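/- \textbf{Setting.} A \emph{bounded $\rho$-function} is a continuous $\rho:\mathbb R\to\mathbb R$ such that $\rho(t)$ is a nondecreasing function of $|t|$, $\rho(0)=0$, $\rho(\infty)=1$, and $\rho(v)<1$ implies $\rho(u)<\rho(v)$ for $|u|<|v|$. Let $\delta\in(0,1)$. Let $\rho_0,\rho_1$ be bounded $\rho$-functions with $\rho_1\le\rho_0$ such that, for $i=0,1$ and some $m_i$, $\rho_i(u)=1$ if and only if $|u|\ge m_i$, and $\log(1-\rho_i)$ is concave on $(-m_i,m_i)$. Write $\psi_i=\rho_i'$ when the derivative exists. For a probability distribution $F$ on $\mathbb R$ and $\alpha\in\mathbb R$ let $S^*(F,\alpha)=\inf\{s>0:\ \mathrm E_F\,\rho_0((u-\alpha)/s)\le\delta\}$ (the solution $s$ of $\mathrm E_F\,\rho_0((u-\alpha)/s)=\delta$, or $0$ if the expectation is at most $\delta$ for every $s>0$), and let $S(F)=\min_\alpha S^*(F,\alpha)$. Let $T_{\mathrm S}(F)$ be any choice of a minimizer of $\alpha\mapsto S^*(F,\alpha)$, let $T_{\mathrm{MM}}(F)$ be any choice of a minimizer of $\alpha\mapsto \mathrm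 E_F\,\rho_1((u-\alpha)/S(F))$ (an arbitrary real number if $S(F)=0$), and let $T=(T_{\mathrm S},T_{\mathrm{MM}},S)$, with values in $\mathbb R^3$. Let $F_0$ be a distribution with a strongly unimodal density $f$: for some $a$, $f$ is nondecreasing on $(-\infty,a)$ and nonincreasing on $(a,\infty)$, $f(t)<f(a)$ for all $t\ne a$, and $f$ is continuous at $a$ from at least one side (choice of the version of the density). Assume moreover that at least one of the following holds: $\log(1-\rho_i)$ is strictly concave on $(-m_i,m_i)$ for $i=0,1$; or $f$ is strictly increasing on $\{t<a: f(t)>0\}$ and strictly decreasing on $\{t>a: f(t)>0\}$. \textbf{Theorem.} Put $\sigma_0=S(F_0)$. Then $\sigma_0>0$ and the following hold. (i) The function $t\mapsto \mathrm E_{F_0}\rho_0((u-t)/\sigma_0)$ has a unique minimizer $\alpha_{00}$, its minimum value is $\delta$, and $T_{\mathrm S}(F_0)=\alpha_{00}$ is the unique minimizer of $S^*(F_0,\cdot)$. If $F_0$ is symmetric around $\mu_0$, then $\alpha_{00}=\mu_0$. (ii) $T_{\mathrm{MM}}(F_0)=\alpha_{01}$ is the unique minimizer of $t\mapsto \mathrm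 E_{F_0}\rho_1((u-t)/\sigma_0)$. If $F_0$ is symmetric around $\mu_0$, then $\alpha_{01}=\mu_0$. (iii) $T$ is weakly continuous at $F_0$, that is, $F_n\to_w F_0$ implies $T(F_n)\to T(F_0)$. For the remaining parts assume also that $\rho_0,\rho_1$ are twice continuously differentiable and that $a_{00}\ne0$, $a_{01}\ne0$, $d_0\ne0$, where $$a_{0i}=\mathrm E_{F_0}\psi_i'\Big(\tfrac{u-\alpha_{0i}}{\sigma_0}\Big),\qquad e_{0i}=\mathrm E_{F_0}\tfrac{u-\alpha_{0i}}{\sigma_0}\,\psi_i'\Big(\tfrac{u-\alpha_{0i}}{\sigma_0}\Big),\qquad d_0=\mathrm E_{F_0}\tfrac{u-\alpha_{00}}{\sigma_0}\,\psi_0\Big(\tfrac{u-\alpha_{00}}{\sigma_0}\Big).$$ (iv) Let $\Psi(y,\theta)=\big(\psi_0(\tfrac{y-\xi_{\mathrm S}}{\sigma}),\ \psi_1(\tfrac{y-\xi_{\mathrm{MM}}}{\sigma}),\ \rho_0(\tfrac{y-\xi_{\mathrm S}}{\sigma})-\delta\big)$ for $\theta=(\xi_{\mathrm S},\xi_{\mathrm{MM}},\sigma)$.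 The $3\times3$ matrix $D_0=\mathrm E_{F_0}\,\partial\Psi(y,\theta)/\partial\theta\,|_{\theta=T(F_0)}$ exists and is invertible. The influence function $I_{T,F_0}(y)=\partial T((1-\varepsilon)F_0+\varepsilon\delta_y)/\partial\varepsilon\,|_{\varepsilon=0^+}$ exists for every $y$ and has the components $$I_{T_{\mathrm S},F_0}(y)=\frac{\sigma_0}{a_{00}}\psi_0\Big(\frac{y-\alpha_{00}}{\sigma_0}\Big)-\frac{e_{00}\sigma_0}{a_{00}d_0}\Big(\rho_0\Big(\frac{y-\alpha_{00}}{\sigma_0}\Big)-\delta\Big),$$ $$I_{T_{\mathrm{MM}},F_0}(y)=\frac{\sigma_0}{a_{01}}\psi_1\Big(\frac{y-\alpha_{01}}{\sigma_0}\Big)-\frac{e_{01}\sigma_0}{a_{01}d_0}\Big(\rho_0\Big(\frac{y-\alpha_{00}}{\sigma_0}\Big)-\delta\Big),\qquad I_{S,F_0}(y)=\frac{\sigma_0}{d_0}\Big(\rho_0\Big(\frac{y-\alpha_{00}}{\sigma_0}\Big)-\delta\Big).$$ (v) Let $\{F_n\}$ be a sequence of random distributions with $F_n\to_w F_0$ a.s.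 Then $T$ is a.s. weakly differentiable at $\{F_n\}$: a.s., $$T(F_n)-T(F_0)=\mathrm E_{F_n}I_{T,F_0}+o\big(\|\mathrm E_{F_n}I_{T,F_0}\|\big).$$ (vi) If $\{F_n\}$ is as in (v) and $n^{1/2}\,\mathrm E_{F_n}I_{T,F_0}\to_d H$, then $n^{1/2}(T(F_n)-T(F_0))=n^{1/2}\,\mathrm E_{F_n}I_{T,F_0}+o_p(1)$, and therefore $n^{1/2}(T(F_n)-T(F_0))\to_d H$ (provided the $T(F_n)$ are random vectors, i.e. measurable). (vii) If $F_n$ is the empirical distribution of the first $n$ of i.i.d. observations with distribution $F_0$, then $n^{1/2}\,\mathrm E_{F_n}I_{T,F_0}\to_d N(0,V)$ with $V=\mathrm E_{F_0}I_{T,F_0}(y)I_{T,F_0}(y)'$, and the conclusions of (vi) hold with $H=N(0,V)$. -/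

import Mathlib

open MeasureTheory ProbabilityTheory Filter Set
open scoped Topology ENNReal

noncomputable section

namespace RobustLocation

/-- Values of the joint functional `(T_S, T_MM, S)`, with the Euclidean norm. -/
abbrev E3 : Type := EuclideanSpace ℝ (Fin 3)

/-- Bounded `ρ`-functions. -/
structure IsBoundedRho (ρ : ℝ → ℝ) : Prop where
  continuous : Continuous ρ
  mono : ∀ u v : ℝ, |u| ≤ |v| → ρ u ≤ ρ v
  zero : ρ 0 = 0
  tendsto_one : Tendsto ρ atTop (𝓝 1)
  strict : ∀ u v : ℝ, ρ v < 1 → |u| < |v| → ρ u < ρ v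

/-- `ρ` reaches the value `1` exactly outside `(-m, m)`, and `log (1 - ρ)` is concave on
`(-m, m)`. -/
def LogConcaveRho (ρ : ℝ → ℝ) (m : ℝ) : Prop :=
  (∀ u : ℝ, ρ u = 1 ↔ m ≤ |u|) ∧
    ConcaveOn ℝ (Ioo (-m) m) (fun u => Real.log (1 - ρ u))

/-- `log (1 - ρ)` is strictly concave on `(-m, m)`. -/
def StrictLogConcaveRho (ρ : ℝ → ℝ) (m : ℝ) : Prop :=
  StrictConcaveOn ℝ (Ioo (-m) m) (fun u => Real.log (1 - ρ u))

/-- `f` is a density of the probability measure `F`. -/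
def IsDensity (F : ProbabilityMeasure ℝ) (f : ℝ → ℝ) : Prop :=
  Measurable f ∧ (∀ t, 0 ≤ f t) ∧
    (F : Measure ℝ) = volume.withDensity (fun t => ENNReal.ofReal (f t))

/-- Strong unimodality of a density `f` with mode `a`. A density is only determined up to null
sets; the last field chooses the value at the mode, so that the unique maximum cannot be produced
by changing `f` at one point. -/
structure StronglyUnimodal (f : ℝ → ℝ) (a : ℝ) : Prop where
  monotone_left : MonotoneOn f (Iio a)
  antitone_right : AntitoneOn f (Ioi a)
  unique_max : ∀ t, t ≠ a → f t < f a
  version : ContinuousWithinAt f (Iio a) a ∨ ContinuousWithinAt f (Ioi a) a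

/-- On the set where `f` is positive, `f` is strictly increasing to the left of `a` and strictly
decreasing to the right of `a`. -/
def StrictOnSupport (f : ℝ → ℝ) (a : ℝ) : Prop :=
  StrictMonoOn f {t | t < a ∧ 0 < f t} ∧ StrictAntiOn f {t | a < t ∧ 0 < f t}

/-- `F` is symmetric around `μ₀`. -/
def IsSymmetricAround (F : ProbabilityMeasure ℝ) (μ₀ : ℝ) : Prop :=
  (F : Measure ℝ).map (fun u => 2 * μ₀ - u) = (F : Measure ℝ)

/-- `E_F ρ((u - t)/σ)`. -/
def mLoss (ρ : ℝ → ℝ) (σ : ℝ) (F : ProbabilityMeasure ℝ) (t : ℝ) : ℝ :=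
  ∫ u, ρ ((u - t) / σ) ∂(F : Measure ℝ)

/-- The residual scale `S*(F, α)`: the solution `s` of `E_F ρ₀((u - α)/s) = δ`. As a function of
`s > 0` the left side is continuous and nonincreasing with limit `0` at infinity, so the solution
is the least `s` at which it is at most `δ`; the scale is `0` when
`E_F ρ₀((u - α)/s) ≤ δ` for all `s > 0`. -/
def residualScale (ρ₀ : ℝ → ℝ) (δ : ℝ) (F : ProbabilityMeasure ℝ) (α : ℝ) : ℝ :=
  sInf {s : ℝ | 0 < s ∧ mLoss ρ₀ s F α ≤ δ}

/-- The error scale functional `S(F)`, the minimum of `S*(F, α)` over `α`. -/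
def scaleFunctional (ρ₀ : ℝ → ℝ) (δ : ℝ) (F : ProbabilityMeasure ℝ) : ℝ :=
  ⨅ α : ℝ, residualScale ρ₀ δ F α

/-- `TS` selects, for every distribution, a minimizer of the residual scale. -/
def IsSFunctional (ρ₀ : ℝ → ℝ) (δ : ℝ) (TS : ProbabilityMeasure ℝ → ℝ) : Prop :=
  ∀ F, IsMinOn (residualScale ρ₀ δ F) univ (TS F)

/-- `TMM` selects, for every distribution with positive scale `S(F)`, a minimizer of
`t ↦ E_F ρ₁((u - t)/S(F))`. -/
def IsMMFunctional (ρ₀ ρ₁ : ℝ → ℝ) (δ : ℝ) (TMM : ProbabilityMeasure ℝ → ℝ) : Prop :=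
  ∀ F, 0 < scaleFunctional ρ₀ δ F →
    IsMinOn (mLoss ρ₁ (scaleFunctional ρ₀ δ F) F) univ (TMM F)

/-- The joint functional `T = (T_S, T_MM, S)`. -/
def jointFunctional (ρ₀ : ℝ → ℝ) (δ : ℝ) (TS TMM : ProbabilityMeasure ℝ → ℝ)
    (F : ProbabilityMeasure ℝ) : E3 :=
  !₂[TS F, TMM F, scaleFunctional ρ₀ δ F]

/-- `a = E_F ψ'((u - α)/σ)`, where `ψ = ρ'`. -/
def aConst (ρ : ℝ → ℝ) (F : ProbabilityMeasure ℝ) (α σ : ℝ) : ℝ :=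
  ∫ u, deriv (deriv ρ) ((u - α) / σ) ∂(F : Measure ℝ)

/-- `e = E_F ((u - α)/σ) ψ'((u - α)/σ)`, where `ψ = ρ'`. -/
def eConst (ρ : ℝ → ℝ) (F : ProbabilityMeasure ℝ) (α σ : ℝ) : ℝ :=
  ∫ u, ((u - α) / σ) * deriv (deriv ρ) ((u - α) / σ) ∂(F : Measure ℝ)

/-- `d = E_F ((u - α)/σ) ψ((u - α)/σ)`, where `ψ = ρ'`. -/
def dConst (ρ : ℝ → ℝ) (F : ProbabilityMeasure ℝ) (α σ : ℝ) : ℝ :=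
  ∫ u, ((u - α) / σ) * deriv ρ ((u - α) / σ) ∂(F : Measure ℝ)

/-- The score of the joint M-functional: with `θ = (ξ_S, ξ_MM, σ)`,
`Ψ(y, θ) = (ψ₀((y - ξ_S)/σ), ψ₁((y - ξ_MM)/σ), ρ₀((y - ξ_S)/σ) - δ)`. -/
def score (ρ₀ ρ₁ : ℝ → ℝ) (δ : ℝ) (y : ℝ) (θ : E3) : E3 :=
  !₂[deriv ρ₀ ((y - θ 0) / θ 2), deriv ρ₁ ((y - θ 1) / θ 2), ρ₀ ((y - θ 0) / θ 2) - δ]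

/-- The matrix of partial derivatives of the score with respect to `θ`. -/
def scoreJacobian (ρ₀ ρ₁ : ℝ → ℝ) (δ : ℝ) (y : ℝ) (θ : E3) : Matrix (Fin 3) (Fin 3) ℝ :=
  Matrix.of fun j k => (fderiv ℝ (score ρ₀ ρ₁ δ y) θ (EuclideanSpace.single k 1)) j

/-- `D(F, θ)`, the entrywise expectation of the Jacobian of the score. -/
def expectedJacobian (ρ₀ ρ₁ : ℝ → ℝ) (δ : ℝ) (F : ProbabilityMeasure ℝ) (θ : E3) :
    Matrix (Fin 3) (Fin 3) ℝ :=
  Matrix.of fun j k => ∫ y, scoreJacobian ρ₀ ρ₁ δ y θ j k ∂(F : Measure ℝ)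

/-- The contaminated distribution `(1 - ε) F + ε δ_z`, for `ε ∈ [0, 1]` (other values of `ε` are
projected to `[0, 1]`). -/
def contaminate (F : ProbabilityMeasure ℝ) (z ε : ℝ) : ProbabilityMeasure ℝ :=
  ⟨ENNReal.ofReal (1 - max 0 (min 1 ε)) • (F : Measure ℝ) +
      ENNReal.ofReal (max 0 (min 1 ε)) • Measure.dirac z, by
    constructor
    have h0 : 0 ≤ max 0 (min 1 ε) := le_max_left _ _
    have h1 : 0 ≤ 1 - max 0 (min 1 ε) :=
      sub_nonneg.2 (max_le zero_le_one (min_le_left _ _))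
    simp only [Measure.coe_add, Measure.coe_smul, Pi.add_apply, Pi.smul_apply, measure_univ,
      smul_eq_mul, mul_one]
    rw [← ENNReal.ofReal_add h1 h0]
    simp⟩

/-- `I` is the influence function of `T` at `F`: the right derivative at `ε = 0` of
`T((1 - ε) F + ε δ_z)` is `I z` for every `z`. -/
def HasInfluenceFunction (T : ProbabilityMeasure ℝ → E3) (F : ProbabilityMeasure ℝ)
    (I : ℝ → E3) : Prop :=
  ∀ z, HasDerivWithinAt (fun ε => T (contaminate F z ε)) (I z) (Ici 0) 0

/-- `T`, weakly continuous at `F₀` and with influence function `I` at `F₀`, is weakly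
differentiable at the sequence `Fₙ`, which converges weakly to `F₀`. -/
structure WeaklyDifferentiableAt (T : ProbabilityMeasure ℝ → E3) (F₀ : ProbabilityMeasure ℝ)
    (I : ℝ → E3) (Fn : ℕ → ProbabilityMeasure ℝ) : Prop where
  continuousAt : ContinuousAt T F₀
  tendsto : Tendsto Fn atTop (𝓝 F₀)
  influence : HasInfluenceFunction T F₀ I
  integrable : ∀ n, Integrable I (Fn n : Measure ℝ)
  expansion : (fun n => T (Fn n) - T F₀ - ∫ y, I y ∂(Fn n : Measure ℝ)) =o[atTop]
    (fun n => ∫ y, I y ∂(Fn n : Measure ℝ))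

/-- The influence function of a location functional with loss `ρ` and centre `α`:
`(σ/a) ψ((y - α)/σ) - (e σ/(a d)) (ρ₀((y - α₀₀)/σ) - δ)`. -/
def locationInfluence (ρ₀ ρ : ℝ → ℝ) (δ : ℝ) (F : ProbabilityMeasure ℝ) (α₀₀ α σ : ℝ)
    (y : ℝ) : ℝ :=
  σ / aConst ρ F α σ * deriv ρ ((y - α) / σ) -
    eConst ρ F α σ * σ / (aConst ρ F α σ * dConst ρ₀ F α₀₀ σ) *
      (ρ₀ ((y - α₀₀) / σ) - δ)

/-- The influence function of the scale: `(σ/d) (ρ₀((y - α₀₀)/σ) - δ)`. -/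
def scaleInfluence (ρ₀ : ℝ → ℝ) (δ : ℝ) (F : ProbabilityMeasure ℝ) (α₀₀ σ : ℝ) (y : ℝ) : ℝ :=
  σ / dConst ρ₀ F α₀₀ σ * (ρ₀ ((y - α₀₀) / σ) - δ)

/-- The influence function of `T = (T_S, T_MM, S)`. -/
def jointInfluence (ρ₀ ρ₁ : ℝ → ℝ) (δ : ℝ) (F : ProbabilityMeasure ℝ) (α₀₀ α₀₁ σ : ℝ)
    (y : ℝ) : E3 :=
  !₂[locationInfluence ρ₀ ρ₀ δ F α₀₀ α₀₀ σ y,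
    locationInfluence ρ₀ ρ₁ δ F α₀₀ α₀₁ σ y,
    scaleInfluence ρ₀ δ F α₀₀ σ y]

/-- `V = E_F I(y) I(y)'`. -/
def influenceCovariance (F : ProbabilityMeasure ℝ) (I : ℝ → E3) : Matrix (Fin 3) (Fin 3) ℝ :=
  Matrix.of fun j k => ∫ y, I y j * I y k ∂(F : Measure ℝ)

/-- The empirical distribution of `x 0, …, x (n - 1)` (a point mass at `0` for `n = 0`). -/
def empirical (x : ℕ → ℝ) (n : ℕ) : ProbabilityMeasure ℝ :=
  if h : n = 0 then ⟨Measure.dirac 0, inferInstance⟩ else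
    ⟨(n : ℝ≥0∞)⁻¹ • ∑ i ∈ Finset.range n, Measure.dirac (x i), by
      constructor
      simp only [Measure.coe_smul, Measure.coe_finsetSum, Pi.smul_apply, Finset.sum_apply,
        measure_univ, Finset.sum_const, Finset.card_range, nsmul_eq_mul, smul_eq_mul, mul_one]
      exact ENNReal.inv_mul_cancel (by exact_mod_cast h) (ENNReal.natCast_ne_top n)⟩

/-- `√n E_{Fₙ} I`. -/
def scaledInfluence (I : ℝ → E3) (Fn : ℕ → ProbabilityMeasure ℝ) (n : ℕ) : E3 :=
  Real.sqrt n • ∫ y, I y ∂(Fn n : Measure ℝ)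

/-- `√n (T(Fₙ) - T(F₀))`. -/
def scaledError (T : ProbabilityMeasure ℝ → E3) (F₀ : ProbabilityMeasure ℝ)
    (Fn : ℕ → ProbabilityMeasure ℝ) (n : ℕ) : E3 :=
  Real.sqrt n • (T (Fn n) - T F₀)

end RobustLocation

end

open RobustLocation

/-! The main object is the kernel `k = 1 - ρ`: continuous, compactly supported, decreasing in `|x|`,
and totally positive of order two because `log (1 - ρ)` is concave
(`LogConcaveRho.isUnimodalKernel`). Minimizing the loss at scale `σ` means maximizing `H t = ∫ k ((u
- t) / σ) dF₀`.

Uniqueness. Absorb `σ` into `k` and slice the density into superlevel intervals with endpoints `l s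
≤ a ≤ r s`. Then `H' = A - B` with `A t = ∫ k (l s - t) ds` and `B t = ∫ k (r s - t) ds`. Total
positivity makes `A t / k (a - t)` nonincreasing and `B t / k (a - t)` nondecreasing where `k (a -
t) > 0`, and all maximizers lie there. The ratios agree at every maximizer, so two maximizers force
equality in the total positivity inequality at almost every endpoint. Strict log-concavity excludes
this near the mode. If instead `f` is strictly monotone on its support, the equality spreads to the
whole support and makes several distinct points the midpoint of the two maximizers
(`StronglyUnimodal.eq_of_isMaxOn`).

Continuity. The loss is jointly continuous in distribution, location and scale, and tends to `1`
when the location escapes to infinity. Locations with loss bounded away from `1` therefore converge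
along ultrafilters, and uniqueness identifies the limit (`tendsto_of_mLoss_le`). The S functional
fits this scheme because it minimizes the loss at the fixed scale `S(F)`, with value `δ`.

Differentiability. The derivatives of the score components are compactly supported, so their
first-order expansions are uniform in the observation and can be integrated against any `F` weakly
close to `F₀`. The estimating equations become a linear system, triangular because `ψ₀` has mean
zero at `F₀`. Solving it gives `T(F) - T(F₀) - ∫ I dF = o(∫ I dF)` as `F → F₀`
(`isLittleO_jointFunctional_sub`). This one expansion yields the influence function, weak
differentiability and, with tightness, the limit law; the strong law and the central limit theorem
supply the i.i.d. case. -/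

namespace RobustLocation

/-! ### Location-scale integrals of compactly supported kernels -/

section Kernel

variable {g : ℝ → ℝ} {m : ℝ}

lemma hasCompactSupport_of_eq_zero (hm : ∀ x, m ≤ |x| → g x = 0) : HasCompactSupport g := by
  refine HasCompactSupport.intro (isCompact_Icc (a := -m) (b := m)) fun x hx => hm x ?_
  by_contra! h
  exact hx ⟨(abs_lt.1 h).1.le, (abs_lt.1 h).2.le⟩

lemma exists_bound_of_eq_zero (hg : Continuous g) (hm : ∀ x, m ≤ |x| → g x = 0) :
    ∃ C, 0 ≤ C ∧ ∀ x, |g x| ≤ C := by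
  obtain ⟨C, hC⟩ := hg.bounded_above_of_compact_support (hasCompactSupport_of_eq_zero hm)
  exact ⟨C, (norm_nonneg _).trans (hC 0), hC⟩

lemma integrable_of_continuous_of_bound {μ : Measure ℝ} [IsFiniteMeasure μ] (hg : Continuous g)
    {C : ℝ} (hC : ∀ x, |g x| ≤ C) : Integrable g μ :=
  Integrable.of_bound hg.aestronglyMeasurable C (ae_of_all _ hC)

lemma integrable_locScale {μ : Measure ℝ} [IsFiniteMeasure μ] (hg : Continuous g)
    (hm : ∀ x, m ≤ |x| → g x = 0) (t s : ℝ) : Integrable (fun u => g ((u - t) / s)) μ := by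
  obtain ⟨C, -, hC⟩ := exists_bound_of_eq_zero hg hm
  exact integrable_of_continuous_of_bound (C := C) (by fun_prop) fun x => hC _

/-- Weak convergence tested against a bounded continuous function. -/
lemma continuous_integral_of_bound (hg : Continuous g) {C : ℝ} (hC : ∀ x, |g x| ≤ C) :
    Continuous fun F : ProbabilityMeasure ℝ => ∫ u, g u ∂(F : Measure ℝ) :=
  ProbabilityMeasure.continuous_integral_boundedContinuousFunction
    (BoundedContinuousFunction.ofNormedAddCommGroup g hg C hC)

/-- One radius `R` serves all parameters near `(t₀, s₀)`, so uniformity in `u` reduces to a compact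
interval. -/
lemma locScale_eq_zero {t₀ s₀ t s u R : ℝ} (hm0 : 0 ≤ m) (hm : ∀ x, m ≤ |x| → g x = 0)
    (hs0 : 0 < s) (hs : s ≤ 2 * s₀) (hu : R ≤ |u|)
    (ht : |t - t₀| ≤ 1) (hR : |t₀| + 1 + 2 * s₀ * m ≤ R) :
    g ((u - t) / s) = 0 := by
  apply hm
  rw [abs_div, abs_of_pos hs0, le_div_iff₀ hs0]
  have h1 : |u| ≤ |u - t| + |t| := by
    simpa using abs_add_le (u - t) t
  have h2 : |t| ≤ |t - t₀| + |t₀| := by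
    simpa using abs_add_le (t - t₀) t₀
  nlinarith

/-- Location-scale translates of a compactly supported kernel depend continuously on the
parameters in the uniform norm. -/
lemma eventually_locScale_sub_le (hg : Continuous g) (hm : ∀ x, m ≤ |x| → g x = 0)
    (t₀ : ℝ) {s₀ : ℝ} (hs₀ : 0 < s₀) {ε : ℝ} (hε : 0 < ε) :
    ∀ᶠ p : ℝ × ℝ in 𝓝 (t₀, s₀), ∀ u, |g ((u - p.1) / p.2) - g ((u - t₀) / s₀)| ≤ ε := by
  -- A negative `m` means that `g` vanishes identically, and then `0` is an admissible radius as
  -- well.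
  wlog hm0 : 0 ≤ m generalizing m
  · exact this (m := 0) (fun x hx => hm x (by linarith)) le_rfl
  set R := |t₀| + 1 + 2 * s₀ * m with hR
  have hK : ∀ᶠ p : ℝ × ℝ in 𝓝 (t₀, s₀), ∀ u ∈ Icc (-R) R,
      |g ((u - p.1) / p.2) - g ((u - t₀) / s₀)| < ε := by
    refine isCompact_Icc.eventually_forall_of_forall_eventually fun u _ => ?_
    have hc : ContinuousAt (fun z : (ℝ × ℝ) × ℝ =>
        |g ((z.2 - z.1.1) / z.1.2) - g ((z.2 - t₀) / s₀)|) ((t₀, s₀), u) := by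
      refine ContinuousAt.abs (ContinuousAt.sub ?_ (by fun_prop))
      refine hg.continuousAt.comp (ContinuousAt.div (by fun_prop) (by fun_prop) hs₀.ne')
    have h0 := hc.tendsto
    simp only [sub_self, abs_zero] at h0
    exact h0.eventually (gt_mem_nhds hε)
  have h1 : ∀ᶠ p : ℝ × ℝ in 𝓝 (t₀, s₀), |p.1 - t₀| ≤ 1 := by
    have : ContinuousAt (fun p : ℝ × ℝ => |p.1 - t₀|) (t₀, s₀) := by fun_prop
    exact (this.tendsto.eventually_lt_const (u := 1) (by simp)).mono fun _ h => le_of_lt h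
  have h2 : ∀ᶠ p : ℝ × ℝ in 𝓝 (t₀, s₀), 0 < p.2 ∧ p.2 ≤ 2 * s₀ := by
    have : ContinuousAt (fun p : ℝ × ℝ => p.2) (t₀, s₀) := by fun_prop
    exact (this.tendsto.eventually_const_lt hs₀).and
      ((this.tendsto.eventually_lt_const (u := 2 * s₀) (by dsimp only; linarith)).mono
        fun _ h => le_of_lt h)
  filter_upwards [hK, h1, h2] with p hp h1 h2 u
  by_cases hu : u ∈ Icc (-R) R
  · exact (hp u hu).le
  · have hu' : R ≤ |u| := by
      by_contra! h
      exact hu ⟨(abs_lt.1 h).1.le, (abs_lt.1 h).2.le⟩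
    rw [locScale_eq_zero hm0 hm h2.1 h2.2 hu' h1 hR.ge,
      locScale_eq_zero hm0 hm hs₀ (by linarith) hu' (by simp) hR.ge]
    simpa using hε.le

lemma abs_integral_sub_le {F : ProbabilityMeasure ℝ} {a b : ℝ → ℝ} {ε : ℝ}
    (ha : Integrable a (F : Measure ℝ)) (hb : Integrable b (F : Measure ℝ))
    (h : ∀ u, |a u - b u| ≤ ε) :
    |∫ u, a u ∂(F : Measure ℝ) - ∫ u, b u ∂(F : Measure ℝ)| ≤ ε := by
  rw [← integral_sub ha hb]
  have := norm_integral_le_of_norm_le_const (μ := (F : Measure ℝ))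
    (f := fun u => a u - b u) (C := ε) (ae_of_all _ h)
  simpa using this

/-- The expectation of a location-scale kernel is jointly continuous in the distribution (for the
weak topology) and the parameters. -/
lemma continuousAt_integral_locScale (hg : Continuous g) (hm : ∀ x, m ≤ |x| → g x = 0)
    (F₀ : ProbabilityMeasure ℝ) (t₀ : ℝ) {s₀ : ℝ} (hs₀ : 0 < s₀) :
    ContinuousAt (fun p : ProbabilityMeasure ℝ × ℝ × ℝ =>
      ∫ u, g ((u - p.2.1) / p.2.2) ∂(p.1 : Measure ℝ)) (F₀, t₀, s₀) := by
  obtain ⟨C, -, hC⟩ := exists_bound_of_eq_zero hg hm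
  have hF : Continuous fun F : ProbabilityMeasure ℝ => ∫ u, g ((u - t₀) / s₀) ∂(F : Measure ℝ) :=
    continuous_integral_of_bound (C := C) (by fun_prop) fun x => hC _
  rw [ContinuousAt, Metric.tendsto_nhds]
  intro ε hε
  -- Moving the parameters costs at most `ε / 2` uniformly in `u`, hence under every distribution;
  -- moving the distribution at fixed parameters is weak convergence.
  have h1 : ∀ᶠ p : ProbabilityMeasure ℝ × ℝ × ℝ in 𝓝 (F₀, t₀, s₀),
      ∀ u, |g ((u - p.2.1) / p.2.2) - g ((u - t₀) / s₀)| ≤ ε / 2 :=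
    (continuous_snd.tendsto (F₀, t₀, s₀)).eventually
      (eventually_locScale_sub_le hg hm t₀ hs₀ (half_pos hε))
  have h2 : ∀ᶠ p : ProbabilityMeasure ℝ × ℝ × ℝ in 𝓝 (F₀, t₀, s₀),
      dist (∫ u, g ((u - t₀) / s₀) ∂(p.1 : Measure ℝ))
        (∫ u, g ((u - t₀) / s₀) ∂(F₀ : Measure ℝ)) < ε / 2 :=
    (hF.comp continuous_fst).continuousAt.eventually (Metric.ball_mem_nhds _ (half_pos hε))
  filter_upwards [h1, h2] with p h1 h2
  refine (dist_triangle _ _ _).trans_lt ((add_lt_add_of_le_of_lt ?_ h2).trans_eq (add_halves ε))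
  exact abs_integral_sub_le (integrable_locScale hg hm _ _) (integrable_locScale hg hm _ _) h1

/-- The expectation of a location-scale kernel vanishes as the location escapes to infinity,
locally uniformly in the distribution and the scale. -/
lemma tendsto_integral_locScale_cocompact (hg : Continuous g) (hm : ∀ x, m ≤ |x| → g x = 0)
    (F₀ : ProbabilityMeasure ℝ) {s₀ : ℝ} (hs₀ : 0 < s₀) :
    Tendsto (fun p : ProbabilityMeasure ℝ × ℝ × ℝ =>
      ∫ u, g ((u - p.2.1) / p.2.2) ∂(p.1 : Measure ℝ)) (𝓝 F₀ ×ˢ cocompact ℝ ×ˢ 𝓝 s₀) (𝓝 0) := by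
  wlog hm0 : 0 ≤ m generalizing m
  · exact this (m := 0) (fun x hx => hm x (by linarith)) le_rfl
  obtain ⟨C, hC0, hC⟩ := exists_bound_of_eq_zero hg hm
  -- piecewise linear cutoffs
  let χ : ℕ → ℝ → ℝ := fun n u => max 0 (min 1 (n + 1 - |u|))
  have hχc : ∀ n, Continuous (χ n) := fun n => by fun_prop
  have hχ0 : ∀ n u, 0 ≤ χ n u := fun n u => le_max_left _ _
  have hχ1 : ∀ n u, χ n u ≤ 1 := fun n u => max_le zero_le_one (min_le_left _ _)
  have hχb : ∀ n u, |χ n u| ≤ 1 := fun n u => by rw [abs_of_nonneg (hχ0 n u)]; exact hχ1 n u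
  have hχi : ∀ n (F : ProbabilityMeasure ℝ), Integrable (χ n) (F : Measure ℝ) := fun n F =>
    integrable_of_continuous_of_bound (hχc n) (hχb n)
  have hlim : Tendsto (fun n => ∫ u, χ n u ∂(F₀ : Measure ℝ)) atTop (𝓝 1) := by
    have : Tendsto (fun n => ∫ u, χ n u ∂(F₀ : Measure ℝ)) atTop
        (𝓝 (∫ _, (1 : ℝ) ∂(F₀ : Measure ℝ))) := by
      refine tendsto_integral_of_dominated_convergence (fun _ => 1)
        (fun n => (hχc n).aestronglyMeasurable) (integrable_const _)
        (fun n => ae_of_all _ (hχb n)) (ae_of_all _ fun u => ?_)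
      refine tendsto_const_nhds.congr' ?_
      filter_upwards [eventually_ge_atTop ⌈|u|⌉₊] with n hn
      have : |u| ≤ n := Nat.ceil_le.1 hn
      simp only [χ]
      rw [min_eq_left (by linarith), max_eq_right zero_le_one]
    simpa using this
  rw [Metric.tendsto_nhds]
  intro ε hε
  -- The denominator is `C + 1` because `C` may be zero.
  obtain ⟨n, hn⟩ := (hlim.eventually (lt_mem_nhds (a := 1 - ε / (C + 1))
    (by have : 0 < ε / (C + 1) := by positivity
        linarith))).exists
  have hF : ∀ᶠ F : ProbabilityMeasure ℝ in 𝓝 F₀,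
      1 - ε / (C + 1) < ∫ u, χ n u ∂(F : Measure ℝ) :=
    (continuous_integral_of_bound (hχc n) (hχb n)).continuousAt.eventually (lt_mem_nhds hn)
  have ht : ∀ᶠ t : ℝ in cocompact ℝ, n + 1 + 2 * s₀ * m ≤ |t| :=
    tendsto_norm_cocompact_atTop.eventually_ge_atTop _
  have hs : ∀ᶠ s : ℝ in 𝓝 s₀, 0 < s ∧ s < 2 * s₀ :=
    (lt_mem_nhds hs₀).and (gt_mem_nhds (by linarith))
  filter_upwards [hF.prod_mk (ht.prod_mk hs)] with p hp
  obtain ⟨hF, ht, hs0, hs2⟩ := hp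
  rw [Real.dist_eq, sub_zero]
  -- For `|u| < n + 1` the location is so remote that the kernel vanishes; for larger `|u|` the
  -- cutoff vanishes and the bound `C` suffices.
  have hle : ∀ u, |g ((u - p.2.1) / p.2.2)| ≤ C * (1 - χ n u) := by
    intro u
    rcases le_or_gt ((n : ℝ) + 1) |u| with hu | hu
    · have : χ n u = 0 := by
        simp only [χ]
        exact max_eq_left ((min_le_right _ _).trans (by linarith))
      rw [this, sub_zero, mul_one]
      exact hC _
    · have : g ((u - p.2.1) / p.2.2) = 0 := by
        apply hm
        rw [abs_div, abs_of_pos hs0, le_div_iff₀ hs0]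
        have h1 : |p.2.1| ≤ |u - p.2.1| + |u| := by
          rw [abs_sub_comm]
          simpa using abs_add_le (p.2.1 - u) u
        nlinarith
      rw [this, abs_zero]
      exact mul_nonneg hC0 (by linarith [hχ1 n u])
  calc |∫ u, g ((u - p.2.1) / p.2.2) ∂(p.1 : Measure ℝ)|
      ≤ ∫ u, |g ((u - p.2.1) / p.2.2)| ∂(p.1 : Measure ℝ) := abs_integral_le_integral_abs
    _ ≤ ∫ u, C * (1 - χ n u) ∂(p.1 : Measure ℝ) :=
        integral_mono (integrable_locScale hg hm _ _).abs
          (((integrable_const _).sub (hχi n _)).const_mul _) hle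
    _ = C * (1 - ∫ u, χ n u ∂(p.1 : Measure ℝ)) := by
        rw [integral_const_mul, integral_sub (integrable_const _) (hχi n _)]
        simp
    _ ≤ C * (ε / (C + 1)) := by gcongr; linarith
    _ < ε := by
        rw [← mul_div_assoc, div_lt_iff₀ (by positivity)]
        nlinarith

end Kernel

/-- Continuous kernels supported on `[-w, w]`, strictly decreasing in `|x|` on `(-w, w)` and
log-concave (totally positive of order two). -/
structure IsUnimodalKernel (k : ℝ → ℝ) (w : ℝ) : Prop where
  continuous : Continuous k
  zero_of_le : ∀ x, w ≤ |x| → k x = 0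
  pos_of_lt : ∀ x, |x| < w → 0 < k x
  anti : ∀ x y, |x| ≤ |y| → k y ≤ k x
  strict : ∀ x y, |x| < |y| → |x| < w → k y < k x
  tp2 : ∀ p q r s, p ≤ q → p ≤ r → p + s = q + r → k p * k s ≤ k q * k r

namespace IsUnimodalKernel

variable {k : ℝ → ℝ} {w : ℝ} (hk : IsUnimodalKernel k w)
include hk

lemma nonneg (x : ℝ) : 0 ≤ k x := by
  rcases le_or_gt w |x| with h | h
  · exact (hk.zero_of_le x h).ge
  · exact (hk.pos_of_lt x h).le

lemma even (x : ℝ) : k (-x) = k x :=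
  le_antisymm (hk.anti _ _ (abs_neg x).ge) (hk.anti _ _ (abs_neg x).le)

lemma le_zero (x : ℝ) : k x ≤ k 0 := hk.anti _ _ (by simp)

lemma abs_le (x : ℝ) : |k x| ≤ k 0 := by
  rw [abs_of_nonneg (hk.nonneg x)]
  exact hk.le_zero x

lemma abs_eq_of_eq {x y : ℝ} (hx : |x| < w) (hy : |y| < w) (h : k x = k y) : |x| = |y| := by
  rcases lt_trichotomy |x| |y| with h1 | h1 | h1
  · exact absurd h (hk.strict _ _ h1 hx).ne'
  · exact h1
  · exact absurd h (hk.strict _ _ h1 hy).ne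

end IsUnimodalKernel

/-! ### Convolution with a unimodal function, through the endpoints of its level sets -/

section Mixture

variable {S : Type*} [MeasurableSpace S] {ν : Measure S} [IsFiniteMeasure ν] {k : ℝ → ℝ} {w a : ℝ}
  {l r : S → ℝ}

lemma IsUnimodalKernel.integrable_comp (hk : IsUnimodalKernel k w) (hl : AEMeasurable l ν) (t : ℝ) :
    Integrable (fun s => k (l s - t)) ν :=
  Integrable.of_bound
    (hk.continuous.measurable.comp_aemeasurable (hl.sub_const t)).aestronglyMeasurable (k 0)
    (ae_of_all _ fun _ => hk.abs_le _)

lemma IsUnimodalKernel.continuous_integral (hk : IsUnimodalKernel k w) (hl : AEMeasurable l ν) :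
    Continuous fun t => ∫ s, k (l s - t) ∂ν := by
  refine continuous_of_dominated (bound := fun _ => k 0)
    (fun t => (hk.integrable_comp hl t).aestronglyMeasurable)
    (fun t => ae_of_all _ fun _ => hk.abs_le _) (integrable_const _) (ae_of_all _ fun s => ?_)
  have := hk.continuous
  fun_prop

/-- Endpoints of the level sets of a unimodal function with mode `a`: they lie on the two sides of
`a`, come arbitrarily close to `a`, and at least one of them is almost surely not `a`. -/
structure IsLevelEndpoints (ν : Measure S) (l r : S → ℝ) (a : ℝ) : Prop where
  left_meas : AEMeasurable l ν
  right_meas : AEMeasurable r ν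
  left_le : ∀ᵐ s ∂ν, l s ≤ a
  le_right : ∀ᵐ s ∂ν, a ≤ r s
  left_near : ∀ ε > 0, ν {s | a - ε < l s} ≠ 0
  right_near : ∀ ε > 0, ν {s | r s < a + ε} ≠ 0
  strict : (∀ᵐ s ∂ν, l s < a) ∨ ∀ᵐ s ∂ν, a < r s

omit [IsFiniteMeasure ν] in
lemma IsLevelEndpoints.reflect (h : IsLevelEndpoints ν l r a) :
    IsLevelEndpoints ν (fun s => -r s) (fun s => -l s) (-a) where
  left_meas := h.right_meas.neg
  right_meas := h.left_meas.neg
  left_le := h.le_right.mono fun s hs => by linarith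
  le_right := h.left_le.mono fun s hs => by linarith
  left_near ε hε := by
    have e : {s | -a - ε < -r s} = {s | r s < a + ε} := by
      ext s
      exact ⟨fun h => by simp only [mem_ofPred_eq] at h ⊢; linarith,
        fun h => by simp only [mem_ofPred_eq] at h ⊢; linarith⟩
    rw [e]
    exact h.right_near ε hε
  right_near ε hε := by
    have e : {s | -l s < -a + ε} = {s | a - ε < l s} := by
      ext s
      exact ⟨fun h => by simp only [mem_ofPred_eq] at h ⊢; linarith,
        fun h => by simp only [mem_ofPred_eq] at h ⊢; linarith⟩
    rw [e]
    exact h.left_near ε hε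
  strict := h.strict.symm.imp (fun h => h.mono fun s hs => by linarith)
    (fun h => h.mono fun s hs => by linarith)

/-- The derivative of the convolution of a kernel with the unimodal function whose level sets have
endpoints `l` and `r`. -/
noncomputable def mixtureDeriv (ν : Measure S) (k : ℝ → ℝ) (l r : S → ℝ) (t : ℝ) : ℝ :=
  ∫ s, k (l s - t) ∂ν - ∫ s, k (r s - t) ∂ν

omit [IsFiniteMeasure ν] in
lemma mixtureDeriv_reflect (hk : IsUnimodalKernel k w) (t : ℝ) :
    mixtureDeriv ν k (fun s => -r s) (fun s => -l s) (-t) = - mixtureDeriv ν k l r t := by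
  unfold mixtureDeriv
  have h : ∀ x : ℝ, k (-x - -t) = k (x - t) := fun x => by
    rw [← hk.even]; congr 1; ring
  simp_rw [h]
  ring

omit [IsFiniteMeasure ν] in
-- Every right endpoint is at distance at least `w` from such a `t`, so only the nonnegative left
-- integral survives.
lemma mixtureDeriv_nonneg (hk : IsUnimodalKernel k w) (h : IsLevelEndpoints ν l r a) {t : ℝ}
    (ht : t ≤ a - w) : 0 ≤ mixtureDeriv ν k l r t := by
  have hB : ∫ s, k (r s - t) ∂ν = 0 := by
    refine integral_eq_zero_of_ae (h.le_right.mono fun s hs => hk.zero_of_le _ ?_)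
    exact le_trans (by linarith) (le_abs_self _)
  rw [mixtureDeriv, hB, sub_zero]
  exact integral_nonneg fun s => hk.nonneg _

/-- Integrated total positivity at `l ≤ a`: the left integral divided by `k (a - t)` is
nonincreasing in `t`. Cross-multiplication avoids dividing where `k (a - t)` is zero. -/
lemma left_ratio_le (hk : IsUnimodalKernel k w) (h : IsLevelEndpoints ν l r a) {t₁ t₂ : ℝ}
    (ht : t₁ ≤ t₂) :
    (∫ s, k (l s - t₂) ∂ν) * k (a - t₁) ≤ (∫ s, k (l s - t₁) ∂ν) * k (a - t₂) := by
  rw [← integral_mul_const, ← integral_mul_const]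
  refine integral_mono_ae ((hk.integrable_comp h.left_meas _).mul_const _)
    ((hk.integrable_comp h.left_meas _).mul_const _) (h.left_le.mono fun s hs => ?_)
  exact hk.tp2 _ _ _ _ (by linarith) (by linarith) (by ring)

/-- The mirror image of `left_ratio_le`: the right ratio is nondecreasing. -/
lemma right_ratio_le (hk : IsUnimodalKernel k w) (h : IsLevelEndpoints ν l r a) {t₁ t₂ : ℝ}
    (ht : t₁ ≤ t₂) :
    (∫ s, k (r s - t₁) ∂ν) * k (a - t₂) ≤ (∫ s, k (r s - t₂) ∂ν) * k (a - t₁) := by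
  rw [← integral_mul_const, ← integral_mul_const]
  refine integral_mono_ae ((hk.integrable_comp h.right_meas _).mul_const _)
    ((hk.integrable_comp h.right_meas _).mul_const _) (h.le_right.mono fun s hs => ?_)
  dsimp only
  rw [mul_comm (k (r s - t₁)), mul_comm (k (r s - t₂))]
  exact hk.tp2 _ _ _ _ (by linarith) (by linarith) (by ring)

/-- At `a - w` the right integral is zero, so continuity suffices if the left one is positive.
Otherwise the left endpoints near `a` coincide with `a` and form an atom; the right endpoints then
avoid `a`, and those close enough to matter have smaller mass than the atom. -/
lemma exists_mixtureDeriv_pos (hk : IsUnimodalKernel k w) (hw : 0 < w)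
    (h : IsLevelEndpoints ν l r a) :
    ∃ η > 0, ∀ t ∈ Ioo (a - w) (a - w + η), 0 < mixtureDeriv ν k l r t := by
  have hBint := fun t => hk.integrable_comp h.right_meas t
  have hAint := fun t => hk.integrable_comp h.left_meas t
  by_cases hA : 0 < ∫ s, k (l s - (a - w)) ∂ν
  · have hB : ∫ s, k (r s - (a - w)) ∂ν = 0 := by
      refine integral_eq_zero_of_ae (h.le_right.mono fun s hs => hk.zero_of_le _ ?_)
      exact le_trans (by linarith) (le_abs_self _)
    have hc : Continuous (mixtureDeriv ν k l r) :=
      (hk.continuous_integral h.left_meas).sub (hk.continuous_integral h.right_meas)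
    have hpos : 0 < mixtureDeriv ν k l r (a - w) := by
      rw [mixtureDeriv, hB, sub_zero]; exact hA
    obtain ⟨η, hη, hball⟩ := Metric.mem_nhds_iff.1 (hc.continuousAt.eventually (lt_mem_nhds hpos))
    refine ⟨η, hη, fun t ht => hball ?_⟩
    rw [Metric.mem_ball, Real.dist_eq, abs_lt]
    constructor <;> linarith [ht.1, ht.2]
  · have hA0 : ∫ s, k (l s - (a - w)) ∂ν = 0 :=
      le_antisymm (not_lt.1 hA) (integral_nonneg fun s => hk.nonneg _)
    have hA1 : ∀ᵐ s ∂ν, k (l s - (a - w)) = 0 :=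
      (integral_eq_zero_iff_of_nonneg (fun s => hk.nonneg _) (hAint _)).1 hA0
    -- left endpoints within `2 w` of the mode coincide with it
    have hla : ∀ᵐ s ∂ν, a - 2 * w < l s → l s = a := by
      filter_upwards [hA1, h.left_le] with s h1 h2 h3
      by_contra hne
      have : l s < a := lt_of_le_of_ne h2 hne
      exact (hk.pos_of_lt _ (abs_lt.2 ⟨by linarith, by linarith⟩)).ne' h1
    have hνl : ν {s | l s = a} ≠ 0 := by
      intro h0
      refine h.left_near (2 * w) (by linarith) (measure_mono_null_ae ?_ h0)
      filter_upwards [hla] with s hs using hs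
    have hra : ∀ᵐ s ∂ν, a < r s := by
      refine h.strict.resolve_left fun hlt => hνl ?_
      rw [← nonpos_iff_eq_zero]
      exact (measure_mono_null (fun s (hs : l s = a) => hs.not_lt) (ae_iff.1 hlt)).le
    let L : ℝ := ν.real {s | l s = a}
    have hL : 0 < L := ENNReal.toReal_pos hνl (measure_ne_top _ _)
    have hnl : NullMeasurableSet {s | l s = a} ν :=
      nullMeasurableSet_eq_fun h.left_meas aemeasurable_const
    -- right endpoints are rarely close to the mode
    have htend : Tendsto (fun n : ℕ => ν {s | r s < a + 1 / ((n : ℝ) + 1)}) atTop (𝓝 0) := by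
      have hmeas : ∀ n : ℕ, NullMeasurableSet {s | r s < a + 1 / ((n : ℝ) + 1)} ν := fun n =>
        nullMeasurableSet_lt h.right_meas aemeasurable_const
      have := tendsto_measure_iInter_atTop (μ := ν) hmeas (fun i j hij s hs => ?_)
        ⟨0, measure_ne_top _ _⟩
      · have h0 : ν (⋂ n : ℕ, {s | r s < a + 1 / ((n : ℝ) + 1)}) = 0 := by
          rw [measure_eq_zero_iff_ae_notMem]
          filter_upwards [hra] with s hs hmem
          obtain ⟨n, hn⟩ := exists_nat_one_div_lt (sub_pos.2 hs)
          have := mem_iInter.1 hmem n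
          simp only [mem_ofPred_eq] at this
          linarith
        rw [h0] at this
        exact this
      · simp only [mem_ofPred_eq] at hs ⊢
        refine hs.trans_le ?_
        gcongr
    obtain ⟨n, hn⟩ := (htend.eventually_lt_const (pos_iff_ne_zero.2 hνl)).exists
    have hR : ν.real {s | r s < a + 1 / ((n : ℝ) + 1)} < L :=
      (ENNReal.toReal_lt_toReal (measure_ne_top _ _) (measure_ne_top _ _)).2 hn
    -- The bound `w` keeps `t` below `a`; the bound `1 / (n + 1)` keeps right endpoints beyond `a +
    -- 1 / (n + 1)` outside the support of the translated kernel.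
    refine ⟨min w (1 / ((n : ℝ) + 1)), lt_min hw (by positivity), fun t ht => ?_⟩
    have ht1 : t < a := by linarith [ht.2, min_le_left w (1 / ((n : ℝ) + 1))]
    have ht2 : t + w < a + 1 / ((n : ℝ) + 1) := by
      linarith [ht.2, min_le_right w (1 / ((n : ℝ) + 1))]
    have hkpos : 0 < k (a - t) := hk.pos_of_lt _ (abs_lt.2 ⟨by linarith, by linarith [ht.1]⟩)
    have hAge : L * k (a - t) ≤ ∫ s, k (l s - t) ∂ν := by
      calc L * k (a - t) = ∫ s in {s | l s = a}, k (l s - t) ∂ν := by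
            rw [setIntegral_congr_fun₀ (g := fun _ => k (a - t)) hnl
              (fun s (hs : l s = a) => by simp only [hs])]
            simp [L]
        _ ≤ ∫ s, k (l s - t) ∂ν :=
            setIntegral_le_integral (hAint t) (ae_of_all _ fun s => hk.nonneg _)
    have hBle : ∫ s, k (r s - t) ∂ν ≤ ν.real {s | r s < a + 1 / ((n : ℝ) + 1)} * k (a - t) := by
      have hnr : NullMeasurableSet {s | r s < a + 1 / ((n : ℝ) + 1)} ν :=
        nullMeasurableSet_lt h.right_meas aemeasurable_const
      have e : ν.real {s | r s < a + 1 / ((n : ℝ) + 1)} * k (a - t) =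
          ∫ s, ({s | r s < a + 1 / ((n : ℝ) + 1)}.indicator fun _ => k (a - t)) s ∂ν := by
        rw [integral_indicator₀ hnr]; simp
      rw [e]
      refine integral_mono_ae (hBint t)
        ((integrable_const _).indicator₀ hnr) ?_
      filter_upwards [h.le_right] with s hs
      by_cases hs' : s ∈ {s | r s < a + 1 / ((n : ℝ) + 1)}
      · rw [indicator_of_mem hs']
        apply hk.anti
        rw [abs_of_nonneg (by linarith), abs_of_nonneg (by linarith)]
        linarith
      · rw [indicator_of_notMem hs', hk.zero_of_le]
        rw [abs_of_nonneg (by linarith)]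
        have : a + 1 / ((n : ℝ) + 1) ≤ r s := not_lt.1 hs'
        linarith
    have := mul_lt_mul_of_pos_right hR hkpos
    unfold mixtureDeriv
    linarith

/-- `H` is nondecreasing up to `a - w` and strictly increasing just after it, so no point at or
below `a - w` is maximal. -/
lemma lt_of_isMaxOn_mixture (hk : IsUnimodalKernel k w) (hw : 0 < w) (h : IsLevelEndpoints ν l r a)
    {H : ℝ → ℝ} (hH : ∀ t, HasDerivAt H (mixtureDeriv ν k l r t) t) {t : ℝ}
    (ht : IsMaxOn H univ t) : a - w < t := by
  by_contra! hle
  obtain ⟨η, hη, hpos⟩ := exists_mixtureDeriv_pos hk hw h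
  have hcont : Continuous H := continuous_iff_continuousAt.2 fun t => (hH t).continuousAt
  have h1 : H t ≤ H (a - w) := by
    have : MonotoneOn H (Iic (a - w)) := by
      refine monotoneOn_of_deriv_nonneg (convex_Iic _) hcont.continuousOn
        (fun x _ => (hH x).differentiableAt.differentiableWithinAt) fun x hx => ?_
      rw [(hH x).deriv]
      rw [interior_Iic] at hx
      exact mixtureDeriv_nonneg hk h (le_of_lt hx)
    exact this hle (mem_Iic.2 le_rfl) hle
  have h2 : H (a - w) < H (a - w + η / 2) := by
    have : StrictMonoOn H (Icc (a - w) (a - w + η / 2)) := by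
      refine strictMonoOn_of_deriv_pos (convex_Icc _ _) hcont.continuousOn fun x hx => ?_
      rw [(hH x).deriv]
      rw [interior_Icc] at hx
      exact hpos x ⟨hx.1, by linarith [hx.2]⟩
    exact this ⟨le_rfl, by linarith⟩ ⟨by linarith, le_rfl⟩ (by linarith)
  have h3 : H (a - w + η / 2) ≤ H t := ht (mem_univ _)
  linarith

/-- The upper bound is the lower bound for the reflected problem, in which left and right endpoints
change roles. -/
lemma abs_sub_lt_of_isMaxOn_mixture (hk : IsUnimodalKernel k w) (hw : 0 < w)
    (h : IsLevelEndpoints ν l r a)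
    {H : ℝ → ℝ} (hH : ∀ t, HasDerivAt H (mixtureDeriv ν k l r t) t) {t : ℝ}
    (ht : IsMaxOn H univ t) : |a - t| < w := by
  have h1 := lt_of_isMaxOn_mixture hk hw h hH ht
  have h2 : -a - w < -t := by
    refine lt_of_isMaxOn_mixture (H := fun t => H (-t)) hk hw h.reflect (fun x => ?_) ?_
    · have := (hH (-x)).comp x (hasDerivAt_neg x)
      have e := mixtureDeriv_reflect (ν := ν) (l := l) (r := r) hk (-x)
      rw [neg_neg] at e
      rw [e]
      simpa [Function.comp_def] using this
    · intro x _
      have := ht (mem_univ (-x))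
      simpa using this
  rw [abs_lt]
  constructor <;> linarith

/-- Two maximizers force equality in the total positivity inequalities at all endpoints. -/
lemma ae_eq_of_isMaxOn_mixture (hk : IsUnimodalKernel k w)
    (h : IsLevelEndpoints ν l r a)
    {H : ℝ → ℝ} (hH : ∀ t, HasDerivAt H (mixtureDeriv ν k l r t) t) {t₁ t₂ : ℝ} (ht : t₁ ≤ t₂)
    (h₁ : IsMaxOn H univ t₁) (h₂ : IsMaxOn H univ t₂) :
    (∀ᵐ s ∂ν, k (l s - t₂) * k (a - t₁) = k (l s - t₁) * k (a - t₂)) ∧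
      ∀ᵐ s ∂ν, k (r s - t₂) * k (a - t₁) = k (r s - t₁) * k (a - t₂) := by
  have hz : ∀ t, IsMaxOn H univ t → mixtureDeriv ν k l r t = 0 := fun t hm =>
    (hm.isLocalMax univ_mem).hasDerivAt_eq_zero (hH t)
  have e1 := hz _ h₁
  have e2 := hz _ h₂
  have i1 := left_ratio_le hk h ht
  have i2 := right_ratio_le hk h ht
  unfold mixtureDeriv at e1 e2
  -- The left and right integrals agree at both critical points, so the opposite monotonicities of
  -- the two ratios collapse to equalities. Integrands ordered almost everywhere with equal
  -- integrals then coincide almost everywhere.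
  have e1' : ∫ s, k (l s - t₁) ∂ν = ∫ s, k (r s - t₁) ∂ν := by linarith
  have e2' : ∫ s, k (l s - t₂) ∂ν = ∫ s, k (r s - t₂) ∂ν := by linarith
  have hl := fun t => hk.integrable_comp h.left_meas t
  have hr := fun t => hk.integrable_comp h.right_meas t
  have key : ∀ {x y : S → ℝ}, Integrable x ν → Integrable y ν → (∀ᵐ s ∂ν, x s ≤ y s) →
      ∫ s, x s ∂ν = ∫ s, y s ∂ν → ∀ᵐ s ∂ν, x s = y s := by
    intro x y hx hy hle heq
    have h0 : ∫ s, (y s - x s) ∂ν = 0 := by rw [integral_sub hy hx, heq, sub_self]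
    have := (integral_eq_zero_iff_of_nonneg_ae (hle.mono fun s hs => sub_nonneg.2 hs)
      (hy.sub hx)).1 h0
    filter_upwards [this] with s hs
    have : y s - x s = 0 := hs
    linarith
  constructor
  · refine key ((hl _).mul_const _) ((hl _).mul_const _) (h.left_le.mono fun s hs => ?_) ?_
    · exact hk.tp2 _ _ _ _ (by linarith) (by linarith) (by ring)
    · rw [integral_mul_const, integral_mul_const]
      refine le_antisymm i1 ?_
      rw [e1', e2']; exact i2
  · have := key ((hr t₁).mul_const (k (a - t₂))) ((hr t₂).mul_const (k (a - t₁)))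
      (h.le_right.mono fun s hs => ?_) ?_
    · exact this.mono fun s hs => hs.symm
    · rw [mul_comm (k (r s - t₁)), mul_comm (k (r s - t₂))]
      exact hk.tp2 _ _ _ _ (by linarith) (by linarith) (by ring)
    · rw [integral_mul_const, integral_mul_const]
      refine le_antisymm i2 ?_
      rw [← e1', ← e2']; exact i1

/-- With a strictly log-concave kernel the maximizer is unique. -/
lemma eq_of_isMaxOn_mixture_of_strict (hk : IsUnimodalKernel k w) (hw : 0 < w)
    (h : IsLevelEndpoints ν l r a)
    (hstrict : ∀ p q r s, p < q → p < r → p + s = q + r → |q| < w → |r| < w →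
      k p * k s < k q * k r)
    {H : ℝ → ℝ} (hH : ∀ t, HasDerivAt H (mixtureDeriv ν k l r t) t) {t₁ t₂ : ℝ}
    (h₁ : IsMaxOn H univ t₁) (h₂ : IsMaxOn H univ t₂) : t₁ = t₂ := by
  wlog ht : t₁ < t₂ generalizing t₁ t₂
  · rcases lt_trichotomy t₁ t₂ with h' | h' | h'
    · exact absurd h' ht
    · exact h'
    · exact (this h₂ h₁ h').symm
  exfalso
  have w1 := abs_lt.1 (abs_sub_lt_of_isMaxOn_mixture hk hw h hH h₁)
  have w2 := abs_lt.1 (abs_sub_lt_of_isMaxOn_mixture hk hw h hH h₂)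
  obtain ⟨hl, hr⟩ := ae_eq_of_isMaxOn_mixture hk h hH ht.le h₁ h₂
  rcases h.strict with hs | hs
  · have hε : 0 < w + (a - t₁) := by linarith
    refine h.left_near _ hε (measure_mono_null_ae (t := ∅) ?_ measure_empty)
    filter_upwards [hl, hs] with s e hlt hmem
    have hmem : a - (w + (a - t₁)) < l s := hmem
    exact (hstrict (l s - t₂) (l s - t₁) (a - t₂) (a - t₁) (by linarith) (by linarith)
      (by ring) (abs_lt.2 ⟨by linarith, by linarith⟩) (abs_lt.2 w2)).ne e
  · have hε : 0 < w - (a - t₂) := by linarith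
    refine h.right_near _ hε (measure_mono_null_ae (t := ∅) ?_ measure_empty)
    filter_upwards [hr, hs] with s e hlt hmem
    have hmem : r s < a + (w - (a - t₂)) := hmem
    refine (hstrict (a - t₂) (a - t₁) (r s - t₂) (r s - t₁) (by linarith) (by linarith)
      (by ring) (abs_lt.2 w1) (abs_lt.2 ⟨by linarith, by linarith⟩)).ne ?_
    linarith

end Mixture

/-! ### Level sets of a strongly unimodal density and uniqueness of the maximizer -/

section LevelSets

variable {f : ℝ → ℝ} {a : ℝ} {F : ProbabilityMeasure ℝ}

/-- Left endpoint of the superlevel set of `f` at level `s`. -/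
noncomputable def levelLeft (f : ℝ → ℝ) (s : ℝ) : ℝ := sInf {u | s < f u}

/-- Right endpoint of the superlevel set of `f` at level `s`. -/
noncomputable def levelRight (f : ℝ → ℝ) (s : ℝ) : ℝ := sSup {u | s < f u}

lemma IsDensity.lintegral_eq_one (hf : IsDensity F f) : ∫⁻ u, ENNReal.ofReal (f u) = 1 := by
  have h : (F : Measure ℝ) univ = 1 := measure_univ
  rwa [hf.2.2, withDensity_apply _ MeasurableSet.univ, setLIntegral_univ] at h

/-- Markov's inequality; it makes superlevel sets at positive levels bounded. -/
lemma IsDensity.volume_lt_top (hf : IsDensity F f) {s : ℝ} (hs : 0 < s) {A : Set ℝ}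
    (h : ∀ u ∈ A, s ≤ f u) : volume A < ∞ := by
  have h1 : ENNReal.ofReal s * volume A ≤ 1 := by
    rw [← hf.lintegral_eq_one, ← setLIntegral_const]
    exact (setLIntegral_mono (by have := hf.1; fun_prop)
      fun u hu => ENNReal.ofReal_le_ofReal (h u hu)).trans (setLIntegral_le_lintegral _ _)
  by_contra! htop
  rw [top_le_iff.1 htop, ENNReal.mul_top (by simpa using hs)] at h1
  exact absurd h1 (by simp)

lemma IsDensity.integral_eq (hf : IsDensity F f) (g : ℝ → ℝ) :
    ∫ u, g u ∂(F : Measure ℝ) = ∫ u, f u * g u := by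
  rw [hf.2.2, integral_withDensity_eq_integral_toReal_smul (by have := hf.1; fun_prop)
    (ae_of_all _ fun _ => ENNReal.ofReal_lt_top)]
  simp [ENNReal.toReal_ofReal (hf.2.1 _)]

namespace StronglyUnimodal

variable (hfu : StronglyUnimodal f a)
include hfu

lemma le_max (u : ℝ) : f u ≤ f a := by
  rcases eq_or_ne u a with rfl | h
  · exact le_rfl
  · exact (hfu.unique_max u h).le

lemma max_pos (hf : IsDensity F f) : 0 < f a :=
  (hf.2.1 (a + 1)).trans_lt (hfu.unique_max _ (by simp))

lemma lt_of_lt_left {s x y : ℝ} (hx : s < f x) (hxy : x ≤ y) (hy : y ≤ a) : s < f y := by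
  rcases hy.lt_or_eq with h | rfl
  · exact hx.trans_le (hfu.monotone_left (lt_of_le_of_lt hxy h) h hxy)
  · exact hx.trans_le (hfu.le_max x)

lemma lt_of_lt_right {s x y : ℝ} (hx : s < f x) (hxy : y ≤ x) (hy : a ≤ y) : s < f y := by
  rcases hy.lt_or_eq with h | rfl
  · exact hx.trans_le (hfu.antitone_right h (lt_of_lt_of_le h hxy) hxy)
  · exact hx.trans_le (hfu.le_max x)

lemma bddBelow_level (hf : IsDensity F f) {s : ℝ} (hs : 0 < s) : BddBelow {u | s < f u} := by
  by_contra h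
  rw [not_bddBelow_iff] at h
  refine (hf.volume_lt_top hs (A := Iio a) fun u hu => ?_).ne Real.volume_Iio
  obtain ⟨v, hv, hvu⟩ := h u
  exact (hfu.lt_of_lt_left hv hvu.le (le_of_lt hu)).le

lemma bddAbove_level (hf : IsDensity F f) {s : ℝ} (hs : 0 < s) : BddAbove {u | s < f u} := by
  by_contra h
  rw [not_bddAbove_iff] at h
  refine (hf.volume_lt_top hs (A := Ioi a) fun u hu => ?_).ne Real.volume_Ioi
  obtain ⟨v, hv, hvu⟩ := h u
  exact (hfu.lt_of_lt_right hv hvu.le (le_of_lt hu)).le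

lemma levelLeft_le (hf : IsDensity F f) {s x : ℝ} (hs : 0 < s) (hx : s < f x) :
    levelLeft f s ≤ x :=
  csInf_le (hfu.bddBelow_level hf hs) hx

lemma le_levelRight (hf : IsDensity F f) {s x : ℝ} (hs : 0 < s) (hx : s < f x) :
    x ≤ levelRight f s :=
  le_csSup (hfu.bddAbove_level hf hs) hx

lemma le_levelLeft {s x : ℝ} (hs : s < f a) (hxa : x ≤ a) (hx : f x ≤ s) : x ≤ levelLeft f s := by
  refine le_csInf ⟨a, hs⟩ fun v hv => ?_
  by_contra! hvx
  exact (hfu.lt_of_lt_left hv hvx.le hxa).not_ge hx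

lemma levelRight_le {s x : ℝ} (hs : s < f a) (hxa : a ≤ x) (hx : f x ≤ s) :
    levelRight f s ≤ x := by
  refine csSup_le ⟨a, hs⟩ fun v hv => ?_
  by_contra! hvx
  exact (hfu.lt_of_lt_right hv hvx.le hxa).not_ge hx

lemma lt_of_mem_Ioo {s x : ℝ} (hs : s < f a) (hx : x ∈ Ioo (levelLeft f s) (levelRight f s)) :
    s < f x := by
  by_contra! h
  rcases le_total x a with hxa | hxa
  · exact (hfu.le_levelLeft hs hxa h).not_gt hx.1
  · exact (hfu.levelRight_le hs hxa h).not_gt hx.2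

/-- Whether the endpoints belong to the level set is immaterial; `Ioc` is the form that interval
integrals use. -/
lemma level_ae_eq (hf : IsDensity F f) {s : ℝ} (hs : s ∈ Ioo 0 (f a)) :
    {u | s < f u} =ᵐ[volume] Ioc (levelLeft f s) (levelRight f s) := by
  refine EventuallyLE.antisymm ?_ ?_
  · have : {u | s < f u} ≤ᵐ[volume] Icc (levelLeft f s) (levelRight f s) :=
      LE.le.eventuallyLE fun u hu =>
        ⟨hfu.levelLeft_le hf hs.1 hu, hfu.le_levelRight hf hs.1 hu⟩
    exact this.trans Ioc_ae_eq_Icc.symm.le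
  · refine Ioo_ae_eq_Ioc.symm.le.trans (LE.le.eventuallyLE fun u hu => ?_)
    exact hfu.lt_of_mem_Ioo hs.2 hu

omit hfu in
lemma volume_Ioo_pos {p q : ℝ} (hp : 0 ≤ p) (hpq : p < q) (hq : q ≤ f a) :
    (volume.restrict (Ioo 0 (f a))) (Ioo p q) ≠ 0 := by
  rw [Measure.restrict_apply measurableSet_Ioo,
    inter_eq_left.2 (Ioo_subset_Ioo hp hq), Real.volume_Ioo]
  simpa using hpq

/-- Endpoints are monotone in the level, hence measurable. Levels between `f (a ± ε / 2)` and `f a`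
have positive measure by the unique maximum, which gives endpoints near the mode. One-sided
continuity at the mode gives `strict`. -/
lemma isLevelEndpoints (hf : IsDensity F f) :
    IsLevelEndpoints (volume.restrict (Ioo 0 (f a))) (levelLeft f) (levelRight f) a where
  left_meas := aemeasurable_restrict_of_monotoneOn measurableSet_Ioo fun s hs s' hs' h =>
    csInf_le_csInf (hfu.bddBelow_level hf hs.1) ⟨a, hs'.2⟩ fun _ hu => lt_of_le_of_lt h hu
  right_meas := aemeasurable_restrict_of_antitoneOn measurableSet_Ioo fun s hs s' hs' h =>
    csSup_le_csSup (hfu.bddAbove_level hf hs.1) ⟨a, hs'.2⟩ fun _ hu => lt_of_le_of_lt h hu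
  left_le := (ae_restrict_mem measurableSet_Ioo).mono fun s hs => hfu.levelLeft_le hf hs.1 hs.2
  le_right := (ae_restrict_mem measurableSet_Ioo).mono fun s hs => hfu.le_levelRight hf hs.1 hs.2
  left_near ε hε h0 := by
    refine volume_Ioo_pos (hf.2.1 (a - ε / 2)) (hfu.unique_max _ (by linarith)) le_rfl
      (measure_mono_null (fun s hs => ?_) h0)
    have := hfu.le_levelLeft hs.2 (x := a - ε / 2) (by linarith) hs.1.le
    simp only [mem_ofPred_eq]
    linarith
  right_near ε hε h0 := by
    refine volume_Ioo_pos (hf.2.1 (a + ε / 2)) (hfu.unique_max _ (by linarith)) le_rfl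
      (measure_mono_null (fun s hs => ?_) h0)
    have := hfu.levelRight_le hs.2 (x := a + ε / 2) (by linarith) hs.1.le
    simp only [mem_ofPred_eq]
    linarith
  strict := by
    refine hfu.version.imp (fun hc => ?_) (fun hc => ?_)
    · filter_upwards [ae_restrict_mem measurableSet_Ioo] with s hs
      obtain ⟨x, hx, hxa⟩ := ((hc.tendsto.eventually_const_lt hs.2).and self_mem_nhdsWithin).exists
      exact (hfu.levelLeft_le hf hs.1 hx).trans_lt hxa
    · filter_upwards [ae_restrict_mem measurableSet_Ioo] with s hs
      obtain ⟨x, hx, hxa⟩ := ((hc.tendsto.eventually_const_lt hs.2).and self_mem_nhdsWithin).exists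
      exact lt_of_lt_of_le hxa (hfu.le_levelRight hf hs.1 hx)

/-- The layer-cake formula, with levels cut at the maximum `f a` so that the measure on levels is
finite. -/
lemma eq_integral_indicator (hf : IsDensity F f) (u : ℝ) :
    f u = ∫ s in Ioo 0 (f a), {s | s < f u}.indicator (fun _ => (1 : ℝ)) s := by
  have hm : MeasurableSet {s | s < f u} := measurableSet_Iio
  rw [setIntegral_indicator hm]
  have : Ioo 0 (f a) ∩ {s | s < f u} = Ioo 0 (f u) := by
    ext s
    exact ⟨fun h => ⟨h.1.1, h.2⟩, fun h => ⟨⟨h.1, lt_of_lt_of_le h.2 (hfu.le_max u)⟩, h.2⟩⟩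
  rw [this]
  simp [hf.2.1 u]

end StronglyUnimodal

lemma IsUnimodalKernel.integrable {k : ℝ → ℝ} {w : ℝ} (hk : IsUnimodalKernel k w) :
    Integrable k :=
  hk.continuous.integrable_of_hasCompactSupport (hasCompactSupport_of_eq_zero hk.zero_of_le)

/-- Layer-cake and Fubini. After the integration over a level interval, `t` occurs only inside a
primitive of the kernel, so no regularity of `f` is needed to differentiate. -/
lemma StronglyUnimodal.integral_kernel_eq (hfu : StronglyUnimodal f a) (hf : IsDensity F f)
    {k : ℝ → ℝ} {w : ℝ} (hk : IsUnimodalKernel k w) (t : ℝ) :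
    ∫ u, k (u - t) ∂(F : Measure ℝ) =
      ∫ s in Ioo 0 (f a),
        ((∫ x in (0 : ℝ)..(levelRight f s - t), k x) - ∫ x in (0 : ℝ)..(levelLeft f s - t), k x) := by
  have hkt : Integrable (fun u => k (u - t)) := hk.integrable.comp_sub_right t
  have hmeas : MeasurableSet {p : ℝ × ℝ | p.2 < f p.1} :=
    measurableSet_lt measurable_snd (hf.1.comp measurable_fst)
  have hind : ∀ u s, {s | s < f u}.indicator (fun _ => (1 : ℝ)) s * k (u - t) =
      {p : ℝ × ℝ | p.2 < f p.1}.indicator (fun p => k (p.1 - t)) (u, s) := by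
    intro u s
    by_cases h : s < f u
    · rw [indicator_of_mem (show s ∈ {s | s < f u} from h),
        indicator_of_mem (show (u, s) ∈ {p : ℝ × ℝ | p.2 < f p.1} from h), one_mul]
    · rw [indicator_of_notMem (show s ∉ {s | s < f u} from h),
        indicator_of_notMem (show (u, s) ∉ {p : ℝ × ℝ | p.2 < f p.1} from h), zero_mul]
  rw [hf.integral_eq]
  calc ∫ u, f u * k (u - t)
      = ∫ u, ∫ s in Ioo 0 (f a),
          {p : ℝ × ℝ | p.2 < f p.1}.indicator (fun p => k (p.1 - t)) (u, s) := by
        refine integral_congr_ae (ae_of_all _ fun u => ?_)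
        dsimp only
        conv_lhs => rw [hfu.eq_integral_indicator hf u, ← integral_mul_const]
        simp_rw [hind]
    _ = ∫ s in Ioo 0 (f a), ∫ u,
          {p : ℝ × ℝ | p.2 < f p.1}.indicator (fun p => k (p.1 - t)) (u, s) := by
        refine integral_integral_swap ?_
        have h1 : Integrable (fun p : ℝ × ℝ => k (p.1 - t) * (fun _ : ℝ => (1 : ℝ)) p.2)
            (volume.prod (volume.restrict (Ioo 0 (f a)))) :=
          hkt.mul_prod (integrable_const _)
        simp only [mul_one] at h1
        exact h1.indicator hmeas
    _ = _ := by
        refine setIntegral_congr_fun measurableSet_Ioo fun s hs => ?_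
        have e : ∀ u, {p : ℝ × ℝ | p.2 < f p.1}.indicator (fun p => k (p.1 - t)) (u, s) =
            {u | s < f u}.indicator (fun u => k (u - t)) u := fun u => by
          simp only [indicator, mem_ofPred_eq]
        have hm : MeasurableSet {u | s < f u} := measurableSet_lt measurable_const hf.1
        have hlr : levelLeft f s ≤ levelRight f s :=
          (hfu.levelLeft_le hf hs.1 hs.2).trans (hfu.le_levelRight hf hs.1 hs.2)
        simp_rw [e]
        rw [integral_indicator hm, setIntegral_congr_set (hfu.level_ae_eq hf hs),
          ← intervalIntegral.integral_of_le hlr, intervalIntegral.integral_comp_sub_right,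
          intervalIntegral.integral_interval_sub_left] <;>
        exact hk.continuous.intervalIntegrable _ _

/-- Differentiation under the integral over levels: the primitive of `k` is bounded, and the
derivative of the integrand is dominated by `2 k(0)`. -/
lemma StronglyUnimodal.hasDerivAt_integral_kernel (hfu : StronglyUnimodal f a)
    (hf : IsDensity F f) {k : ℝ → ℝ} {w : ℝ} (hk : IsUnimodalKernel k w) (t : ℝ) :
    HasDerivAt (fun t => ∫ u, k (u - t) ∂(F : Measure ℝ))
      (mixtureDeriv (volume.restrict (Ioo 0 (f a))) k (levelLeft f) (levelRight f) t) t := by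
  have hE := hfu.isLevelEndpoints hf
  let K : ℝ → ℝ := fun x => ∫ y in (0 : ℝ)..x, k y
  have hK : ∀ x, HasDerivAt K (k x) x := fun x =>
    intervalIntegral.integral_hasDerivAt_right (hk.continuous.intervalIntegrable _ _)
      (hk.continuous.stronglyMeasurableAtFilter _ _) hk.continuous.continuousAt
  have hKc : Continuous K := continuous_iff_continuousAt.2 fun x => (hK x).continuousAt
  have hKb : ∀ x, |K x| ≤ ∫ y, k y := fun x => by
    calc |K x| = ‖∫ y in (0 : ℝ)..x, k y‖ := rfl
      _ ≤ ∫ y in uIoc 0 x, ‖k y‖ := intervalIntegral.norm_integral_le_integral_norm_uIoc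
      _ ≤ ∫ y, ‖k y‖ :=
        setIntegral_le_integral hk.integrable.norm (ae_of_all _ fun _ => norm_nonneg _)
      _ = ∫ y, k y := by simp_rw [Real.norm_of_nonneg (hk.nonneg _)]
  have hm : ∀ t {l : ℝ → ℝ}, AEMeasurable l (volume.restrict (Ioo 0 (f a))) →
      AEStronglyMeasurable (fun s => K (l s - t)) (volume.restrict (Ioo 0 (f a))) := fun t l hl =>
    (hKc.measurable.comp_aemeasurable (hl.sub_const t)).aestronglyMeasurable
  have hi : ∀ t {l : ℝ → ℝ}, AEMeasurable l (volume.restrict (Ioo 0 (f a))) →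
      Integrable (fun s => K (l s - t)) (volume.restrict (Ioo 0 (f a))) := fun t l hl =>
    Integrable.of_bound (hm t hl) _ (ae_of_all _ fun _ => hKb _)
  have hkl := hk.integrable_comp hE.left_meas t
  have hkr := hk.integrable_comp hE.right_meas t
  have main := (hasDerivAt_integral_of_dominated_loc_of_deriv_le
    (μ := volume.restrict (Ioo 0 (f a)))
    (F := fun t s => K (levelRight f s - t) - K (levelLeft f s - t))
    (F' := fun t s => k (levelLeft f s - t) - k (levelRight f s - t))
    (bound := fun _ => k 0 + k 0) (x₀ := t) (s := univ) univ_mem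
    (Eventually.of_forall fun t => (hm t hE.right_meas).sub (hm t hE.left_meas))
    ((hi t hE.right_meas).sub (hi t hE.left_meas))
    (hkl.sub hkr).aestronglyMeasurable
    (ae_of_all _ fun s t _ => (norm_sub_le _ _).trans
      (add_le_add (hk.abs_le _) (hk.abs_le _)))
    (integrable_const _)
    (ae_of_all _ fun s t _ => ?_)).2
  · rw [integral_sub hkl hkr] at main
    have e : (fun t => ∫ u, k (u - t) ∂(F : Measure ℝ)) = fun t =>
        ∫ s in Ioo 0 (f a), (K (levelRight f s - t) - K (levelLeft f s - t)) :=
      funext fun t => hfu.integral_kernel_eq hf hk t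
    rw [e]
    exact main
  · have h : ∀ c : ℝ, HasDerivAt (fun t => K (c - t)) (-k (c - t)) t := fun c => by
      have := (hK (c - t)).comp t ((hasDerivAt_id t).const_sub c)
      simpa [Function.comp_def] using this
    have := (h (levelRight f s)).sub (h (levelLeft f s))
    rw [neg_sub_neg] at this
    exact this

lemma StronglyUnimodal.eventually_pos (hfu : StronglyUnimodal f a) (hf : IsDensity F f) :
    (∀ᶠ u in 𝓝[<] a, 0 < f u) ∨ ∀ᶠ u in 𝓝[>] a, 0 < f u :=
  hfu.version.imp (fun hc => hc.tendsto.eventually_const_lt (hfu.max_pos hf))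
    (fun hc => hc.tendsto.eventually_const_lt (hfu.max_pos hf))

/-- The expectation of a translated unimodal kernel under a strongly unimodal distribution has at
most one maximizer. -/
lemma StronglyUnimodal.eq_of_isMaxOn (hfu : StronglyUnimodal f a) (hf : IsDensity F f)
    {k : ℝ → ℝ} {w : ℝ} (hk : IsUnimodalKernel k w) (hw : 0 < w)
    (hstrict : (∀ p q r s, p < q → p < r → p + s = q + r → |q| < w → |r| < w →
      k p * k s < k q * k r) ∨ StrictOnSupport f a)
    {t₁ t₂ : ℝ} (h₁ : IsMaxOn (fun t => ∫ u, k (u - t) ∂(F : Measure ℝ)) univ t₁)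
    (h₂ : IsMaxOn (fun t => ∫ u, k (u - t) ∂(F : Measure ℝ)) univ t₂) : t₁ = t₂ := by
  have hE := hfu.isLevelEndpoints hf
  have hH := hfu.hasDerivAt_integral_kernel hf hk
  rcases hstrict with hstrict | hstrict
  · exact eq_of_isMaxOn_mixture_of_strict hk hw hE hstrict hH h₁ h₂
  wlog ht : t₁ < t₂ generalizing t₁ t₂
  · rcases lt_trichotomy t₁ t₂ with h' | h' | h'
    · exact absurd h' ht
    · exact h'
    · exact (this h₂ h₁ h').symm
  exfalso
  have w1 := abs_sub_lt_of_isMaxOn_mixture hk hw hE hH h₁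
  have w2 := abs_sub_lt_of_isMaxOn_mixture hk hw hE hH h₂
  obtain ⟨hl, hr⟩ := ae_eq_of_isMaxOn_mixture hk hE hH ht.le h₁ h₂
  have hkc := hk.continuous
  have hopen : IsOpen {u : ℝ | k (u - t₂) * k (a - t₁) ≠ k (u - t₁) * k (a - t₂)} :=
    isOpen_ne_fun (by fun_prop) (by fun_prop)
  -- A failure at `u` would persist on a ball. Take `v` in that ball between `u` and the mode:
  -- strict monotonicity gives the levels between `f u` and `f v` positive measure, and their
  -- endpoints lie in the ball, against the almost sure equality.
  have hE1 : ∀ u, 0 < f u → k (u - t₂) * k (a - t₁) = k (u - t₁) * k (a - t₂) := by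
    intro u hu
    by_contra hne
    obtain ⟨ε, hε, hball⟩ := Metric.isOpen_iff.1 hopen u hne
    rcases lt_trichotomy u a with hua | rfl | hua
    · let v := min (u + ε / 2) ((u + a) / 2)
      have huv : u < v := lt_min (by linarith) (by linarith)
      have hva : v < a := (min_le_right _ _).trans_lt (by linarith)
      have hvε : v ≤ u + ε / 2 := min_le_left _ _
      have hfv : f u < f v := hstrict.1 ⟨hua, hu⟩
        ⟨hva, hu.trans_le (hfu.monotone_left hua hva huv.le)⟩ huv
      refine volume_Ioo_pos hu.le hfv (hfu.le_max v) (measure_mono_null (fun s hs => ?_)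
        (ae_iff.1 hl))
      refine hball ?_
      have h1 := hfu.le_levelLeft (hs.2.trans_le (hfu.le_max v)) hua.le hs.1.le
      have h2 := hfu.levelLeft_le hf (hu.trans hs.1) hs.2
      rw [Metric.mem_ball, Real.dist_eq, abs_lt]
      constructor <;> linarith
    · exact hne (mul_comm _ _)
    · let v := max (u - ε / 2) ((u + a) / 2)
      have huv : v < u := max_lt (by linarith) (by linarith)
      have hva : a < v := lt_of_lt_of_le (by linarith) (le_max_right _ _)
      have hvε : u - ε / 2 ≤ v := le_max_left _ _
      have hfv : f u < f v := hstrict.2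
        ⟨hva, hu.trans_le (hfu.antitone_right hva hua huv.le)⟩ ⟨hua, hu⟩ huv
      refine volume_Ioo_pos hu.le hfv (hfu.le_max v) (measure_mono_null (fun s hs => ?_)
        (ae_iff.1 hr))
      refine hball ?_
      have h1 := hfu.levelRight_le (hs.2.trans_le (hfu.le_max v)) hua.le hs.1.le
      have h2 := hfu.le_levelRight hf (hu.trans hs.1) hs.2
      rw [Metric.mem_ball, Real.dist_eq, abs_lt]
      constructor <;> linarith
  -- points close to the mode at which the density and both kernels are positive
  have hnear : ∀ᶠ u in 𝓝 a, |u - t₁| < w ∧ |u - t₂| < w := by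
    have c1 : ContinuousAt (fun u : ℝ => |u - t₁|) a := by fun_prop
    have c2 : ContinuousAt (fun u : ℝ => |u - t₂|) a := by fun_prop
    exact (c1.tendsto.eventually_lt_const w1).and (c2.tendsto.eventually_lt_const w2)
  have hside : (∀ᶠ u in 𝓝[<] a, 0 < f u ∧ |u - t₁| < w ∧ |u - t₂| < w) ∨
      ∀ᶠ u in 𝓝[>] a, 0 < f u ∧ |u - t₁| < w ∧ |u - t₂| < w :=
    (hfu.eventually_pos hf).imp (fun h => h.and (nhdsWithin_le_nhds hnear))
      (fun h => h.and (nhdsWithin_le_nhds hnear))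
  have hfi : Integrable f := by
    refine ⟨hf.1.aestronglyMeasurable, ?_⟩
    rw [hasFiniteIntegral_iff_ofReal (ae_of_all _ hf.2.1), hf.lintegral_eq_one]
    exact ENNReal.one_lt_top
  have hint : ∀ t, Integrable fun u => f u * k (u - t) := fun t =>
    hfi.mul_bdd (c := k 0) (by fun_prop) (ae_of_all _ fun u => hk.abs_le _)
  have hpos : 0 < ∫ u, k (u - t₁) ∂(F : Measure ℝ) := by
    rw [hf.integral_eq]
    refine lt_of_le_of_ne (integral_nonneg fun u => mul_nonneg (hf.2.1 u) (hk.nonneg _))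
      fun h0 => ?_
    have hz := (integral_eq_zero_iff_of_nonneg
      (fun u => mul_nonneg (hf.2.1 u) (hk.nonneg _)) (hint t₁)).1 h0.symm
    have hz' := ae_iff.1 hz
    rcases hside with h | h
    · obtain ⟨c, hc, hsub⟩ := (mem_nhdsLT_iff_exists_Ioo_subset' (sub_one_lt a)).1 h
      have : volume (Ioo c a) = 0 := measure_mono_null (fun u hu =>
        (mul_pos (hsub hu).1 (hk.pos_of_lt _ (hsub hu).2.1)).ne') hz'
      rw [Real.volume_Ioo] at this
      simp only [ENNReal.ofReal_eq_zero, sub_nonpos] at this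
      exact absurd hc (not_lt.2 this)
    · obtain ⟨c, hc, hsub⟩ := (mem_nhdsGT_iff_exists_Ioo_subset' (lt_add_one a)).1 h
      have : volume (Ioo a c) = 0 := measure_mono_null (fun u hu =>
        (mul_pos (hsub hu).1 (hk.pos_of_lt _ (hsub hu).2.1)).ne') hz'
      rw [Real.volume_Ioo] at this
      simp only [ENNReal.ofReal_eq_zero, sub_nonpos] at this
      exact absurd hc (not_lt.2 this)
  have heq : ∫ u, k (u - t₁) ∂(F : Measure ℝ) = ∫ u, k (u - t₂) ∂(F : Measure ℝ) :=
    le_antisymm (h₂ (mem_univ t₁)) (h₁ (mem_univ t₂))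
  -- Integrating the identity against `f` and cancelling the common maximum gives `k (a - t₁) = k (a
  -- - t₂)`, so `a` is the midpoint of `t₁` and `t₂`. The identity at another point `u` near the
  -- mode makes `u` the midpoint too.
  have hprod : (∫ u, k (u - t₂) ∂(F : Measure ℝ)) * k (a - t₁) =
      (∫ u, k (u - t₁) ∂(F : Measure ℝ)) * k (a - t₂) := by
    rw [hf.integral_eq, hf.integral_eq, ← integral_mul_const, ← integral_mul_const]
    refine integral_congr_ae (ae_of_all _ fun u => ?_)
    rcases (hf.2.1 u).lt_or_eq with hu | hu
    · dsimp only
      rw [mul_assoc, mul_assoc, hE1 u hu]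
    · simp [← hu]
  rw [← heq] at hprod
  have habs := hk.abs_eq_of_eq w1 w2 (mul_left_cancel₀ hpos.ne' hprod)
  have hmid : a - t₁ = -(a - t₂) := (abs_eq_abs.1 habs).resolve_left fun h => by linarith
  obtain ⟨u, hu, hne⟩ : ∃ u, (0 < f u ∧ |u - t₁| < w ∧ |u - t₂| < w) ∧ u ≠ a := by
    rcases hside with h | h
    · exact ((h.and self_mem_nhdsWithin).mono fun u hu => ⟨hu.1, ne_of_lt hu.2⟩).exists
    · exact ((h.and self_mem_nhdsWithin).mono fun u hu => ⟨hu.1, ne_of_gt hu.2⟩).exists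
  have hka : k (a - t₂) = k (a - t₁) := (mul_left_cancel₀ hpos.ne' hprod).symm
  have hku := hE1 u hu.1
  rw [hka] at hku
  have hu' := hk.abs_eq_of_eq hu.2.2 hu.2.1
    (mul_right_cancel₀ (hk.pos_of_lt _ w1).ne' hku)
  have : u - t₂ = -(u - t₁) := (abs_eq_abs.1 hu').resolve_left fun h => by linarith
  exact hne (by linarith)

end LevelSets

lemma IsUnimodalKernel.scale {k : ℝ → ℝ} {w σ : ℝ} (hk : IsUnimodalKernel k w) (hσ : 0 < σ) :
    IsUnimodalKernel (fun x => k (x / σ)) (w * σ) where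
  continuous := by have := hk.continuous; fun_prop
  zero_of_le x hx := hk.zero_of_le _ (by rwa [abs_div, abs_of_pos hσ, le_div_iff₀ hσ])
  pos_of_lt x hx := hk.pos_of_lt _ (by rwa [abs_div, abs_of_pos hσ, div_lt_iff₀ hσ])
  anti x y h := hk.anti _ _ (by rw [abs_div, abs_div]; gcongr)
  strict x y h hx := hk.strict _ _ (by rw [abs_div, abs_div, abs_of_pos hσ]; gcongr)
    (by rwa [abs_div, abs_of_pos hσ, div_lt_iff₀ hσ])
  tp2 p q r s h1 h2 h3 := hk.tp2 _ _ _ _ (by gcongr) (by gcongr)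
    (by rw [← add_div, ← add_div, h3])

/-! ### Log-concave `ρ`-functions as totally positive kernels -/

section Rho

variable {ρ : ℝ → ℝ} {m : ℝ}

lemma LogConcaveRho.pos (hR : LogConcaveRho ρ m) (hρ : IsBoundedRho ρ) : 0 < m := by
  by_contra! h
  have := (hR.1 0).2 (by simpa using h)
  rw [hρ.zero] at this
  exact zero_ne_one this

lemma LogConcaveRho.le_one (hR : LogConcaveRho ρ m) (hρ : IsBoundedRho ρ) (u : ℝ) : ρ u ≤ 1 := by
  rcases le_or_gt m |u| with h | h
  · exact ((hR.1 u).2 h).le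
  · rw [← (hR.1 m).2 (le_abs_self m)]
    exact hρ.mono _ _ (h.le.trans (le_abs_self m))

lemma LogConcaveRho.lt_one (hR : LogConcaveRho ρ m) (hρ : IsBoundedRho ρ) {u : ℝ}
    (hu : |u| < m) : ρ u < 1 :=
  lt_of_le_of_ne (hR.le_one hρ u) fun h => hu.not_ge ((hR.1 u).1 h)

/-- Concavity on an interval gives the four-point inequality. -/
lemma ConcaveOn.four_point {s : Set ℝ} {g : ℝ → ℝ} (hg : ConcaveOn ℝ s g) {p q r t : ℝ}
    (hp : p ∈ s) (ht : t ∈ s) (hpq : p ≤ q) (hpr : p ≤ r) (h : p + t = q + r) :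
    g p + g t ≤ g q + g r := by
  rcases (show p ≤ t by linarith).eq_or_lt with rfl | hpt
  · have : q = p := by linarith
    have : r = p := by linarith
    subst_vars; rfl
  have h0 : 0 < t - p := sub_pos.2 hpt
  have hne := h0.ne'
  have h1 : 0 ≤ (q - p) / (t - p) := div_nonneg (by linarith) h0.le
  have h2 : 0 ≤ (r - p) / (t - p) := div_nonneg (by linarith) h0.le
  have h3 : (r - p) / (t - p) + (q - p) / (t - p) = 1 := by
    rw [← add_div, div_eq_one_iff_eq hne]; linarith
  have e1 := hg.2 hp ht h2 h1 h3
  have e2 := hg.2 hp ht h1 h2 (by rw [add_comm]; exact h3)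
  have x1 : ((r - p) / (t - p)) • p + ((q - p) / (t - p)) • t = q := by
    simp only [smul_eq_mul]
    field_simp
    have : r = p + t - q := by linarith
    subst this; ring
  have x2 : ((q - p) / (t - p)) • p + ((r - p) / (t - p)) • t = r := by
    simp only [smul_eq_mul]
    field_simp
    have : q = p + t - r := by linarith
    subst this; ring
  rw [x1] at e1
  rw [x2] at e2
  simp only [smul_eq_mul] at e1 e2
  calc g p + g t = ((r - p) / (t - p) + (q - p) / (t - p)) * (g p + g t) := by rw [h3, one_mul]
    _ ≤ g q + g r := by linarith

lemma StrictConcaveOn.four_point {s : Set ℝ} {g : ℝ → ℝ} (hg : StrictConcaveOn ℝ s g)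
    {p q r t : ℝ} (hp : p ∈ s) (ht : t ∈ s) (hpq : p < q) (hpr : p < r) (h : p + t = q + r) :
    g p + g t < g q + g r := by
  have hpt : p < t := by linarith
  have h0 : 0 < t - p := sub_pos.2 hpt
  have hne := h0.ne'
  have h1 : 0 < (q - p) / (t - p) := div_pos (by linarith) h0
  have h2 : 0 < (r - p) / (t - p) := div_pos (by linarith) h0
  have h3 : (r - p) / (t - p) + (q - p) / (t - p) = 1 := by
    rw [← add_div, div_eq_one_iff_eq hne]; linarith
  have e1 := hg.2 hp ht hpt.ne h2 h1 h3
  have e2 := hg.2 hp ht hpt.ne h1 h2 (by rw [add_comm]; exact h3)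
  have x1 : ((r - p) / (t - p)) • p + ((q - p) / (t - p)) • t = q := by
    simp only [smul_eq_mul]
    field_simp
    have : r = p + t - q := by linarith
    subst this; ring
  have x2 : ((q - p) / (t - p)) • p + ((r - p) / (t - p)) • t = r := by
    simp only [smul_eq_mul]
    field_simp
    have : q = p + t - r := by linarith
    subst this; ring
  rw [x1] at e1
  rw [x2] at e2
  simp only [smul_eq_mul] at e1 e2
  calc g p + g t = ((r - p) / (t - p) + (q - p) / (t - p)) * (g p + g t) := by rw [h3, one_mul]
    _ < g q + g r := by linarith

/-- Total positivity is the exponentiated four-point inequality for `log (1 - ρ)`. It is trivial if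
an outer factor vanishes; otherwise the inner points lie between the outer ones, inside `(-m, m)`.
-/
lemma LogConcaveRho.isUnimodalKernel (hR : LogConcaveRho ρ m) (hρ : IsBoundedRho ρ) :
    IsUnimodalKernel (fun x => 1 - ρ x) m where
  continuous := continuous_const.sub hρ.continuous
  zero_of_le x hx := by rw [(hR.1 x).2 hx, sub_self]
  pos_of_lt x hx := sub_pos.2 (hR.lt_one hρ hx)
  anti x y h := sub_le_sub_left (hρ.mono _ _ h) _
  strict x y h hx := by
    refine sub_lt_sub_left ?_ _
    rcases lt_or_ge |y| m with hy | hy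
    · exact hρ.strict _ _ (hR.lt_one hρ hy) h
    · rw [(hR.1 y).2 hy]; exact hR.lt_one hρ hx
  tp2 p q r s hpq hpr h := by
    have hnn : ∀ x, 0 ≤ 1 - ρ x := fun x => sub_nonneg.2 (hR.le_one hρ x)
    rcases le_or_gt m |p| with hp | hp
    · rw [(hR.1 p).2 hp, sub_self, zero_mul]; exact mul_nonneg (hnn _) (hnn _)
    rcases le_or_gt m |s| with hs | hs
    · rw [(hR.1 s).2 hs, sub_self, mul_zero]; exact mul_nonneg (hnn _) (hnn _)
    have hp' := abs_lt.1 hp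
    have hs' := abs_lt.1 hs
    have pos : ∀ {x}, |x| < m → 0 < 1 - ρ x := fun hx => sub_pos.2 (hR.lt_one hρ hx)
    have hq : |q| < m := abs_lt.2 ⟨by linarith, by linarith⟩
    have hr : |r| < m := abs_lt.2 ⟨by linarith, by linarith⟩
    rw [← Real.log_le_log_iff (mul_pos (pos hp) (pos hs)) (mul_pos (pos hq) (pos hr)),
      Real.log_mul (pos hp).ne' (pos hs).ne', Real.log_mul (pos hq).ne' (pos hr).ne']
    exact ConcaveOn.four_point hR.2 hp' hs' hpq hpr h

/-- Only the inner points need to lie in the support: an outer point outside makes the left side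
zero while the right side stays positive. -/
lemma LogConcaveRho.strict_tp2 (hR : LogConcaveRho ρ m) (hρ : IsBoundedRho ρ)
    (hS : StrictLogConcaveRho ρ m) {σ : ℝ} (hσ : 0 < σ) (p q r s : ℝ) (hpq : p < q) (hpr : p < r)
    (h : p + s = q + r) (hq : |q| < m * σ) (hr : |r| < m * σ) :
    (1 - ρ (p / σ)) * (1 - ρ (s / σ)) < (1 - ρ (q / σ)) * (1 - ρ (r / σ)) := by
  have pos : ∀ {x}, |x| < m → 0 < 1 - ρ x := fun hx => sub_pos.2 (hR.lt_one hρ hx)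
  have hq : |q / σ| < m := by rwa [abs_div, abs_of_pos hσ, div_lt_iff₀ hσ]
  have hr : |r / σ| < m := by rwa [abs_div, abs_of_pos hσ, div_lt_iff₀ hσ]
  have hqr := mul_pos (pos hq) (pos hr)
  rcases le_or_gt m |p / σ| with hp | hp
  · rwa [(hR.1 _).2 hp, sub_self, zero_mul]
  rcases le_or_gt m |s / σ| with hs | hs
  · rwa [(hR.1 _).2 hs, sub_self, mul_zero]
  rw [← Real.log_lt_log_iff (mul_pos (pos hp) (pos hs)) hqr,
    Real.log_mul (pos hp).ne' (pos hs).ne', Real.log_mul (pos hq).ne' (pos hr).ne']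
  exact StrictConcaveOn.four_point hS (abs_lt.1 hp) (abs_lt.1 hs) (by gcongr) (by gcongr)
    (by rw [← add_div, ← add_div, h])

end Rho

/-! ### The expected loss as a function of distribution, location and scale -/

section Loss

variable {ρ : ℝ → ℝ} {m : ℝ} (hρ : IsBoundedRho ρ) (hR : LogConcaveRho ρ m)
include hρ hR

lemma integrable_rho (F : ProbabilityMeasure ℝ) (t s : ℝ) :
    Integrable (fun u => ρ ((u - t) / s)) (F : Measure ℝ) := by
  have hc := hρ.continuous
  refine integrable_of_continuous_of_bound (C := 1) (by fun_prop) fun x => ?_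
  rw [abs_le]
  refine ⟨?_, hR.le_one hρ _⟩
  have := hρ.mono 0 ((x - t) / s) (by simp)
  rw [hρ.zero] at this
  linarith

lemma mLoss_eq (F : ProbabilityMeasure ℝ) (t s : ℝ) :
    mLoss ρ s F t = 1 - ∫ u, (1 - ρ ((u - t) / s)) ∂(F : Measure ℝ) := by
  rw [integral_sub (integrable_const _) (integrable_rho hρ hR F t s)]
  simp [mLoss]

lemma mLoss_anti (F : ProbabilityMeasure ℝ) (t : ℝ) {s s' : ℝ} (hs : 0 < s) (h : s ≤ s') :
    mLoss ρ s' F t ≤ mLoss ρ s F t :=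
  integral_mono (integrable_rho hρ hR F t s') (integrable_rho hρ hR F t s) fun u =>
    hρ.mono _ _ (by
      rw [abs_div, abs_div, abs_of_pos hs, abs_of_pos (hs.trans_le h)]
      gcongr)

lemma continuousAt_mLoss (F : ProbabilityMeasure ℝ) (t : ℝ) {s : ℝ} (hs : 0 < s) :
    ContinuousAt (fun p : ProbabilityMeasure ℝ × ℝ × ℝ => mLoss ρ p.2.2 p.1 p.2.1) (F, t, s) := by
  simp_rw [mLoss_eq hρ hR]
  exact continuousAt_const.sub (continuousAt_integral_locScale
    (hR.isUnimodalKernel hρ).continuous (hR.isUnimodalKernel hρ).zero_of_le F t hs)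

lemma tendsto_mLoss_cocompact (F : ProbabilityMeasure ℝ) {s : ℝ} (hs : 0 < s) :
    Tendsto (fun p : ProbabilityMeasure ℝ × ℝ × ℝ => mLoss ρ p.2.2 p.1 p.2.1)
      (𝓝 F ×ˢ cocompact ℝ ×ˢ 𝓝 s) (𝓝 1) := by
  simp_rw [mLoss_eq hρ hR]
  simpa using tendsto_const_nhds.sub (tendsto_integral_locScale_cocompact
    (hR.isUnimodalKernel hρ).continuous (hR.isUnimodalKernel hρ).zero_of_le F hs)

lemma continuousAt_mLoss_scale (F : ProbabilityMeasure ℝ) (t : ℝ) {s : ℝ} (hs : 0 < s) :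
    ContinuousAt (fun s => mLoss ρ s F t) s :=
  (continuousAt_mLoss hρ hR F t hs).comp (f := fun s => (F, t, s)) (by fun_prop)

lemma tendsto_mLoss_atTop (F : ProbabilityMeasure ℝ) (t : ℝ) :
    Tendsto (fun s => mLoss ρ s F t) atTop (𝓝 0) := by
  have hc := hρ.continuous
  have : Tendsto (fun s => mLoss ρ s F t) atTop (𝓝 (∫ _, (0 : ℝ) ∂(F : Measure ℝ))) := by
    refine tendsto_integral_filter_of_dominated_convergence (fun _ => 1)
      (Eventually.of_forall fun s => (integrable_rho hρ hR F t s).aestronglyMeasurable)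
      (Eventually.of_forall fun s => ae_of_all _ fun u => ?_) (integrable_const _)
      (ae_of_all _ fun u => ?_)
    · rw [Real.norm_eq_abs, abs_le]
      refine ⟨?_, hR.le_one hρ _⟩
      have := hρ.mono 0 ((u - t) / s) (by simp)
      rw [hρ.zero] at this
      linarith
    · have h0 : Tendsto (fun s : ℝ => (u - t) / s) atTop (𝓝 0) :=
        tendsto_const_nhds.div_atTop tendsto_id
      have := (hc.tendsto 0).comp h0
      rwa [hρ.zero] at this
  simpa using this

omit hR in
lemma mLoss_reflect {F : ProbabilityMeasure ℝ} {μ₀ : ℝ} (hF : IsSymmetricAround F μ₀) (s t : ℝ) :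
    mLoss ρ s F (2 * μ₀ - t) = mLoss ρ s F t := by
  have hc := hρ.continuous
  unfold mLoss
  conv_lhs => rw [← hF]
  rw [integral_map (by fun_prop) (by
    exact (by fun_prop : Continuous fun u => ρ ((u - (2 * μ₀ - t)) / s)).aestronglyMeasurable)]
  congr 1
  ext u
  have h : |(2 * μ₀ - u - (2 * μ₀ - t)) / s| = |(u - t) / s| := by
    rw [show 2 * μ₀ - u - (2 * μ₀ - t) = -(u - t) by ring, neg_div, abs_neg]
  exact le_antisymm (hρ.mono _ _ h.le) (hρ.mono _ _ h.ge)

lemma isMaxOn_kernel_of_isMinOn_mLoss {F : ProbabilityMeasure ℝ} {s t : ℝ}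
    (h : IsMinOn (mLoss ρ s F) univ t) :
    IsMaxOn (fun t => ∫ u, (1 - ρ ((u - t) / s)) ∂(F : Measure ℝ)) univ t := by
  intro x hx
  have := h hx
  simp only [mem_ofPred_eq, mLoss_eq hρ hR] at this ⊢
  linarith

/-- Uniqueness of the M-functional of location under strong unimodality. -/
lemma eq_of_isMinOn_mLoss {F : ProbabilityMeasure ℝ} {f : ℝ → ℝ} {a : ℝ} (hf : IsDensity F f)
    (hfu : StronglyUnimodal f a) (hstrict : StrictLogConcaveRho ρ m ∨ StrictOnSupport f a)
    {s : ℝ} (hs : 0 < s) {t₁ t₂ : ℝ} (h₁ : IsMinOn (mLoss ρ s F) univ t₁)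
    (h₂ : IsMinOn (mLoss ρ s F) univ t₂) : t₁ = t₂ :=
  hfu.eq_of_isMaxOn hf ((hR.isUnimodalKernel hρ).scale hs) (mul_pos (hR.pos hρ) hs)
    (hstrict.imp_left fun h => hR.strict_tp2 hρ h hs)
    (isMaxOn_kernel_of_isMinOn_mLoss hρ hR h₁) (isMaxOn_kernel_of_isMinOn_mLoss hρ hR h₂)

/-- Equal integrals would make the two integrands agree almost surely. Away from the null point `u =
t`, strict monotonicity of `ρ` below `1` then leaves only `ρ = 1`, so the loss would be `1`. -/
lemma mLoss_strictAnti {F : ProbabilityMeasure ℝ} (hF : NullSingletonClass (F : Measure ℝ)) (t : ℝ) {s s' : ℝ}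
    (hs : 0 < s) (h : s < s') (h1 : mLoss ρ s' F t < 1) : mLoss ρ s' F t < mLoss ρ s F t := by
  refine lt_of_le_of_ne (mLoss_anti hρ hR F t hs h.le) fun heq => h1.ne ?_
  have hs' := hs.trans h
  have hle : ∀ u, ρ ((u - t) / s') ≤ ρ ((u - t) / s) := fun u => hρ.mono _ _ (by
      rw [abs_div, abs_div, abs_of_pos hs, abs_of_pos hs']
      gcongr)
  have hz : ∫ u, (ρ ((u - t) / s) - ρ ((u - t) / s')) ∂(F : Measure ℝ) = 0 := by
    rw [integral_sub (integrable_rho hρ hR F t s) (integrable_rho hρ hR F t s')]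
    exact sub_eq_zero.2 heq.symm
  have hae := (integral_eq_zero_iff_of_nonneg (fun u => sub_nonneg.2 (hle u))
    ((integrable_rho hρ hR F t s).sub (integrable_rho hρ hR F t s'))).1 hz
  have hone : ∀ᵐ u ∂(F : Measure ℝ), ρ ((u - t) / s') = 1 := by
    have hne : ∀ᵐ u ∂(F : Measure ℝ), u ≠ t := by
      rw [ae_iff]; simp
    filter_upwards [hae, hne] with u hu hut
    have hu : ρ ((u - t) / s) - ρ ((u - t) / s') = 0 := hu
    by_contra hlt
    have hlt' : |(u - t) / s'| < m := by
      by_contra! h'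
      exact hlt ((hR.1 _).2 h')
    have := (hR.isUnimodalKernel hρ).strict ((u - t) / s') ((u - t) / s) (by
      rw [abs_div, abs_div, abs_of_pos hs, abs_of_pos hs']
      have : 0 < |u - t| := abs_pos.2 (sub_ne_zero.2 hut)
      gcongr) hlt'
    linarith
  unfold mLoss
  rw [integral_congr_ae hone]
  simp

/-- As the scale shrinks, every standardized residual with `u ≠ t` leaves `(-m, m)`, so the loss
tends to `1`. -/
lemma exists_scale_lt_mLoss {F : ProbabilityMeasure ℝ} (hF : NullSingletonClass (F : Measure ℝ)) (t : ℝ)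
    {δ : ℝ} (hδ : δ < 1) : ∃ s > 0, δ < mLoss ρ s F t := by
  have : Tendsto (fun s => mLoss ρ s F t) (𝓝[>] 0) (𝓝 (∫ _, (1 : ℝ) ∂(F : Measure ℝ))) := by
    refine tendsto_integral_filter_of_dominated_convergence (fun _ => 1)
      (Eventually.of_forall fun s => (integrable_rho hρ hR F t s).aestronglyMeasurable)
      (Eventually.of_forall fun s => ae_of_all _ fun u => ?_) (integrable_const _) ?_
    · rw [Real.norm_eq_abs, abs_le]
      refine ⟨?_, hR.le_one hρ _⟩
      have := hρ.mono 0 ((u - t) / s) (by simp)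
      rw [hρ.zero] at this
      linarith
    · have hne : ∀ᵐ u ∂(F : Measure ℝ), u ≠ t := by
        rw [ae_iff]; simp
      filter_upwards [hne] with u hu
      refine tendsto_const_nhds.congr' ?_
      have hm := hR.pos hρ
      have hpos : 0 < |u - t| / m := div_pos (abs_pos.2 (sub_ne_zero.2 hu)) hm
      filter_upwards [Ioo_mem_nhdsGT hpos] with s hs
      refine ((hR.1 _).2 ?_).symm
      rw [abs_div, abs_of_pos hs.1, le_div_iff₀ hs.1]
      have := (lt_div_iff₀ hm).1 hs.2
      linarith
  simp only [integral_const, probReal_univ, smul_eq_mul, mul_one] at this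
  obtain ⟨s, hs, hs0⟩ := ((this.eventually_const_lt hδ).and self_mem_nhdsWithin).exists
  exact ⟨s, hs0, hs⟩

end Loss

/-! ### The residual scale and the scale functional -/

section Scale

variable {ρ : ℝ → ℝ} {m δ : ℝ} (hρ : IsBoundedRho ρ) (hR : LogConcaveRho ρ m)
  (F : ProbabilityMeasure ℝ) (t : ℝ)

lemma residualScale_nonneg : 0 ≤ residualScale ρ δ F t := Real.sInf_nonneg fun _ hs => hs.1.le

variable {F t} in
lemma residualScale_le {s : ℝ} (hs : 0 < s) (h : mLoss ρ s F t ≤ δ) :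
    residualScale ρ δ F t ≤ s :=
  csInf_le ⟨0, fun _ hs => hs.1.le⟩ ⟨hs, h⟩

include hρ hR

variable {F t} in
lemma mLoss_le_of_residualScale_lt (hδ : 0 < δ) {s : ℝ} (h : residualScale ρ δ F t < s) :
    mLoss ρ s F t ≤ δ := by
  have hne : {s : ℝ | 0 < s ∧ mLoss ρ s F t ≤ δ}.Nonempty :=
    ((eventually_gt_atTop 0).and ((tendsto_mLoss_atTop hρ hR F t).eventually_le_const hδ)).exists
  obtain ⟨s', hs', hlt⟩ := exists_lt_of_csInf_lt hne h
  exact (mLoss_anti hρ hR F t hs'.1 hlt.le).trans hs'.2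

variable {F t} in
lemma mLoss_residualScale_le (hδ : 0 < δ) (h : 0 < residualScale ρ δ F t) :
    mLoss ρ (residualScale ρ δ F t) F t ≤ δ := by
  have hc := (continuousAt_mLoss_scale hρ hR F t h).tendsto.mono_left
    (nhdsWithin_le_nhds (s := Ioi (residualScale ρ δ F t)))
  exact le_of_tendsto hc (eventually_mem_nhdsWithin.mono fun s hs =>
    mLoss_le_of_residualScale_lt hρ hR hδ hs)

variable {F t} in
-- By continuity a strict inequality at `s` persists at some smaller scale.
lemma residualScale_lt {s : ℝ} (hs : 0 < s) (h : mLoss ρ s F t < δ) :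
    residualScale ρ δ F t < s := by
  have hc := (continuousAt_mLoss_scale hρ hR F t hs).tendsto.eventually_lt_const h
  have : ∀ᶠ x in 𝓝[<] s, mLoss ρ x F t < δ ∧ 0 < x ∧ x < s :=
    (hc.filter_mono nhdsWithin_le_nhds).and
      (((lt_mem_nhds hs).filter_mono nhdsWithin_le_nhds).and self_mem_nhdsWithin)
  obtain ⟨x, h1, h2, h3⟩ := this.exists
  exact (residualScale_le h2 h1.le).trans_lt h3

lemma residualScale_pos (hF : NullSingletonClass (F : Measure ℝ)) (hδ : δ ∈ Ioo (0 : ℝ) 1) :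
    0 < residualScale ρ δ F t := by
  obtain ⟨s, hs, h⟩ := exists_scale_lt_mLoss hρ hR hF t hδ.2
  refine hs.trans_le ?_
  by_contra! hlt
  exact (mLoss_le_of_residualScale_lt hρ hR hδ.1 hlt).not_gt h

omit hρ hR in
lemma scaleFunctional_le : scaleFunctional ρ δ F ≤ residualScale ρ δ F t :=
  ciInf_le ⟨0, by rintro _ ⟨x, rfl⟩; exact residualScale_nonneg F x⟩ t

omit hρ hR in
lemma IsSFunctional.scale_eq {TS : ProbabilityMeasure ℝ → ℝ} (hTS : IsSFunctional ρ δ TS) :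
    scaleFunctional ρ δ F = residualScale ρ δ F (TS F) :=
  le_antisymm (scaleFunctional_le F _) (le_ciInf fun x => hTS F (mem_univ x))

/-- A location with loss below `δ` at scale `S(F)` would have a residual scale below the infimum. -/
lemma le_mLoss_scaleFunctional (h : 0 < scaleFunctional ρ δ F) :
    δ ≤ mLoss ρ (scaleFunctional ρ δ F) F t := by
  by_contra! hlt
  exact (residualScale_lt hρ hR h hlt).not_ge (scaleFunctional_le F t)

lemma IsSFunctional.mLoss_eq {TS : ProbabilityMeasure ℝ → ℝ} (hTS : IsSFunctional ρ δ TS)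
    (hδ : 0 < δ) (h : 0 < scaleFunctional ρ δ F) :
    mLoss ρ (scaleFunctional ρ δ F) F (TS F) = δ := by
  refine le_antisymm ?_ (le_mLoss_scaleFunctional hρ hR F _ h)
  rw [hTS.scale_eq] at h ⊢
  exact mLoss_residualScale_le hρ hR hδ h

/-- This trades minimization of a scale for minimization of a loss at fixed scale, so the S
functional can be treated as an M-functional of location. -/
lemma IsSFunctional.isMinOn {TS : ProbabilityMeasure ℝ → ℝ} (hTS : IsSFunctional ρ δ TS)
    (hδ : 0 < δ) (h : 0 < scaleFunctional ρ δ F) :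
    IsMinOn (mLoss ρ (scaleFunctional ρ δ F) F) univ (TS F) := fun t _ => by
  simp only [mem_ofPred_eq]
  rw [hTS.mLoss_eq hρ hR F hδ h]
  exact le_mLoss_scaleFunctional hρ hR F t h

end Scale

/-! ### Convergence of near-minimizers and weak continuity of the scale -/

section Consistency

variable {ρ : ℝ → ℝ} {m δ : ℝ} (hρ : IsBoundedRho ρ) (hR : LogConcaveRho ρ m)
  {F₀ : ProbabilityMeasure ℝ}
include hρ hR

/-- Along an ultrafilter of distributions converging to `F₀`, locations with loss bounded away
from one converge. -/
lemma exists_tendsto_of_mLoss_le {U : Ultrafilter (ProbabilityMeasure ℝ)} (hU : ↑U ≤ 𝓝 F₀)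
    {T S c : ProbabilityMeasure ℝ → ℝ} {s₀ c₀ : ℝ} (hs₀ : 0 < s₀) (hS : Tendsto S U (𝓝 s₀))
    (hc : Tendsto c U (𝓝 c₀)) (hc₀ : c₀ < 1) (hle : ∀ᶠ F in U, mLoss ρ (S F) F (T F) ≤ c F) :
    ∃ t, Tendsto T U (𝓝 t) ∧ mLoss ρ s₀ F₀ t ≤ c₀ := by
  have hid : Tendsto (fun F : ProbabilityMeasure ℝ => F) U (𝓝 F₀) := hU
  by_cases h : ∃ t, Tendsto T U (𝓝 t)
  · obtain ⟨t, ht⟩ := h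
    refine ⟨t, ht, ?_⟩
    have := (continuousAt_mLoss hρ hR F₀ t hs₀).tendsto.comp
      (hid.prodMk_nhds (ht.prodMk_nhds hS))
    exact le_of_tendsto_of_tendsto this hc hle
  · exfalso
    push Not at h
    -- An ultrafilter that charges a compact set converges, so without a limit the locations leave
    -- every compact set, where the loss tends to `1`.
    have hco : Tendsto T U (cocompact ℝ) := by
      intro A hA
      obtain ⟨K, hK, hKA⟩ := mem_cocompact.1 hA
      by_contra hmem
      have hTA : Aᶜ ∈ U.map T := Ultrafilter.compl_mem_iff_notMem.2 hmem
      have hTK : K ∈ U.map T := mem_of_superset hTA (compl_subset_comm.1 hKA)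
      obtain ⟨t, -, ht⟩ := hK.ultrafilter_le_nhds (U.map T) (le_principal_iff.2 hTK)
      exact h t ht
    have := (tendsto_mLoss_cocompact hρ hR F₀ hs₀).comp (hid.prodMk (hco.prodMk hS))
    exact absurd (le_of_tendsto_of_tendsto this hc hle) (not_le.2 hc₀)

/-- Testing on ultrafilters provides compactness without extracting subsequences. -/
lemma tendsto_of_mLoss_le {T S c : ProbabilityMeasure ℝ → ℝ} {s₀ c₀ t₀ : ℝ} (hs₀ : 0 < s₀)
    (hS : Tendsto S (𝓝 F₀) (𝓝 s₀)) (hc : Tendsto c (𝓝 F₀) (𝓝 c₀)) (hc₀ : c₀ < 1)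
    (hle : ∀ᶠ F in 𝓝 F₀, mLoss ρ (S F) F (T F) ≤ c F)
    (huniq : ∀ t, mLoss ρ s₀ F₀ t ≤ c₀ → t = t₀) : Tendsto T (𝓝 F₀) (𝓝 t₀) := by
  rw [tendsto_iff_ultrafilter]
  intro U hU
  obtain ⟨t, ht, hle'⟩ := exists_tendsto_of_mLoss_le hρ hR hU hs₀ (hS.mono_left hU)
    (hc.mono_left hU) hc₀ (hle.filter_mono hU)
  rwa [huniq t hle'] at ht

/-- Weak continuity of the scale functional. -/
lemma IsSFunctional.tendsto_scaleFunctional {TS : ProbabilityMeasure ℝ → ℝ}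
    (hTS : IsSFunctional ρ δ TS) (hδ : δ ∈ Ioo (0 : ℝ) 1) (hF : NullSingletonClass (F₀ : Measure ℝ)) :
    Tendsto (scaleFunctional ρ δ) (𝓝 F₀) (𝓝 (scaleFunctional ρ δ F₀)) := by
  have hpos : 0 < scaleFunctional ρ δ F₀ := by
    rw [hTS.scale_eq]; exact residualScale_pos hρ hR F₀ _ hF hδ
  -- Above `S(F₀)` the loss at `TS F₀` is strictly below `δ`, an open condition on the distribution.
  have hup : ∀ s, scaleFunctional ρ δ F₀ < s → ∀ᶠ F in 𝓝 F₀, scaleFunctional ρ δ F < s := by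
    intro s hs
    have h1 : mLoss ρ s F₀ (TS F₀) < δ := by
      have he := hTS.mLoss_eq hρ hR F₀ hδ.1 hpos
      have := mLoss_anti hρ hR F₀ (TS F₀) hpos hs.le
      have := mLoss_strictAnti hρ hR hF (TS F₀) hpos hs (by linarith [hδ.2])
      linarith
    have hs0 := hpos.trans hs
    have hc : Tendsto (fun F => mLoss ρ s F (TS F₀)) (𝓝 F₀) (𝓝 (mLoss ρ s F₀ (TS F₀))) :=
      (continuousAt_mLoss hρ hR F₀ (TS F₀) hs0).tendsto.comp
        (f := fun F => (F, TS F₀, s)) (by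
          exact tendsto_id.prodMk_nhds (tendsto_const_nhds.prodMk_nhds tendsto_const_nhds))
    filter_upwards [hc.eventually_lt_const h1] with F hF
    exact (scaleFunctional_le F (TS F₀)).trans_lt (residualScale_lt hρ hR hs0 hF)
  have hlow : ∀ s, s < scaleFunctional ρ δ F₀ → ∀ᶠ F in 𝓝 F₀, s < scaleFunctional ρ δ F := by
    intro s hs
    -- The maximum with `0` makes `s'` positive. If `S(F) ≤ s` along an ultrafilter, the locations
    -- `TS F` have a limit whose loss under `F₀` at scale `s'` is at most `δ`; strict decrease in
    -- the scale then gives a loss below `δ` at `S(F₀)`.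
    obtain ⟨s', hs', hs'σ⟩ := exists_between (max_lt hs hpos)
    have hs'0 : 0 < s' := (le_max_right _ _).trans_lt hs'
    have hs's : s < s' := (le_max_left _ _).trans_lt hs'
    refine mem_iff_ultrafilter.2 fun U hU => ?_
    by_contra hmem
    have hnot : ∀ᶠ F in U, ¬ s < scaleFunctional ρ δ F := Ultrafilter.compl_mem_iff_notMem.2 hmem
    have hle : ∀ᶠ F in U, mLoss ρ s' F (TS F) ≤ δ := hnot.mono fun F hF => by
      refine mLoss_le_of_residualScale_lt hρ hR hδ.1 ?_
      rw [← hTS.scale_eq]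
      exact (not_lt.1 hF).trans_lt hs's
    obtain ⟨t, -, ht⟩ := exists_tendsto_of_mLoss_le hρ hR hU (S := fun _ => s') (c := fun _ => δ)
      hs'0 tendsto_const_nhds tendsto_const_nhds hδ.2 hle
    have h1 := le_mLoss_scaleFunctional hρ hR F₀ t hpos
    have h2 := mLoss_anti hρ hR F₀ t hs'0 hs'σ.le
    have h3 := mLoss_strictAnti hρ hR hF t hs'0 hs'σ (by linarith [hδ.2])
    linarith
  exact tendsto_order.2 ⟨hlow, hup⟩

end Consistency

/-! ### Uniqueness, symmetry and continuity of the location functionals -/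

lemma IsDensity.nullSingletonClass {F : ProbabilityMeasure ℝ} {f : ℝ → ℝ} (hf : IsDensity F f) :
    NullSingletonClass (F : Measure ℝ) where
  measure_singleton x := by
    rw [hf.2.2]
    exact withDensity_absolutelyContinuous _ _ (measure_singleton x)

/-- Uniqueness of the minimizer of the residual scale. -/
lemma IsSFunctional.isMinOn_residualScale_iff {ρ : ℝ → ℝ} {m δ : ℝ} (hρ : IsBoundedRho ρ)
    (hR : LogConcaveRho ρ m) {F : ProbabilityMeasure ℝ} {TS : ProbabilityMeasure ℝ → ℝ}
    (hTS : IsSFunctional ρ δ TS) (hδ : 0 < δ) (hpos : 0 < scaleFunctional ρ δ F)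
    (huniq : ∀ t, IsMinOn (mLoss ρ (scaleFunctional ρ δ F) F) univ t → t = TS F) (t : ℝ) :
    IsMinOn (residualScale ρ δ F) univ t ↔ t = TS F := by
  refine ⟨fun h => huniq t fun x _ => ?_, fun h => h ▸ hTS F⟩
  have hS : residualScale ρ δ F t = scaleFunctional ρ δ F := by
    refine le_antisymm ?_ (scaleFunctional_le F t)
    rw [hTS.scale_eq]
    exact h (mem_univ _)
  have hle : mLoss ρ (scaleFunctional ρ δ F) F t ≤ δ := by
    rw [← hS] at hpos ⊢
    exact mLoss_residualScale_le hρ hR hδ hpos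
  exact hle.trans (le_mLoss_scaleFunctional hρ hR F x hpos)

/-- Reflection about the centre maps minimizers to minimizers, so it fixes the unique one. -/
lemma eq_center_of_isSymmetricAround {ρ : ℝ → ℝ} (hρ : IsBoundedRho ρ)
    {F : ProbabilityMeasure ℝ} {s α : ℝ}
    (h : ∀ t, IsMinOn (mLoss ρ s F) univ t ↔ t = α) {μ₀ : ℝ} (hF : IsSymmetricAround F μ₀) :
    α = μ₀ := by
  have hα := (h α).2 rfl
  have : 2 * μ₀ - α = α := (h _).1 fun x hx => by
    simp only [mem_ofPred_eq]
    rw [mLoss_reflect hρ hF]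
    exact hα hx
  linarith

section

variable {ρ₀ ρ₁ f : ℝ → ℝ} {m₀ m₁ a δ : ℝ} {F₀ : ProbabilityMeasure ℝ}
  {TS TMM : ProbabilityMeasure ℝ → ℝ}

lemma tendsto_S_functional (hδ : δ ∈ Ioo (0 : ℝ) 1) (hρ₀ : IsBoundedRho ρ₀)
    (hR₀ : LogConcaveRho ρ₀ m₀) (hF : NullSingletonClass (F₀ : Measure ℝ))
    (hTS : IsSFunctional ρ₀ δ TS)
    (huniq : ∀ t, IsMinOn (mLoss ρ₀ (scaleFunctional ρ₀ δ F₀) F₀) univ t → t = TS F₀) :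
    Tendsto TS (𝓝 F₀) (𝓝 (TS F₀)) := by
  have hpos : 0 < scaleFunctional ρ₀ δ F₀ := by
    rw [hTS.scale_eq]; exact residualScale_pos hρ₀ hR₀ F₀ _ hF hδ
  have hS := hTS.tendsto_scaleFunctional hρ₀ hR₀ hδ hF
  refine tendsto_of_mLoss_le hρ₀ hR₀ (c := fun _ => δ) hpos hS tendsto_const_nhds hδ.2
    ((hS.eventually_const_lt hpos).mono fun F hF => (hTS.mLoss_eq hρ₀ hR₀ F hδ.1 hF).le)
    fun t ht => huniq t fun x _ => ht.trans (le_mLoss_scaleFunctional hρ₀ hR₀ F₀ x hpos)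

/-- Comparison with the fixed candidate `TMM F₀` bounds the loss. The limiting bound is below `1`
because `ρ₁ ≤ ρ₀` and the `ρ₀`-loss at `TS F₀` equals `δ`. -/
lemma tendsto_MM_functional (hδ : δ ∈ Ioo (0 : ℝ) 1) (hρ₀ : IsBoundedRho ρ₀)
    (hρ₁ : IsBoundedRho ρ₁) (hR₀ : LogConcaveRho ρ₀ m₀) (hR₁ : LogConcaveRho ρ₁ m₁)
    (hle : ∀ u, ρ₁ u ≤ ρ₀ u)
    (hF : NullSingletonClass (F₀ : Measure ℝ)) (hTS : IsSFunctional ρ₀ δ TS)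
    (hTMM : IsMMFunctional ρ₀ ρ₁ δ TMM)
    (huniq : ∀ t, IsMinOn (mLoss ρ₁ (scaleFunctional ρ₀ δ F₀) F₀) univ t → t = TMM F₀) :
    Tendsto TMM (𝓝 F₀) (𝓝 (TMM F₀)) := by
  have hpos : 0 < scaleFunctional ρ₀ δ F₀ := by
    rw [hTS.scale_eq]; exact residualScale_pos hρ₀ hR₀ F₀ _ hF hδ
  have hS := hTS.tendsto_scaleFunctional hρ₀ hR₀ hδ hF
  have hmin := hTMM F₀ hpos
  refine tendsto_of_mLoss_le hρ₁ hR₁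
    (c := fun F => mLoss ρ₁ (scaleFunctional ρ₀ δ F) F (TMM F₀)) hpos hS
    ((continuousAt_mLoss hρ₁ hR₁ F₀ (TMM F₀) hpos).tendsto.comp
      (tendsto_id.prodMk_nhds (tendsto_const_nhds.prodMk_nhds hS))) ?_
    ((hS.eventually_const_lt hpos).mono fun F hF => hTMM F hF (mem_univ _))
    fun t ht => huniq t fun x hx => ht.trans (hmin hx)
  calc mLoss ρ₁ (scaleFunctional ρ₀ δ F₀) F₀ (TMM F₀)
      ≤ mLoss ρ₁ (scaleFunctional ρ₀ δ F₀) F₀ (TS F₀) := hmin (mem_univ _)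
    _ ≤ mLoss ρ₀ (scaleFunctional ρ₀ δ F₀) F₀ (TS F₀) :=
        integral_mono (integrable_rho hρ₁ hR₁ _ _ _) (integrable_rho hρ₀ hR₀ _ _ _)
          fun u => hle _
    _ = δ := hTS.mLoss_eq hρ₀ hR₀ F₀ hδ.1 hpos
    _ < 1 := hδ.2

lemma continuousAt_jointFunctional (hS : Tendsto (scaleFunctional ρ₀ δ) (𝓝 F₀)
      (𝓝 (scaleFunctional ρ₀ δ F₀)))
    (hTS : Tendsto TS (𝓝 F₀) (𝓝 (TS F₀))) (hTMM : Tendsto TMM (𝓝 F₀) (𝓝 (TMM F₀))) :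
    ContinuousAt (jointFunctional ρ₀ δ TS TMM) F₀ := by
  refine (PiLp.continuous_toLp 2 _).continuousAt.comp (continuousAt_pi.2 fun i => ?_)
  fin_cases i
  · exact hTS
  · exact hTMM
  · exact hS

end

/-! ### Uniform differentiability of location-scale families -/

section Differentiability

variable {g : ℝ → ℝ} {m : ℝ}

/-- Uniform continuity in the parameters of the coefficients of `locScaleDeriv`, which carry a
factor `s⁻¹`. -/
lemma eventually_inv_mul_locScale_sub_le (hg : Continuous g) (hm : ∀ x, m ≤ |x| → g x = 0)
    (t₀ : ℝ) {s₀ : ℝ} (hs₀ : 0 < s₀) {ε : ℝ} (hε : 0 < ε) :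
    ∀ᶠ p : ℝ × ℝ in 𝓝 (t₀, s₀),
      ∀ u, |p.2⁻¹ * g ((u - p.1) / p.2) - s₀⁻¹ * g ((u - t₀) / s₀)| ≤ ε := by
  obtain ⟨C, hC0, hC⟩ := exists_bound_of_eq_zero hg hm
  have hc : Tendsto (fun p : ℝ × ℝ => p.2⁻¹) (𝓝 (t₀, s₀)) (𝓝 s₀⁻¹) :=
    (continuous_snd.tendsto (t₀, s₀)).inv₀ hs₀.ne'
  have hinv := inv_pos.2 hs₀
  have h1 : ∀ᶠ p : ℝ × ℝ in 𝓝 (t₀, s₀), |p.2⁻¹ - s₀⁻¹| < ε / 2 / (C + 1) :=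
    hc.eventually (Metric.ball_mem_nhds _ (by positivity))
  have h2 := eventually_locScale_sub_le hg hm t₀ hs₀
    (show 0 < ε / 2 / s₀⁻¹ by positivity)
  filter_upwards [h1, h2] with p h1 h2 u
  have e : p.2⁻¹ * g ((u - p.1) / p.2) - s₀⁻¹ * g ((u - t₀) / s₀) =
      (p.2⁻¹ - s₀⁻¹) * g ((u - p.1) / p.2) +
        s₀⁻¹ * (g ((u - p.1) / p.2) - g ((u - t₀) / s₀)) := by ring
  rw [e]
  refine (abs_add_le _ _).trans ?_
  rw [abs_mul, abs_mul, abs_of_pos hinv]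
  have i1 : |p.2⁻¹ - s₀⁻¹| * |g ((u - p.1) / p.2)| ≤ ε / 2 / (C + 1) * (C + 1) :=
    mul_le_mul h1.le ((hC _).trans (by linarith)) (abs_nonneg _) (by positivity)
  have i2 : s₀⁻¹ * |g ((u - p.1) / p.2) - g ((u - t₀) / s₀)| ≤ s₀⁻¹ * (ε / 2 / s₀⁻¹) := by
    gcongr
    exact h2 u
  rw [div_mul_cancel₀ _ (by positivity)] at i1
  rw [mul_div_cancel₀ _ hinv.ne'] at i2
  linarith

/-- The derivative of `(t, s) ↦ g ((y - t) / s)`. -/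
noncomputable def locScaleDeriv (g : ℝ → ℝ) (y : ℝ) (p : ℝ × ℝ) : ℝ × ℝ →L[ℝ] ℝ :=
  (-(p.2⁻¹ * deriv g ((y - p.1) / p.2))) • ContinuousLinearMap.fst ℝ ℝ ℝ +
    (-(p.2⁻¹ * (((y - p.1) / p.2) * deriv g ((y - p.1) / p.2)))) • ContinuousLinearMap.snd ℝ ℝ ℝ

lemma hasFDerivAt_locScale (hg : Differentiable ℝ g) (y : ℝ) {p : ℝ × ℝ} (hp : 0 < p.2) :
    HasFDerivAt (fun p : ℝ × ℝ => g ((y - p.1) / p.2)) (locScaleDeriv g y p) p := by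
  have h1 : HasFDerivAt (fun p : ℝ × ℝ => (y - p.1) * p.2⁻¹)
      ((y - p.1) • (-(p.2 ^ 2)⁻¹ • ContinuousLinearMap.snd ℝ ℝ ℝ) +
        p.2⁻¹ • (-ContinuousLinearMap.fst ℝ ℝ ℝ)) p := by
    have a1 : HasFDerivAt (fun p : ℝ × ℝ => y - p.1) (-ContinuousLinearMap.fst ℝ ℝ ℝ) p :=
      hasFDerivAt_fst.const_sub y
    have a2 : HasFDerivAt (fun p : ℝ × ℝ => p.2⁻¹)
        (-(p.2 ^ 2)⁻¹ • ContinuousLinearMap.snd ℝ ℝ ℝ) p :=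
      (hasDerivAt_inv hp.ne').comp_hasFDerivAt p hasFDerivAt_snd
    exact a1.mul a2
  have h2 := ((hg ((y - p.1) * p.2⁻¹)).hasDerivAt.comp_hasFDerivAt p h1)
  simp only [Function.comp_def, ← div_eq_mul_inv] at h2
  refine h2.congr_fderiv ?_
  ext <;> simp [locScaleDeriv] <;> field_simp

/-- First-order expansion of a location-scale family, uniform in the observation. -/
lemma eventually_locScale_expansion (hg : ContDiff ℝ 1 g) (hm : ∀ x, m ≤ |x| → deriv g x = 0)
    (t₀ : ℝ) {s₀ : ℝ} (hs₀ : 0 < s₀) {ε : ℝ} (hε : 0 < ε) :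
    ∀ᶠ p : ℝ × ℝ in 𝓝 (t₀, s₀), ∀ y, |g ((y - p.1) / p.2) - g ((y - t₀) / s₀) -
      locScaleDeriv g y (t₀, s₀) (p - (t₀, s₀))| ≤ ε * ‖p - (t₀, s₀)‖ := by
  have hd : Continuous (deriv g) := hg.continuous_deriv le_rfl
  have h1 := eventually_inv_mul_locScale_sub_le hd hm t₀ hs₀ (half_pos hε)
  have h2 := eventually_inv_mul_locScale_sub_le (g := fun x => x * deriv g x) (by fun_prop)
    (fun x hx => by rw [hm x hx, mul_zero]) t₀ hs₀ (half_pos hε)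
  have h3 : ∀ᶠ p : ℝ × ℝ in 𝓝 (t₀, s₀), 0 < p.2 :=
    (continuous_snd.tendsto (t₀, s₀)).eventually_const_lt hs₀
  obtain ⟨r, hr, hball⟩ := Metric.mem_nhds_iff.1 (h1.and (h2.and h3))
  filter_upwards [Metric.ball_mem_nhds _ hr] with p hp y
  -- Mean value inequality on a convex ball where the derivative stays within `ε` of its value at
  -- the centre, for all `y` at once.
  refine (convex_ball (t₀, s₀) r).norm_image_sub_le_of_norm_hasFDerivWithin_le'
    (f := fun p : ℝ × ℝ => g ((y - p.1) / p.2)) (f' := locScaleDeriv g y)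
    (fun q hq => (hasFDerivAt_locScale (hg.differentiable one_ne_zero) y
      (hball hq).2.2).hasFDerivWithinAt) (fun q hq => ?_) (Metric.mem_ball_self hr) hp
  refine ContinuousLinearMap.opNorm_le_bound _ hε.le fun v => ?_
  have i1 := (hball hq).1 y
  have i2 := (hball hq).2.1 y
  have e : (locScaleDeriv g y q - locScaleDeriv g y (t₀, s₀)) v =
      -((q.2⁻¹ * deriv g ((y - q.1) / q.2) - s₀⁻¹ * deriv g ((y - t₀) / s₀)) * v.1) -
      (q.2⁻¹ * (((y - q.1) / q.2) * deriv g ((y - q.1) / q.2)) -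
        s₀⁻¹ * (((y - t₀) / s₀) * deriv g ((y - t₀) / s₀))) * v.2 := by
    simp [locScaleDeriv]
    ring
  rw [e, Real.norm_eq_abs]
  refine (abs_sub _ _).trans ?_
  rw [abs_neg, abs_mul, abs_mul]
  have n1 : |v.1| ≤ ‖v‖ := norm_fst_le v
  have n2 : |v.2| ≤ ‖v‖ := norm_snd_le v
  calc _ ≤ ε / 2 * ‖v‖ + ε / 2 * ‖v‖ :=
        add_le_add (mul_le_mul i1 n1 (abs_nonneg _) (by positivity))
          (mul_le_mul i2 n2 (abs_nonneg _) (by positivity))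
    _ = ε * ‖v‖ := by ring

/-- First-order expansion of the expectation of a location-scale family along distributions
converging weakly to `F₀`. -/
lemma isLittleO_integral_locScale (hg : ContDiff ℝ 1 g) (hm : ∀ x, m ≤ |x| → deriv g x = 0)
    {C : ℝ} (hC : ∀ x, |g x| ≤ C) {F₀ : ProbabilityMeasure ℝ} {T S : ProbabilityMeasure ℝ → ℝ}
    {t₀ s₀ : ℝ} (hs₀ : 0 < s₀) (hT : Tendsto T (𝓝 F₀) (𝓝 t₀)) (hS : Tendsto S (𝓝 F₀) (𝓝 s₀)) :
    (fun F : ProbabilityMeasure ℝ =>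
      ∫ y, g ((y - T F) / S F) ∂(F : Measure ℝ) - ∫ y, g ((y - t₀) / s₀) ∂(F : Measure ℝ) +
        s₀⁻¹ * (∫ y, deriv g ((y - t₀) / s₀) ∂(F₀ : Measure ℝ)) * (T F - t₀) +
        s₀⁻¹ * (∫ y, ((y - t₀) / s₀) * deriv g ((y - t₀) / s₀) ∂(F₀ : Measure ℝ)) * (S F - s₀))
      =o[𝓝 F₀] fun F => (T F - t₀, S F - s₀) := by
  have hd : Continuous (deriv g) := hg.continuous_deriv le_rfl
  have hgc := hg.continuous
  have hd2 : Continuous fun x => x * deriv g x := by fun_prop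
  have hm2 : ∀ x, m ≤ |x| → x * deriv g x = 0 := fun x hx => by rw [hm x hx, mul_zero]
  obtain ⟨C1, -, hC1⟩ := exists_bound_of_eq_zero hd hm
  obtain ⟨C2, -, hC2⟩ := exists_bound_of_eq_zero hd2 hm2
  let A : ProbabilityMeasure ℝ → ℝ := fun F => ∫ y, deriv g ((y - t₀) / s₀) ∂(F : Measure ℝ)
  let B : ProbabilityMeasure ℝ → ℝ := fun F =>
    ∫ y, ((y - t₀) / s₀) * deriv g ((y - t₀) / s₀) ∂(F : Measure ℝ)
  have hA : Tendsto A (𝓝 F₀) (𝓝 (A F₀)) :=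
    (continuous_integral_of_bound (g := fun y => deriv g ((y - t₀) / s₀)) (by fun_prop)
      fun x => hC1 _).tendsto F₀
  have hB : Tendsto B (𝓝 F₀) (𝓝 (B F₀)) :=
    (continuous_integral_of_bound (g := fun y => ((y - t₀) / s₀) * deriv g ((y - t₀) / s₀))
      (by fun_prop) fun x => hC2 _).tendsto F₀
  have hi : ∀ (F : ProbabilityMeasure ℝ) t s,
      Integrable (fun y => g ((y - t) / s)) (F : Measure ℝ) := fun F t s =>
    integrable_of_continuous_of_bound (C := C) (by fun_prop) fun x => hC _
  have hi1 : ∀ F : ProbabilityMeasure ℝ,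
      Integrable (fun y => deriv g ((y - t₀) / s₀)) (F : Measure ℝ) := fun F =>
    integrable_locScale hd hm _ _
  have hi2 : ∀ F : ProbabilityMeasure ℝ,
      Integrable (fun y => ((y - t₀) / s₀) * deriv g ((y - t₀) / s₀)) (F : Measure ℝ) := fun F =>
    integrable_locScale hd2 hm2 _ _
  have hderiv : ∀ (F : ProbabilityMeasure ℝ) (v : ℝ × ℝ),
      Integrable (fun y => locScaleDeriv g y (t₀, s₀) v) (F : Measure ℝ) ∧
      ∫ y, locScaleDeriv g y (t₀, s₀) v ∂(F : Measure ℝ) =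
        -(s₀⁻¹ * A F * v.1) - s₀⁻¹ * B F * v.2 := by
    intro F v
    have e : (fun y => locScaleDeriv g y (t₀, s₀) v) = fun y =>
        (-(s₀⁻¹ * v.1)) * deriv g ((y - t₀) / s₀) +
          (-(s₀⁻¹ * v.2)) * (((y - t₀) / s₀) * deriv g ((y - t₀) / s₀)) := by
      ext y
      simp [locScaleDeriv]
      ring
    rw [e]
    refine ⟨((hi1 F).const_mul _).add ((hi2 F).const_mul _), ?_⟩
    rw [integral_add ((hi1 F).const_mul _) ((hi2 F).const_mul _), integral_const_mul,
      integral_const_mul]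
    simp only [A, B]
    ring
  have hTS : Tendsto (fun F => (T F, S F)) (𝓝 F₀) (𝓝 (t₀, s₀)) := hT.prodMk_nhds hS
  -- The pointwise expansion is uniform in `y`, so it survives integration against `F`; the
  -- coefficients `A F` and `B F` still depend on `F`.
  have o1 : (fun F : ProbabilityMeasure ℝ =>
      ∫ y, g ((y - T F) / S F) ∂(F : Measure ℝ) - ∫ y, g ((y - t₀) / s₀) ∂(F : Measure ℝ) +
        s₀⁻¹ * A F * (T F - t₀) + s₀⁻¹ * B F * (S F - s₀)) =o[𝓝 F₀]
      fun F => (T F - t₀, S F - s₀) := by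
    refine Asymptotics.isLittleO_iff.2 fun ε hε => ?_
    filter_upwards [hTS.eventually (eventually_locScale_expansion hg hm t₀ hs₀ hε)] with F hF
    have hv := hderiv F ((T F, S F) - (t₀, s₀))
    have hint : Integrable (fun y => g ((y - T F) / S F) - g ((y - t₀) / s₀)) (F : Measure ℝ) :=
      (hi F (T F) (S F)).sub (hi F t₀ s₀)
    have key := norm_integral_le_of_norm_le_const (μ := (F : Measure ℝ))
      (f := fun y => g ((y - T F) / S F) - g ((y - t₀) / s₀) -
        locScaleDeriv g y (t₀, s₀) ((T F, S F) - (t₀, s₀))) (ae_of_all _ hF)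
    rw [integral_sub hint hv.1,
      integral_sub (hi F (T F) (S F)) (hi F t₀ s₀), hv.2] at key
    simp only [Prod.mk_sub_mk, probReal_univ, mul_one] at key
    refine le_trans (le_of_eq ?_) key
    congr 1
    simp only [A, B]
    ring
  -- Replacing `F` by `F₀` in a coefficient costs `o(1)`, by weak convergence.
  have o2 : (fun F => s₀⁻¹ * (A F₀ - A F) * (T F - t₀)) =o[𝓝 F₀]
      fun F => (T F - t₀, S F - s₀) := by
    have h0 : (fun F => s₀⁻¹ * (A F₀ - A F)) =o[𝓝 F₀] fun _ => (1 : ℝ) := by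
      rw [Asymptotics.isLittleO_one_iff]
      simpa using (hA.const_sub (A F₀)).const_mul s₀⁻¹
    have h1 : (fun F => T F - t₀) =O[𝓝 F₀] fun F => (T F - t₀, S F - s₀) :=
      Asymptotics.isBigO_of_le _ fun F => norm_fst_le (T F - t₀, S F - s₀)
    have := h0.mul_isBigO h1.norm_right
    simp only [one_mul] at this
    exact this.of_norm_right
  have o3 : (fun F => s₀⁻¹ * (B F₀ - B F) * (S F - s₀)) =o[𝓝 F₀]
      fun F => (T F - t₀, S F - s₀) := by
    have h0 : (fun F => s₀⁻¹ * (B F₀ - B F)) =o[𝓝 F₀] fun _ => (1 : ℝ) := by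
      rw [Asymptotics.isLittleO_one_iff]
      simpa using (hB.const_sub (B F₀)).const_mul s₀⁻¹
    have h1 : (fun F => S F - s₀) =O[𝓝 F₀] fun F => (T F - t₀, S F - s₀) :=
      Asymptotics.isBigO_of_le _ fun F => norm_snd_le (T F - t₀, S F - s₀)
    have := h0.mul_isBigO h1.norm_right
    simp only [one_mul] at this
    exact this.of_norm_right
  refine ((o1.add o2).add o3).congr_left fun F => ?_
  simp only [A, B]
  ring

end Differentiability

/-! ### Support of the derivatives and the first-order condition -/

section Derivatives

variable {ρ : ℝ → ℝ} {m : ℝ} (hρ : IsBoundedRho ρ) (hR : LogConcaveRho ρ m)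
include hρ hR

/-- Such an `x` is a global maximum of `ρ`, which covers the boundary `|x| = m` too. -/
lemma deriv_rho_eq_zero {x : ℝ} (hx : m ≤ |x|) : deriv ρ x = 0 := by
  refine IsLocalMax.deriv_eq_zero (Eventually.of_forall fun y => ?_)
  rw [(hR.1 x).2 hx]
  exact hR.le_one hρ y

/-- The margin `1` leaves a neighbourhood on which `deriv ρ` vanishes; any positive margin would do.
-/
lemma deriv_deriv_rho_eq_zero {x : ℝ} (hx : m + 1 ≤ |x|) : deriv (deriv ρ) x = 0 := by
  have h : deriv ρ =ᶠ[𝓝 x] fun _ => 0 := by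
    have hc : Tendsto (fun y : ℝ => |y|) (𝓝 x) (𝓝 |x|) := continuous_abs.tendsto x
    filter_upwards [hc.eventually_const_lt (show m < |x| by linarith)] with y hy
    exact deriv_rho_eq_zero hρ hR hy.le
  rw [h.deriv_eq, deriv_const]

lemma abs_rho_le (x : ℝ) : |ρ x| ≤ 1 := by
  rw [abs_le]
  refine ⟨?_, hR.le_one hρ _⟩
  have := hρ.mono 0 x (by simp)
  rw [hρ.zero] at this
  linarith

/-- The first-order condition for M-functionals of location. -/
lemma integral_deriv_rho_eq_zero (hc : ContDiff ℝ 2 ρ) {F : ProbabilityMeasure ℝ} {s t : ℝ}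
    (hs : 0 < s) (hmin : IsMinOn (mLoss ρ s F) univ t) :
    ∫ u, deriv ρ ((u - t) / s) ∂(F : Measure ℝ) = 0 := by
  have hd : Continuous (deriv ρ) := hc.continuous_deriv one_le_two
  have hdiff : Differentiable ℝ ρ := hc.differentiable two_ne_zero
  have hm : ∀ x, m ≤ |x| → deriv ρ x = 0 := fun x hx => deriv_rho_eq_zero hρ hR hx
  obtain ⟨C, hC0, hC⟩ := exists_bound_of_eq_zero hd hm
  have hD : HasDerivAt (mLoss ρ s F)
      (∫ u, -s⁻¹ * deriv ρ ((u - t) / s) ∂(F : Measure ℝ)) t := by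
    refine (hasDerivAt_integral_of_dominated_loc_of_deriv_le (μ := (F : Measure ℝ))
      (F := fun t u => ρ ((u - t) / s)) (F' := fun t u => -s⁻¹ * deriv ρ ((u - t) / s))
      (bound := fun _ => s⁻¹ * C) (s := univ) univ_mem
      (Eventually.of_forall fun t => (integrable_rho hρ hR F t s).aestronglyMeasurable)
      (integrable_rho hρ hR F t s) ?_ (ae_of_all _ fun u t _ => ?_) (integrable_const _)
      (ae_of_all _ fun u t _ => ?_)).2
    · exact ((integrable_locScale hd hm t s).const_mul _).aestronglyMeasurable
    · rw [norm_mul, norm_neg, Real.norm_of_nonneg (inv_pos.2 hs).le]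
      exact mul_le_mul_of_nonneg_left (hC _) (inv_pos.2 hs).le
    · have h1 : HasDerivAt (fun t : ℝ => (u - t) / s) (-1 / s) t :=
        ((hasDerivAt_id t).const_sub u).div_const s
      have h2 := (hdiff ((u - t) / s)).hasDerivAt.comp t h1
      simp only [Function.comp_def] at h2
      refine h2.congr_deriv ?_
      ring
  have h0 := (hmin.isLocalMin univ_mem).hasDerivAt_eq_zero hD
  rw [integral_const_mul] at h0
  exact (mul_eq_zero.1 h0).resolve_left (neg_ne_zero.2 (inv_ne_zero hs.ne'))

end Derivatives

/-! ### The influence function and the first-order expansion of the joint functional -/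

section Influence

variable {ρ₀ ρ₁ : ℝ → ℝ} {m₀ m₁ δ : ℝ} {F₀ : ProbabilityMeasure ℝ}

lemma continuous_locationInfluence {ρ : ℝ → ℝ} (h₀ : Continuous ρ₀) (h : Continuous (deriv ρ))
    (F : ProbabilityMeasure ℝ) (α₀ α σ : ℝ) :
    Continuous (locationInfluence ρ₀ ρ δ F α₀ α σ) := by
  unfold locationInfluence
  fun_prop

lemma continuous_scaleInfluence (h₀ : Continuous ρ₀) (F : ProbabilityMeasure ℝ) (α₀ σ : ℝ) :
    Continuous (scaleInfluence ρ₀ δ F α₀ σ) := by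
  unfold scaleInfluence
  fun_prop

lemma continuous_jointInfluence (h₀ : Continuous ρ₀) (h₀' : Continuous (deriv ρ₀))
    (h₁' : Continuous (deriv ρ₁)) (F : ProbabilityMeasure ℝ) (α₀ α₁ σ : ℝ) :
    Continuous (jointInfluence ρ₀ ρ₁ δ F α₀ α₁ σ) := by
  refine (PiLp.continuous_toLp 2 _).comp (continuous_pi fun i => ?_)
  fin_cases i
  · exact continuous_locationInfluence h₀ h₀' F _ _ _
  · exact continuous_locationInfluence h₀ h₁' F _ _ _
  · exact continuous_scaleInfluence h₀ F _ _

/-- Bounded `ρ`-functions of class `C²` with log-concave complement. -/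
structure IsSmoothRho (ρ : ℝ → ℝ) (m : ℝ) : Prop where
  bounded : IsBoundedRho ρ
  logConcave : LogConcaveRho ρ m
  contDiff : ContDiff ℝ 2 ρ

namespace IsSmoothRho

variable {ρ : ℝ → ℝ} {m : ℝ} (h : IsSmoothRho ρ m)
include h

lemma contDiff_deriv : ContDiff ℝ 1 (deriv ρ) :=
  (contDiff_succ_iff_deriv (n := 1)).1 h.contDiff |>.2.2

lemma continuous_deriv : Continuous (deriv ρ) := h.contDiff_deriv.continuous

lemma continuous_deriv_deriv : Continuous (deriv (deriv ρ)) :=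
  h.contDiff_deriv.continuous_deriv le_rfl

lemma deriv_zero (x : ℝ) (hx : m ≤ |x|) : deriv ρ x = 0 :=
  deriv_rho_eq_zero h.bounded h.logConcave hx

lemma deriv_deriv_zero (x : ℝ) (hx : m + 1 ≤ |x|) : deriv (deriv ρ) x = 0 :=
  deriv_deriv_rho_eq_zero h.bounded h.logConcave hx

lemma integrable_deriv (F : ProbabilityMeasure ℝ) (t s : ℝ) :
    Integrable (fun u => deriv ρ ((u - t) / s)) (F : Measure ℝ) :=
  integrable_locScale h.continuous_deriv h.deriv_zero t s

lemma integrable_mul_deriv (F : ProbabilityMeasure ℝ) (t s : ℝ) :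
    Integrable (fun u => ((u - t) / s) * deriv ρ ((u - t) / s)) (F : Measure ℝ) :=
  integrable_locScale (g := fun x => x * deriv ρ x) (m := m)
    (by have := h.continuous_deriv; fun_prop)
    (fun x hx => by rw [h.deriv_zero x hx, mul_zero]) t s

lemma integrable_deriv_deriv (F : ProbabilityMeasure ℝ) (t s : ℝ) :
    Integrable (fun u => deriv (deriv ρ) ((u - t) / s)) (F : Measure ℝ) :=
  integrable_locScale h.continuous_deriv_deriv h.deriv_deriv_zero t s

lemma integrable_mul_deriv_deriv (F : ProbabilityMeasure ℝ) (t s : ℝ) :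
    Integrable (fun u => ((u - t) / s) * deriv (deriv ρ) ((u - t) / s)) (F : Measure ℝ) :=
  integrable_locScale (g := fun x => x * deriv (deriv ρ) x) (m := m + 1)
    (by have := h.continuous_deriv_deriv; fun_prop)
    (fun x hx => by rw [h.deriv_deriv_zero x hx, mul_zero]) t s

lemma exists_bound_deriv : ∃ C, 0 ≤ C ∧ ∀ x, |deriv ρ x| ≤ C :=
  exists_bound_of_eq_zero h.continuous_deriv h.deriv_zero

end IsSmoothRho

variable (h₀ : IsSmoothRho ρ₀ m₀) (h₁ : IsSmoothRho ρ₁ m₁)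
include h₀

lemma exists_bound_scaleInfluence (F : ProbabilityMeasure ℝ) (α₀ σ : ℝ) :
    ∃ C, ∀ y, |scaleInfluence ρ₀ δ F α₀ σ y| ≤ C := by
  refine ⟨|σ / dConst ρ₀ F α₀ σ| * (1 + |δ|), fun y => ?_⟩
  unfold scaleInfluence
  rw [abs_mul]
  gcongr
  exact (abs_sub _ _).trans (add_le_add (abs_rho_le h₀.bounded h₀.logConcave _) le_rfl)

lemma exists_bound_locationInfluence {ρ : ℝ → ℝ} {m : ℝ} (h : IsSmoothRho ρ m)
    (F : ProbabilityMeasure ℝ) (α₀ α σ : ℝ) :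
    ∃ C, ∀ y, |locationInfluence ρ₀ ρ δ F α₀ α σ y| ≤ C := by
  obtain ⟨C, hC0, hC⟩ := h.exists_bound_deriv
  refine ⟨|σ / aConst ρ F α σ| * C +
    |eConst ρ F α σ * σ / (aConst ρ F α σ * dConst ρ₀ F α₀ σ)| * (1 + |δ|), fun y => ?_⟩
  unfold locationInfluence
  refine (abs_sub _ _).trans ?_
  rw [abs_mul, abs_mul]
  gcongr
  · exact hC _
  · exact (abs_sub _ _).trans (add_le_add (abs_rho_le h₀.bounded h₀.logConcave _) le_rfl)

include h₁ in
lemma exists_bound_jointInfluence (F : ProbabilityMeasure ℝ) (α₀ α₁ σ : ℝ) :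
    ∃ C, ∀ y i, |jointInfluence ρ₀ ρ₁ δ F α₀ α₁ σ y i| ≤ C := by
  obtain ⟨C0, h0⟩ := exists_bound_locationInfluence (δ := δ) h₀ h₀ F α₀ α₀ σ
  obtain ⟨C1, h1⟩ := exists_bound_locationInfluence (δ := δ) h₀ h₁ F α₀ α₁ σ
  obtain ⟨C2, h2⟩ := exists_bound_scaleInfluence (δ := δ) h₀ F α₀ σ
  refine ⟨max C0 (max C1 C2), fun y i => ?_⟩
  fin_cases i
  · exact (h0 y).trans (le_max_left _ _)
  · exact (h1 y).trans ((le_max_left _ _).trans (le_max_right _ _))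
  · exact (h2 y).trans ((le_max_right _ _).trans (le_max_right _ _))

include h₁ in
lemma integrable_jointInfluence_apply (F F' : ProbabilityMeasure ℝ) (α₀ α₁ σ : ℝ) (i : Fin 3) :
    Integrable (fun y => jointInfluence ρ₀ ρ₁ δ F α₀ α₁ σ y i) (F' : Measure ℝ) := by
  obtain ⟨C, hC⟩ := exists_bound_jointInfluence (δ := δ) h₀ h₁ F α₀ α₁ σ
  have hc := continuous_jointInfluence (δ := δ) h₀.bounded.continuous h₀.continuous_deriv
    h₁.continuous_deriv F α₀ α₁ σ
  exact integrable_of_continuous_of_bound (C := C)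
    ((PiLp.continuous_apply 2 _ i).comp hc) fun x => hC x i

include h₁ in
lemma integrable_jointInfluence (F F' : ProbabilityMeasure ℝ) (α₀ α₁ σ : ℝ) :
    Integrable (jointInfluence ρ₀ ρ₁ δ F α₀ α₁ σ) (F' : Measure ℝ) :=
  Integrable.of_eval_piLp fun i => integrable_jointInfluence_apply h₀ h₁ F F' α₀ α₁ σ i

lemma integral_scaleInfluence (F F' : ProbabilityMeasure ℝ) (α₀ σ : ℝ) :
    ∫ y, scaleInfluence ρ₀ δ F α₀ σ y ∂(F' : Measure ℝ) =
      σ / dConst ρ₀ F α₀ σ * (∫ y, ρ₀ ((y - α₀) / σ) ∂(F' : Measure ℝ) - δ) := by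
  unfold scaleInfluence
  rw [integral_const_mul, integral_sub (integrable_rho h₀.bounded h₀.logConcave _ _ _)
    (integrable_const _)]
  simp

lemma integral_locationInfluence {ρ : ℝ → ℝ} {m : ℝ} (h : IsSmoothRho ρ m)
    (F F' : ProbabilityMeasure ℝ) (α₀ α σ : ℝ) :
    ∫ y, locationInfluence ρ₀ ρ δ F α₀ α σ y ∂(F' : Measure ℝ) =
      σ / aConst ρ F α σ * ∫ y, deriv ρ ((y - α) / σ) ∂(F' : Measure ℝ) -
      eConst ρ F α σ * σ / (aConst ρ F α σ * dConst ρ₀ F α₀ σ) *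
        (∫ y, ρ₀ ((y - α₀) / σ) ∂(F' : Measure ℝ) - δ) := by
  have hi := integrable_rho h₀.bounded h₀.logConcave F' α₀ σ
  have hi' : Integrable (fun y => ρ₀ ((y - α₀) / σ) - δ) (F' : Measure ℝ) :=
    hi.sub (integrable_const _)
  unfold locationInfluence
  rw [integral_sub ((h.integrable_deriv F' α σ).const_mul _)
    (hi'.const_mul _), integral_const_mul, integral_const_mul,
    integral_sub hi (integrable_const _)]
  simp

include h₁

/-- First-order expansion of the joint functional by its influence function along distributions
converging weakly to `F₀`. -/
lemma isLittleO_jointFunctional_sub {TS TMM : ProbabilityMeasure ℝ → ℝ} {σ α₀ α₁ : ℝ}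
    (hδ : δ ∈ Ioo (0 : ℝ) 1) (hTS : IsSFunctional ρ₀ δ TS) (hTMM : IsMMFunctional ρ₀ ρ₁ δ TMM)
    (hσ : scaleFunctional ρ₀ δ F₀ = σ) (hσ0 : 0 < σ) (hα₀ : TS F₀ = α₀) (hα₁ : TMM F₀ = α₁)
    (cS : Tendsto (scaleFunctional ρ₀ δ) (𝓝 F₀) (𝓝 σ)) (cTS : Tendsto TS (𝓝 F₀) (𝓝 α₀))
    (cTMM : Tendsto TMM (𝓝 F₀) (𝓝 α₁))
    (ha₀ : aConst ρ₀ F₀ α₀ σ ≠ 0) (ha₁ : aConst ρ₁ F₀ α₁ σ ≠ 0) (hd : dConst ρ₀ F₀ α₀ σ ≠ 0) :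
    (fun F : ProbabilityMeasure ℝ => jointFunctional ρ₀ δ TS TMM F -
        jointFunctional ρ₀ δ TS TMM F₀ -
        ∫ y, jointInfluence ρ₀ ρ₁ δ F₀ α₀ α₁ σ y ∂(F : Measure ℝ)) =o[𝓝 F₀]
      fun F => ∫ y, jointInfluence ρ₀ ρ₁ δ F₀ α₀ α₁ σ y ∂(F : Measure ℝ) := by
  set X : ProbabilityMeasure ℝ → E3 := fun F => jointFunctional ρ₀ δ TS TMM F -
    jointFunctional ρ₀ δ TS TMM F₀ with hX
  set w : ProbabilityMeasure ℝ → E3 := fun F =>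
    ∫ y, jointInfluence ρ₀ ρ₁ δ F₀ α₀ α₁ σ y ∂(F : Measure ℝ) with hw
  have X0 : ∀ F, X F 0 = TS F - α₀ := fun F => by simp [hX, jointFunctional, hα₀]
  have X1 : ∀ F, X F 1 = TMM F - α₁ := fun F => by simp [hX, jointFunctional, hα₁]
  have X2 : ∀ F, X F 2 = scaleFunctional ρ₀ δ F - σ := fun F => by
    simp [hX, jointFunctional, hσ]
  have hcoord : ∀ i, (fun F => X F i) =O[𝓝 F₀] X := fun i =>
    Asymptotics.isBigO_of_le _ fun F => PiLp.norm_apply_le (X F) i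
  have big0 : (fun F => (TS F - α₀, scaleFunctional ρ₀ δ F - σ)) =O[𝓝 F₀] X :=
    ((hcoord 0).congr_left X0).prod_left ((hcoord 2).congr_left X2)
  have big1 : (fun F => (TMM F - α₁, scaleFunctional ρ₀ δ F - σ)) =O[𝓝 F₀] X :=
    ((hcoord 1).congr_left X1).prod_left ((hcoord 2).congr_left X2)
  have hpos : ∀ᶠ F in 𝓝 F₀, 0 < scaleFunctional ρ₀ δ F := cS.eventually_const_lt hσ0
  have hpos₀ : 0 < scaleFunctional ρ₀ δ F₀ := hσ ▸ hσ0
  -- the three estimating equations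
  have eq0 : ∀ F, 0 < scaleFunctional ρ₀ δ F →
      ∫ y, deriv ρ₀ ((y - TS F) / scaleFunctional ρ₀ δ F) ∂(F : Measure ℝ) = 0 := fun F hF =>
    integral_deriv_rho_eq_zero h₀.bounded h₀.logConcave h₀.contDiff hF
      (hTS.isMinOn h₀.bounded h₀.logConcave F hδ.1 hF)
  have eq1 : ∀ F, 0 < scaleFunctional ρ₀ δ F →
      ∫ y, deriv ρ₁ ((y - TMM F) / scaleFunctional ρ₀ δ F) ∂(F : Measure ℝ) = 0 := fun F hF =>
    integral_deriv_rho_eq_zero h₁.bounded h₁.logConcave h₁.contDiff hF (hTMM F hF)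
  have eq2 : ∀ F, 0 < scaleFunctional ρ₀ δ F →
      ∫ y, ρ₀ ((y - TS F) / scaleFunctional ρ₀ δ F) ∂(F : Measure ℝ) = δ := fun F hF =>
    hTS.mLoss_eq h₀.bounded h₀.logConcave F hδ.1 hF
  have hb : ∫ y, deriv ρ₀ ((y - α₀) / σ) ∂(F₀ : Measure ℝ) = 0 := by
    have := eq0 F₀ hpos₀
    rwa [hσ, hα₀] at this
  obtain ⟨C0, -, hC0⟩ := h₀.exists_bound_deriv
  obtain ⟨C1, -, hC1⟩ := h₁.exists_bound_deriv
  have r0 := (isLittleO_integral_locScale h₀.contDiff_deriv h₀.deriv_deriv_zero hC0 hσ0 cTS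
    cS).trans_isBigO big0
  have r1 := (isLittleO_integral_locScale h₁.contDiff_deriv h₁.deriv_deriv_zero hC1 hσ0 cTMM
    cS).trans_isBigO big1
  have r2 := (isLittleO_integral_locScale (h₀.contDiff.of_le one_le_two) h₀.deriv_zero
    (abs_rho_le h₀.bounded h₀.logConcave) hσ0 cTS cS).trans_isBigO big0
  have w_apply : ∀ F i, w F i =
      ∫ y, jointInfluence ρ₀ ρ₁ δ F₀ α₀ α₁ σ y i ∂(F : Measure ℝ) := fun F i =>
    eval_integral_piLp (fun i => integrable_jointInfluence_apply h₀ h₁ F₀ F α₀ α₁ σ i) i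
  have w0 : ∀ F, w F 0 = _ := fun F =>
    (w_apply F 0).trans (integral_locationInfluence (δ := δ) h₀ h₀ F₀ F α₀ α₀ σ)
  have w1 : ∀ F, w F 1 = _ := fun F =>
    (w_apply F 1).trans (integral_locationInfluence (δ := δ) h₀ h₁ F₀ F α₀ α₁ σ)
  have w2 : ∀ F, w F 2 = _ := fun F =>
    (w_apply F 2).trans (integral_scaleInfluence (δ := δ) h₀ F₀ F α₀ σ)
  -- The location increment drops out of the scale equation, since `ψ₀` has mean zero at `F₀`.
  rw [hb] at r2
  have hσne := hσ0.ne'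
  have o2 : (fun F => X F 2 - w F 2) =o[𝓝 F₀] X := by
    refine (r2.const_mul_left (σ / dConst ρ₀ F₀ α₀ σ)).congr' ?_ EventuallyEq.rfl
    filter_upwards [hpos] with F hF
    rw [eq2 F hF, X2, w2, ← dConst]
    field_simp
    ring
  have location : ∀ {ρ : ℝ → ℝ} {T : ProbabilityMeasure ℝ → ℝ} {α : ℝ} {i : Fin 3},
      aConst ρ F₀ α σ ≠ 0 → (∀ F, X F i = T F - α) →
      (∀ F, 0 < scaleFunctional ρ₀ δ F →
        ∫ y, deriv ρ ((y - T F) / scaleFunctional ρ₀ δ F) ∂(F : Measure ℝ) = 0) →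
      (∀ F : ProbabilityMeasure ℝ, w F i =
        σ / aConst ρ F₀ α σ * ∫ y, deriv ρ ((y - α) / σ) ∂(F : Measure ℝ) -
        eConst ρ F₀ α σ * σ / (aConst ρ F₀ α σ * dConst ρ₀ F₀ α₀ σ) *
        (∫ y, ρ₀ ((y - α₀) / σ) ∂(F : Measure ℝ) - δ)) →
      ((fun F : ProbabilityMeasure ℝ =>
        ∫ y, deriv ρ ((y - T F) / scaleFunctional ρ₀ δ F) ∂(F : Measure ℝ) -
          ∫ y, deriv ρ ((y - α) / σ) ∂(F : Measure ℝ) +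
          σ⁻¹ * (∫ y, deriv (deriv ρ) ((y - α) / σ) ∂(F₀ : Measure ℝ)) * (T F - α) +
          σ⁻¹ * (∫ y, ((y - α) / σ) * deriv (deriv ρ) ((y - α) / σ) ∂(F₀ : Measure ℝ)) *
            (scaleFunctional ρ₀ δ F - σ)) =o[𝓝 F₀] X) →
      (fun F => X F i - w F i) =o[𝓝 F₀] X := by
    intro ρ T α i ha hXi heq hwi hr
    -- These coefficients solve the linearized location equation for `T F - α`, and `o2` eliminates
    -- the scale increment.
    refine ((hr.const_mul_left (σ / aConst ρ F₀ α σ)).sub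
      (o2.const_mul_left (eConst ρ F₀ α σ / aConst ρ F₀ α σ))).congr' ?_ EventuallyEq.rfl
    filter_upwards [hpos] with F hF
    rw [heq F hF, hXi, hwi, X2, w2, ← aConst, ← eConst]
    field_simp
    ring
  have o0 := location ha₀ X0 eq0 w0 r0
  have o1 := location ha₁ X1 eq1 w1 r1
  have hXw : (fun F => X F - w F) =o[𝓝 F₀] X := by
    refine ((EuclideanSpace.equiv (Fin 3) ℝ).isBigO_comp_rev _ _).trans_isLittleO
      (Asymptotics.isLittleO_pi.2 fun i => ?_)
    fin_cases i
    · exact o0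
    · exact o1
    · exact o2
  -- A remainder negligible against `X` makes `w` and `X` equivalent, hence is negligible against
  -- `w` as well.
  have hequiv : Asymptotics.IsEquivalent (𝓝 F₀) w X := by
    refine hXw.neg_left.congr_left fun F => ?_
    simp
  exact hequiv.symm

end Influence

/-! ### The expected Jacobian of the score -/

section Jacobian

variable {ρ₀ ρ₁ : ℝ → ℝ} {m₀ m₁ δ : ℝ} {F₀ : ProbabilityMeasure ℝ}

lemma hasFDerivAt_locScale_euclidean {g : ℝ → ℝ} (hg : Differentiable ℝ g) (y : ℝ) (i : Fin 3)
    {θ : E3} (hθ : 0 < θ 2) :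
    HasFDerivAt (fun θ : E3 => g ((y - θ i) / θ 2))
      ((locScaleDeriv g y (θ i, θ 2)).comp
        ((EuclideanSpace.proj i : E3 →L[ℝ] ℝ).prod (EuclideanSpace.proj 2))) θ := by
  have h := hasFDerivAt_locScale hg y (p := (θ i, θ 2)) hθ
  have hL := ((EuclideanSpace.proj i : E3 →L[ℝ] ℝ).prod
    (EuclideanSpace.proj 2 : E3 →L[ℝ] ℝ)).hasFDerivAt (x := θ)
  exact HasFDerivAt.comp (g := fun p : ℝ × ℝ => g ((y - p.1) / p.2))
    (f := fun θ : E3 => (θ i, θ 2)) θ h hL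

variable (h₀ : IsSmoothRho ρ₀ m₀) (h₁ : IsSmoothRho ρ₁ m₁)
include h₀ h₁

/-- The vectors `![deriv ρ₀, deriv ρ₁, ρ₀]` and `![0, 1, 0]` list the function and the location
coordinate of each component, so one formula handles all three rows. -/
lemma hasFDerivAt_score_apply (y : ℝ) {θ : E3} (hθ : 0 < θ 2) (j : Fin 3) :
    HasFDerivAt (fun θ => score ρ₀ ρ₁ δ y θ j)
      ((locScaleDeriv (![deriv ρ₀, deriv ρ₁, ρ₀] j) y (θ (![0, 1, 0] j), θ 2)).comp
        ((EuclideanSpace.proj (![0, 1, 0] j) : E3 →L[ℝ] ℝ).prod (EuclideanSpace.proj 2))) θ := by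
  fin_cases j
  · exact hasFDerivAt_locScale_euclidean (h₀.contDiff_deriv.differentiable one_ne_zero) y 0 hθ
  · exact hasFDerivAt_locScale_euclidean (h₁.contDiff_deriv.differentiable one_ne_zero) y 1 hθ
  · exact (hasFDerivAt_locScale_euclidean (h₀.contDiff.differentiable two_ne_zero) y 0
      hθ).sub_const δ

lemma differentiableAt_score (y : ℝ) {θ : E3} (hθ : 0 < θ 2) :
    DifferentiableAt ℝ (score ρ₀ ρ₁ δ y) θ :=
  differentiableAt_euclidean.2 fun j => (hasFDerivAt_score_apply h₀ h₁ y hθ j).differentiableAt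

lemma scoreJacobian_apply (y : ℝ) {θ : E3} (hθ : 0 < θ 2) (j k : Fin 3) :
    scoreJacobian ρ₀ ρ₁ δ y θ j k =
      locScaleDeriv (![deriv ρ₀, deriv ρ₁, ρ₀] j) y (θ (![0, 1, 0] j), θ 2)
        ((EuclideanSpace.single k (1 : ℝ) : E3) (![0, 1, 0] j),
          (EuclideanSpace.single k (1 : ℝ) : E3) 2) := by
  have h1 := ((EuclideanSpace.proj j : E3 →L[ℝ] ℝ).hasFDerivAt.comp θ
    (differentiableAt_score (δ := δ) h₀ h₁ y hθ).hasFDerivAt)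
  have h2 := h1.unique (hasFDerivAt_score_apply (δ := δ) h₀ h₁ y hθ j)
  exact congrArg (fun L : E3 →L[ℝ] ℝ => L (EuclideanSpace.single k 1)) h2

lemma integrable_score_deriv (F : ProbabilityMeasure ℝ) (j : Fin 3) (t s : ℝ) :
    Integrable (fun u => deriv (![deriv ρ₀, deriv ρ₁, ρ₀] j) ((u - t) / s)) (F : Measure ℝ) ∧
      Integrable (fun u => ((u - t) / s) * deriv (![deriv ρ₀, deriv ρ₁, ρ₀] j) ((u - t) / s))
        (F : Measure ℝ) := by
  fin_cases j
  · exact ⟨h₀.integrable_deriv_deriv F _ _, h₀.integrable_mul_deriv_deriv F _ _⟩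
  · exact ⟨h₁.integrable_deriv_deriv F _ _, h₁.integrable_mul_deriv_deriv F _ _⟩
  · exact ⟨h₀.integrable_deriv F _ _, h₀.integrable_mul_deriv F _ _⟩

omit h₀ h₁ in
lemma integrable_locScaleDeriv {g : ℝ → ℝ} {F : ProbabilityMeasure ℝ} {p : ℝ × ℝ} (v : ℝ × ℝ)
    (h1 : Integrable (fun u => deriv g ((u - p.1) / p.2)) (F : Measure ℝ))
    (h2 : Integrable (fun u => ((u - p.1) / p.2) * deriv g ((u - p.1) / p.2)) (F : Measure ℝ)) :
    Integrable (fun y => locScaleDeriv g y p v) (F : Measure ℝ) ∧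
      ∫ y, locScaleDeriv g y p v ∂(F : Measure ℝ) =
        -p.2⁻¹ * (v.1 * ∫ u, deriv g ((u - p.1) / p.2) ∂(F : Measure ℝ) +
          v.2 * ∫ u, ((u - p.1) / p.2) * deriv g ((u - p.1) / p.2) ∂(F : Measure ℝ)) := by
  have e : (fun y => locScaleDeriv g y p v) = fun y =>
      (-p.2⁻¹ * v.1) * deriv g ((y - p.1) / p.2) +
        (-p.2⁻¹ * v.2) * (((y - p.1) / p.2) * deriv g ((y - p.1) / p.2)) := by
    ext y
    simp [locScaleDeriv]
    ring
  rw [e]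
  refine ⟨(h1.const_mul _).add (h2.const_mul _), ?_⟩
  rw [integral_add (h1.const_mul _) (h2.const_mul _), integral_const_mul, integral_const_mul]
  ring

lemma integrable_scoreJacobian (F : ProbabilityMeasure ℝ) {θ : E3} (hθ : 0 < θ 2) (j k : Fin 3) :
    Integrable (fun y => scoreJacobian ρ₀ ρ₁ δ y θ j k) (F : Measure ℝ) := by
  simp_rw [scoreJacobian_apply h₀ h₁ _ hθ]
  obtain ⟨h1, h2⟩ := integrable_score_deriv h₀ h₁ F j (θ (![0, 1, 0] j)) (θ 2)
  exact (integrable_locScaleDeriv _ h1 h2).1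

lemma expectedJacobian_apply (F : ProbabilityMeasure ℝ) {θ : E3} (hθ : 0 < θ 2) (j k : Fin 3) :
    expectedJacobian ρ₀ ρ₁ δ F θ j k = -(θ 2)⁻¹ *
      ((EuclideanSpace.single k (1 : ℝ) : E3) (![0, 1, 0] j) *
        ∫ u, deriv (![deriv ρ₀, deriv ρ₁, ρ₀] j) ((u - θ (![0, 1, 0] j)) / θ 2)
          ∂(F : Measure ℝ) +
        (EuclideanSpace.single k (1 : ℝ) : E3) 2 *
        ∫ u, ((u - θ (![0, 1, 0] j)) / θ 2) *
          deriv (![deriv ρ₀, deriv ρ₁, ρ₀] j) ((u - θ (![0, 1, 0] j)) / θ 2)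
          ∂(F : Measure ℝ)) := by
  rw [expectedJacobian, Matrix.of_apply]
  simp_rw [scoreJacobian_apply h₀ h₁ _ hθ]
  obtain ⟨h1, h2⟩ := integrable_score_deriv h₀ h₁ F j (θ (![0, 1, 0] j)) (θ 2)
  exact (integrable_locScaleDeriv (p := (θ (![0, 1, 0] j), θ 2)) _ h1 h2).2

lemma expectedJacobian_eq (F : ProbabilityMeasure ℝ) {θ : E3} (hθ : 0 < θ 2) :
    expectedJacobian ρ₀ ρ₁ δ F θ = (-(θ 2)⁻¹) •
      !![aConst ρ₀ F (θ 0) (θ 2), 0, eConst ρ₀ F (θ 0) (θ 2);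
        0, aConst ρ₁ F (θ 1) (θ 2), eConst ρ₁ F (θ 1) (θ 2);
        ∫ u, deriv ρ₀ ((u - θ 0) / θ 2) ∂(F : Measure ℝ), 0, dConst ρ₀ F (θ 0) (θ 2)] := by
  ext j k
  rw [expectedJacobian_apply h₀ h₁ F hθ]
  fin_cases j <;> fin_cases k <;> simp [aConst, eConst, dConst]

/-- The vanishing mean of `ψ₀` makes the matrix upper triangular, with diagonal `a₀`, `a₁`, `d` up
to the scalar `-1/σ`. -/
lemma isUnit_expectedJacobian (F : ProbabilityMeasure ℝ) {θ : E3} (hθ : 0 < θ 2)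
    (hb : ∫ u, deriv ρ₀ ((u - θ 0) / θ 2) ∂(F : Measure ℝ) = 0)
    (ha₀ : aConst ρ₀ F (θ 0) (θ 2) ≠ 0) (ha₁ : aConst ρ₁ F (θ 1) (θ 2) ≠ 0)
    (hd : dConst ρ₀ F (θ 0) (θ 2) ≠ 0) : IsUnit (expectedJacobian ρ₀ ρ₁ δ F θ) := by
  rw [Matrix.isUnit_iff_isUnit_det, expectedJacobian_eq h₀ h₁ F hθ, hb, Matrix.det_smul,
    isUnit_iff_ne_zero]
  refine mul_ne_zero (pow_ne_zero _ (neg_ne_zero.2 (inv_ne_zero hθ.ne'))) ?_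
  rw [Matrix.det_fin_three]
  simp [ha₀, ha₁, hd]

end Jacobian

/-! ### Contamination by a point mass -/

section Contamination

lemma integral_contaminate {E : Type*} [NormedAddCommGroup E] [NormedSpace ℝ E] [CompleteSpace E]
    {F : ProbabilityMeasure ℝ} {g : ℝ → E} (hg : Integrable g (F : Measure ℝ))
    (hgm : StronglyMeasurable g) (z ε : ℝ) :
    ∫ y, g y ∂(contaminate F z ε : Measure ℝ) =
      (1 - max 0 (min 1 ε)) • ∫ y, g y ∂(F : Measure ℝ) + max 0 (min 1 ε) • g z := by
  have h0 : 0 ≤ max 0 (min 1 ε) := le_max_left _ _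
  have h1 : 0 ≤ 1 - max 0 (min 1 ε) := sub_nonneg.2 (max_le zero_le_one (min_le_left _ _))
  have hz : Integrable g (Measure.dirac z) :=
    ⟨hgm.aestronglyMeasurable, by
      simp [HasFiniteIntegral, lintegral_dirac' _ hgm.enorm]⟩
  change ∫ y, g y ∂(ENNReal.ofReal (1 - max 0 (min 1 ε)) • (F : Measure ℝ) +
      ENNReal.ofReal (max 0 (min 1 ε)) • Measure.dirac z) = _
  rw [integral_add_measure (hg.smul_measure ENNReal.ofReal_ne_top)
    (hz.smul_measure ENNReal.ofReal_ne_top), integral_smul_measure, integral_smul_measure,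
    ENNReal.toReal_ofReal h0, ENNReal.toReal_ofReal h1, integral_dirac' _ _ hgm]

lemma contaminate_zero (F : ProbabilityMeasure ℝ) (z : ℝ) : contaminate F z 0 = F := by
  apply Subtype.ext
  simp [contaminate]

lemma tendsto_contaminate (F : ProbabilityMeasure ℝ) (z : ℝ) :
    Tendsto (contaminate F z) (𝓝 0) (𝓝 F) := by
  rw [ProbabilityMeasure.tendsto_iff_forall_integral_tendsto]
  intro g
  have hg : Integrable g (F : Measure ℝ) := g.integrable _
  simp_rw [integral_contaminate hg g.continuous.stronglyMeasurable]
  have hc : Continuous fun ε : ℝ => (1 - max 0 (min 1 ε)) • ∫ y, g y ∂(F : Measure ℝ) +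
      max 0 (min 1 ε) • g z := by fun_prop
  simpa using hc.tendsto 0

/-- A first-order expansion by the mean of a centred bounded function identifies it as the
influence function. -/
lemma hasInfluenceFunction_of_isLittleO {T : ProbabilityMeasure ℝ → E3} {F₀ : ProbabilityMeasure ℝ}
    {I : ℝ → E3} (hc : Continuous I) (hi : Integrable I (F₀ : Measure ℝ))
    (h0 : ∫ y, I y ∂(F₀ : Measure ℝ) = 0)
    (h : (fun F : ProbabilityMeasure ℝ => T F - T F₀ - ∫ y, I y ∂(F : Measure ℝ)) =o[𝓝 F₀]
      fun F => ∫ y, I y ∂(F : Measure ℝ)) : HasInfluenceFunction T F₀ I := by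
  intro z
  rw [hasDerivWithinAt_iff_isLittleO]
  have hlim : Tendsto (contaminate F₀ z) (𝓝[Ici 0] 0) (𝓝 F₀) :=
    (tendsto_contaminate F₀ z).mono_left nhdsWithin_le_nhds
  -- Centring makes the contaminated mean exactly linear in `ε`; near `0` from the right the
  -- projection to `[0, 1]` is inactive.
  have e : ∀ᶠ ε : ℝ in 𝓝[Ici 0] 0,
      ∫ y, I y ∂(contaminate F₀ z ε : Measure ℝ) = ε • I z := by
    have h1 : ∀ᶠ ε : ℝ in 𝓝[Ici 0] 0, ε < 1 := nhdsWithin_le_nhds (gt_mem_nhds one_pos)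
    filter_upwards [h1, self_mem_nhdsWithin] with ε h1 h2
    rw [integral_contaminate hi hc.stronglyMeasurable, h0, min_eq_right h1.le,
      max_eq_right h2]
    simp
  have key := h.comp_tendsto hlim
  have hO : (fun ε : ℝ => ε • I z) =O[𝓝[Ici 0] 0] fun ε : ℝ => ε :=
    Asymptotics.isBigO_of_le' (c := ‖I z‖) _ fun ε => by rw [norm_smul, mul_comm]
  refine ((key.congr' ?_ e).trans_isBigO hO).congr_right fun ε => by simp
  filter_upwards [e] with ε he
  simp only [Function.comp_apply]
  rw [he, contaminate_zero, sub_zero]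

end Contamination

/-! ### From the weak expansion to remainders in probability -/

section StochasticOrder

/-- The weak topology is induced by integrals of bounded continuous functions, each of which is
measurable. Measurable neighbourhoods are needed to pass from almost sure convergence to the
probability of leaving them. -/
lemma nhds_probabilityMeasure_isMeasurablyGenerated (F₀ : ProbabilityMeasure ℝ) :
    (𝓝 F₀).IsMeasurablyGenerated := by
  let J : BoundedContinuousFunction ℝ NNReal → ProbabilityMeasure ℝ → ℝ≥0∞ :=
    fun g F => ∫⁻ u, g u ∂(F : Measure ℝ)
  have e : 𝓝 F₀ = ⨅ g, comap (J g) (𝓝 (J g F₀)) := by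
    apply le_antisymm
    · refine le_iInf fun g => tendsto_iff_comap.1 ?_
      exact ProbabilityMeasure.tendsto_iff_forall_lintegral_tendsto.1 tendsto_id g
    · refine (ProbabilityMeasure.tendsto_iff_forall_lintegral_tendsto (μs := id)).2 fun g => ?_
      exact tendsto_comap.mono_left (iInf_le _ g)
  have hJ : ∀ g, Measurable (J g) := fun g =>
    (Measure.measurable_lintegral
      (ENNReal.continuous_coe.comp g.continuous).measurable).comp measurable_subtype_coe
  rw [e]
  refine @Filter.iInf_isMeasurablyGenerated _ _ _ _ fun g => ⟨fun s hs => ?_⟩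
  obtain ⟨t, ht, hts⟩ := mem_comap.1 hs
  obtain ⟨t', ht', hm, hsub⟩ := IsMeasurablyGenerated.exists_measurable_subset ht
  exact ⟨J g ⁻¹' t', preimage_mem_comap ht', hJ g hm, (preimage_mono hsub).trans hts⟩

variable {Ω : Type*} [MeasurableSpace Ω] {P : Measure Ω} [IsProbabilityMeasure P]
  {F : ℕ → Ω → ProbabilityMeasure ℝ} {F₀ : ProbabilityMeasure ℝ}

lemma tendsto_measure_notMem (hF : ∀ n, Measurable (F n))
    (hlim : ∀ᵐ ω ∂P, Tendsto (fun n => F n ω) atTop (𝓝 F₀)) {V : Set (ProbabilityMeasure ℝ)}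
    (hV : V ∈ 𝓝 F₀) (hVm : MeasurableSet V) :
    Tendsto (fun n => P {ω | F n ω ∉ V}) atTop (𝓝 0) := by
  rw [← measure_empty (μ := P)]
  refine tendsto_measure_of_ae_tendsto_indicator_of_isFiniteMeasure atTop MeasurableSet.empty
    (fun n => hF n hVm.compl) ?_
  filter_upwards [hlim] with ω hω
  filter_upwards [hω hV] with n hn
  simpa using hn

/-- A remainder that is negligible with respect to a statistic near `F₀` is negligible in
probability when the scaled statistic converges in distribution. -/
lemma tendstoInMeasure_smul_of_isLittleO (hF : ∀ n, Measurable (F n))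
    (hlim : ∀ᵐ ω ∂P, Tendsto (fun n => F n ω) atTop (𝓝 F₀))
    {R w : ProbabilityMeasure ℝ → E3} (h : R =o[𝓝 F₀] w) {c : ℕ → ℝ}
    {H : Measure E3} [IsProbabilityMeasure H]
    (hH : TendstoInDistribution (fun n ω => c n • w (F n ω)) atTop id (fun _ => P) H) :
    TendstoInMeasure P (fun n ω => c n • R (F n ω)) atTop (fun _ => 0) := by
  rw [tendstoInMeasure_iff_norm]
  intro ε hε
  rw [ENNReal.tendsto_nhds_zero]
  intro η hη
  have hη2 : 0 < η / 2 := ENNReal.half_pos hη.ne'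
  obtain ⟨M, hM0, hM⟩ : ∃ M : ℝ, 0 < M ∧ H {x | M ≤ ‖x‖} < η / 2 := by
    have ht := isTightMeasureSet_iff_tendsto_measure_norm_gt.1
      (isTightMeasureSet_singleton (μ := H))
    simp only [mem_singleton_iff, iSup_iSup_eq_left] at ht
    obtain ⟨r, hr, hr0⟩ := ((ht.eventually_lt_const hη2).and (eventually_ge_atTop 0)).exists
    -- The shift to `r + 1` passes from an open tail to a closed one, as the portmanteau bound
    -- requires, and makes `M` positive.
    refine ⟨r + 1, by linarith, (measure_mono fun x hx => ?_).trans_lt hr⟩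
    simp only [mem_ofPred_eq] at hx ⊢
    linarith
  have hcl : IsClosed {x : E3 | M ≤ ‖x‖} := isClosed_le continuous_const continuous_norm
  have h1 : ∀ᶠ n in atTop, P {ω | M ≤ ‖c n • w (F n ω)‖} < η / 2 := by
    have hle := ProbabilityMeasure.limsup_measure_closed_le_of_tendsto hH.tendsto hcl
    have := eventually_lt_of_limsup_lt (hle.trans_lt (by simpa using hM))
    filter_upwards [this] with n hn
    refine lt_of_le_of_lt (le_of_eq ?_) hn
    exact (Measure.map_apply_of_aemeasurable (hH.forall_aemeasurable n) hcl.measurableSet).symm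
  have := nhds_probabilityMeasure_isMeasurablyGenerated F₀
  obtain ⟨V, hV, hVm, hVR⟩ := (h.def (div_pos hε hM0)).exists_measurable_mem
  have h2 := (tendsto_measure_notMem hF hlim hV hVm).eventually_lt_const hη2
  filter_upwards [h1, h2] with n hn1 hn2
  calc P {ω | ε ≤ ‖c n • R (F n ω) - 0‖}
      ≤ P ({ω | M ≤ ‖c n • w (F n ω)‖} ∪ {ω | F n ω ∉ V}) := by
        refine measure_mono fun ω hω => ?_
        by_contra hcon
        simp only [mem_union, mem_ofPred_eq, not_or, not_le, not_not, sub_zero] at hcon hω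
        have hb := hVR _ hcon.2
        have : ‖c n • R (F n ω)‖ ≤ ε / M * ‖c n • w (F n ω)‖ := by
          rw [norm_smul, norm_smul, mul_left_comm]
          exact mul_le_mul_of_nonneg_left hb (norm_nonneg _)
        have h3 : ε / M * ‖c n • w (F n ω)‖ < ε / M * M :=
          mul_lt_mul_of_pos_left hcon.1 (div_pos hε hM0)
        rw [div_mul_cancel₀ _ hM0.ne'] at h3
        linarith
    _ ≤ η / 2 + η / 2 := (measure_union_le _ _).trans (add_le_add hn1.le hn2.le)
    _ = η := ENNReal.add_halves η

/-- Asymptotic linearity and the limit law of a functional with a first-order expansion. -/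
lemma tendstoInMeasure_scaledError_sub {T : ProbabilityMeasure ℝ → E3} {I : ℝ → E3}
    (hT : (fun F : ProbabilityMeasure ℝ => T F - T F₀ - ∫ y, I y ∂(F : Measure ℝ)) =o[𝓝 F₀]
      fun F => ∫ y, I y ∂(F : Measure ℝ))
    (hF : ∀ n, Measurable (F n))
    (hlim : ∀ᵐ ω ∂P, Tendsto (fun n => F n ω) atTop (𝓝 F₀))
    {H : Measure E3} [IsProbabilityMeasure H]
    (hH : TendstoInDistribution (fun n ω => scaledInfluence I (fun k => F k ω) n) atTop id
      (fun _ => P) H) :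
    TendstoInMeasure P (fun n ω => scaledError T F₀ (fun k => F k ω) n -
      scaledInfluence I (fun k => F k ω) n) atTop (fun _ => 0) := by
  have := tendstoInMeasure_smul_of_isLittleO hF hlim hT hH
  simpa only [scaledError, scaledInfluence, ← smul_sub] using this

lemma tendstoInDistribution_scaledError {T : ProbabilityMeasure ℝ → E3} {I : ℝ → E3}
    (hT : (fun F : ProbabilityMeasure ℝ => T F - T F₀ - ∫ y, I y ∂(F : Measure ℝ)) =o[𝓝 F₀]
      fun F => ∫ y, I y ∂(F : Measure ℝ))
    (hF : ∀ n, Measurable (F n))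
    (hlim : ∀ᵐ ω ∂P, Tendsto (fun n => F n ω) atTop (𝓝 F₀))
    {H : Measure E3} [IsProbabilityMeasure H]
    (hH : TendstoInDistribution (fun n ω => scaledInfluence I (fun k => F k ω) n) atTop id
      (fun _ => P) H)
    (hTm : ∀ n, AEMeasurable (fun ω => T (F n ω)) P) :
    TendstoInDistribution (fun n ω => scaledError T F₀ (fun k => F k ω) n) atTop id
      (fun _ => P) H :=
  tendstoInDistribution_of_tendstoInMeasure_sub _ _ hH
    (tendstoInMeasure_scaledError_sub hT hF hlim hH)
    fun n => ((hTm n).sub_const (T F₀)).const_smul (Real.sqrt n)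

end StochasticOrder

/-! ### Empirical distributions and their almost sure weak convergence -/

section Empirical

lemma coe_empirical (x : ℕ → ℝ) {n : ℕ} (hn : n ≠ 0) : (empirical x n : Measure ℝ) =
    (n : ℝ≥0∞)⁻¹ • ∑ i ∈ Finset.range n, Measure.dirac (x i) := by
  unfold empirical
  exact congrArg Subtype.val (dif_neg hn)

lemma integral_empirical {E : Type*} [NormedAddCommGroup E] [NormedSpace ℝ E] [CompleteSpace E]
    (g : ℝ → E) (x : ℕ → ℝ) {n : ℕ} (hn : n ≠ 0) :
    ∫ y, g y ∂(empirical x n : Measure ℝ) = (n : ℝ)⁻¹ • ∑ i ∈ Finset.range n, g (x i) := by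
  rw [coe_empirical x hn, integral_smul_measure, integral_finsetSum_measure]
  · simp
  · exact fun i _ => integrable_dirac (by simp)

lemma scaledInfluence_empirical (I : ℝ → E3) (x : ℕ → ℝ) (n : ℕ) :
    scaledInfluence I (empirical x) n = (Real.sqrt n)⁻¹ • ∑ i ∈ Finset.range n, I (x i) := by
  rcases eq_or_ne n 0 with rfl | hn
  · simp [scaledInfluence]
  · have hn' : (0 : ℝ) < n := by positivity
    rw [scaledInfluence, integral_empirical I x hn, smul_smul]
    congr 1
    have := Real.mul_self_sqrt hn'.le
    have h0 : Real.sqrt n ≠ 0 := (Real.sqrt_pos.2 hn').ne'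
    field_simp
    rw [sq, this]

variable {Ω : Type*} [MeasurableSpace Ω] {P : Measure Ω} [IsProbabilityMeasure P]
  {X : ℕ → Ω → ℝ} {F₀ : ProbabilityMeasure ℝ}

omit [IsProbabilityMeasure P] in
lemma measurable_empirical (hX : ∀ i, Measurable (X i)) (n : ℕ) :
    Measurable fun ω => empirical (fun i => X i ω) n := by
  refine measurable_comap_iff.2 ?_
  rcases eq_or_ne n 0 with rfl | hn
  · exact measurable_const
  · have e : (Subtype.val ∘ fun ω => empirical (fun i => X i ω) n) = fun ω =>
        (n : ℝ≥0∞)⁻¹ • ∑ i ∈ Finset.range n, Measure.dirac (X i ω) :=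
      funext fun ω => coe_empirical _ hn
    refine e ▸ Measure.measurable_of_measurable_coe _ fun s hs => ?_
    simp only [Measure.coe_smul, Measure.coe_finsetSum, Pi.smul_apply, Finset.sum_apply,
      smul_eq_mul]
    refine Measurable.const_mul (Finset.measurable_fun_sum _ fun i _ => ?_) _
    exact (Measure.measurable_coe hs).comp (Measure.measurable_dirac.comp (hX i))

/-- The empirical distributions of i.i.d. observations converge weakly, almost surely. -/
lemma tendsto_empirical (hX : ∀ i, Measurable (X i)) (hind : iIndepFun X P)
    (hlaw : ∀ i, P.map (X i) = (F₀ : Measure ℝ)) :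
    ∀ᵐ ω ∂P, Tendsto (fun n => empirical (fun i => X i ω) n) atTop (𝓝 F₀) := by
  have key : ∀ s : Set ℝ, MeasurableSet s → ∀ᵐ ω ∂P,
      Tendsto (fun n => (empirical (fun i => X i ω) n) s) atTop (𝓝 (F₀ s)) := by
    intro s hs
    have hm : Measurable (s.indicator (1 : ℝ → ℝ)) := measurable_one.indicator hs
    have hslln := strong_law_ae_real (μ := P) (fun i ω => s.indicator (1 : ℝ → ℝ) (X i ω))
      (Integrable.of_bound (hm.comp (hX 0)).aestronglyMeasurable 1
        (ae_of_all _ fun ω => by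
          by_cases h : X 0 ω ∈ s <;> simp [h]))
      (fun i j hij => (hind.indepFun hij).comp hm hm)
      (fun i => (IdentDistrib.mk (hX i).aemeasurable (hX 0).aemeasurable
        ((hlaw i).trans (hlaw 0).symm)).comp hm)
    have hmean : ∫ ω, s.indicator (1 : ℝ → ℝ) (X 0 ω) ∂P = (F₀ s : ℝ) := by
      rw [← integral_map (f := s.indicator (1 : ℝ → ℝ)) (hX 0).aemeasurable
        hm.aestronglyMeasurable, hlaw 0, integral_indicator_one hs]
      rfl
    filter_upwards [hslln] with ω hω
    rw [hmean] at hω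
    rw [← NNReal.tendsto_coe]
    refine hω.congr' ?_
    filter_upwards [eventually_ne_atTop 0] with n hn
    have h1 := integral_empirical (s.indicator (1 : ℝ → ℝ)) (fun i => X i ω) hn
    rw [integral_indicator_one hs] at h1
    refine Eq.trans ?_ h1.symm
    rw [smul_eq_mul, div_eq_inv_mul]
  -- Countably many rational intervals share one almost sure event, and they form a
  -- convergence-determining π-system.
  have hall : ∀ᵐ ω ∂P, ∀ p q : ℚ,
      Tendsto (fun n => (empirical (fun i => X i ω) n) (Ioo (p : ℝ) q)) atTop
        (𝓝 (F₀ (Ioo (p : ℝ) q))) :=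
    ae_all_iff.2 fun p => ae_all_iff.2 fun q => key _ measurableSet_Ioo
  filter_upwards [hall] with ω hω
  refine Real.isPiSystem_Ioo_rat.tendsto_probabilityMeasure_of_tendsto_of_mem ?_ ?_ ?_
  · intro s hs
    simp only [mem_iUnion, mem_singleton_iff] at hs
    obtain ⟨p, q, -, rfl⟩ := hs
    exact measurableSet_Ioo
  · intro u hu x hx
    obtain ⟨s, hs, hxs, hsu⟩ := Real.isTopologicalBasis_Ioo_rat.exists_subset_of_mem_open hx hu
    exact ⟨s, hs, (Real.isTopologicalBasis_Ioo_rat.isOpen hs).mem_nhds hxs, hsu⟩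
  · intro s hs
    simp only [mem_iUnion, mem_singleton_iff] at hs
    obtain ⟨p, q, -, rfl⟩ := hs
    exact hω p q

end Empirical

/-! ### The central limit theorem for the influence function -/

section CentralLimit

variable {F₀ : ProbabilityMeasure ℝ} {I : ℝ → E3} {C : ℝ}

lemma integrable_mul_of_bound (hc : Continuous I) (hb : ∀ y i, |I y i| ≤ C) (j k : Fin 3) :
    Integrable (fun y => I y j * I y k) (F₀ : Measure ℝ) := by
  refine Integrable.of_bound (by fun_prop) (C * C) (ae_of_all _ fun y => ?_)
  rw [norm_mul]
  exact mul_le_mul (hb y j) (hb y k) (abs_nonneg _) ((abs_nonneg _).trans (hb y j))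

/-- The quadratic form of the covariance of the influence function. -/
lemma dotProduct_influenceCovariance (hc : Continuous I) (hb : ∀ y i, |I y i| ≤ C)
    (t : Fin 3 → ℝ) :
    t ⬝ᵥ (influenceCovariance F₀ I).mulVec t =
      ∫ y, (∑ i, t i * I y i) ^ 2 ∂(F₀ : Measure ℝ) := by
  have e : ∀ y, (∑ i, t i * I y i) ^ 2 = ∑ j, ∑ k, t j * t k * (I y j * I y k) := fun y => by
    rw [sq, Finset.sum_mul_sum]
    exact Finset.sum_congr rfl fun j _ => Finset.sum_congr rfl fun k _ => by ring
  have hi := fun j k => (integrable_mul_of_bound (F₀ := F₀) hc hb j k).const_mul (t j * t k)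
  simp_rw [e]
  rw [integral_finsetSum _ fun j _ => integrable_finsetSum _ fun k _ => hi j k]
  simp_rw [integral_finsetSum _ fun k _ => hi _ k, integral_const_mul]
  simp only [dotProduct, Matrix.mulVec, influenceCovariance, Matrix.of_apply, Finset.mul_sum]
  exact Finset.sum_congr rfl fun j _ => Finset.sum_congr rfl fun k _ => by ring

lemma posSemidef_influenceCovariance (hc : Continuous I) (hb : ∀ y i, |I y i| ≤ C) :
    (influenceCovariance F₀ I).PosSemidef := by
  refine Matrix.posSemidef_iff_dotProduct_mulVec.2 ⟨?_, fun t => ?_⟩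
  · ext j k
    simp [influenceCovariance, mul_comm]
  · rw [star_trivial, dotProduct_influenceCovariance hc hb]
    exact integral_nonneg fun y => sq_nonneg _

variable {Ω : Type*} [MeasurableSpace Ω] {P : Measure Ω} [IsProbabilityMeasure P] {X : ℕ → Ω → ℝ}

/-- The central limit theorem for the normalized sums of a bounded centred function of i.i.d.
observations. -/
lemma tendstoInDistribution_scaledInfluence_empirical (hc : Continuous I)
    (hb : ∀ y i, |I y i| ≤ C) (h0 : ∫ y, I y ∂(F₀ : Measure ℝ) = 0)
    (hX : ∀ i, Measurable (X i)) (hind : iIndepFun X P)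
    (hlaw : ∀ i, P.map (X i) = (F₀ : Measure ℝ)) :
    TendstoInDistribution (fun n ω => scaledInfluence I (empirical (fun i => X i ω)) n) atTop id
      (fun _ => P) (multivariateGaussian 0 (influenceCovariance F₀ I)) := by
  have hm : ∀ n, Measurable fun ω => scaledInfluence I (empirical (fun i => X i ω)) n := by
    intro n
    simp_rw [scaledInfluence_empirical]
    exact Measurable.const_smul (Finset.measurable_fun_sum _ fun i _ =>
      hc.measurable.comp (hX i)) (Real.sqrt n)⁻¹
  refine ⟨fun n => (hm n).aemeasurable, aemeasurable_id, ?_⟩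
  refine ProbabilityMeasure.tendsto_iff_tendsto_charFun.2 fun t => ?_
  set g : ℝ → ℝ := fun y => ∑ i, t i * I y i with hg
  have hgc : Continuous g := by fun_prop
  have hinner : ∀ y, inner ℝ (I y) t = g y := fun y => by
    simp [PiLp.inner_apply, hg]
  have hI : Integrable I (F₀ : Measure ℝ) := by
    refine Integrable.of_eval_piLp fun i => ?_
    exact Integrable.of_bound (by fun_prop) C (ae_of_all _ fun y => hb y i)
  have hgb : ∀ y, ‖g y‖ ≤ ∑ i, |t i| * C := fun y =>
    (norm_sum_le _ _).trans (Finset.sum_le_sum fun i _ => by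
      rw [norm_mul]
      exact mul_le_mul_of_nonneg_left (hb y i) (abs_nonneg _))
  have hg0 : ∫ y, g y ∂(F₀ : Measure ℝ) = 0 := by
    simp_rw [← hinner, real_inner_comm t]
    rw [integral_inner hI, h0, inner_zero_right]
  have hmap : ∀ h : ℝ → ℝ, Continuous h → ∫ ω, h (X 0 ω) ∂P = ∫ y, h y ∂(F₀ : Measure ℝ) := by
    intro h hh
    rw [← hlaw 0, integral_map (hX 0).aemeasurable hh.aestronglyMeasurable]
  have hvar : Var[fun ω => g (X 0 ω); P] = t ⬝ᵥ (influenceCovariance F₀ I).mulVec t := by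
    rw [variance_of_integral_eq_zero (X := fun ω => g (X 0 ω))
      (hgc.measurable.comp (hX 0)).aemeasurable ((hmap g hgc).trans hg0), dotProduct_influenceCovariance hc hb]
    exact hmap (fun y => g y ^ 2) (hgc.pow 2)
  -- Cramér–Wold: the scalar limit theorem for the projection on `t`, read at frequency `1`, gives
  -- the characteristic function of the vector at `t`.
  have clt := tendstoInDistribution_inv_sqrt_mul_sum_sub (P := P)
    (X := fun i ω => g (X i ω)) (HasLaw.id (μ := gaussianReal 0 _))
    (MemLp.of_bound (hgc.measurable.comp (hX 0)).aestronglyMeasurable _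
      (ae_of_all _ fun ω => hgb (X 0 ω)))
    (hind.comp (fun _ => g) fun _ => hgc.measurable)
    (fun i => (IdentDistrib.mk (hX i).aemeasurable (hX 0).aemeasurable
        ((hlaw i).trans (hlaw 0).symm)).comp hgc.measurable)
  have hchar := ProbabilityMeasure.tendsto_iff_tendsto_charFun.1 clt.tendsto 1
  have hlim : charFun (gaussianReal 0 Var[fun ω => g (X 0 ω); P].toNNReal) 1 =
      charFun (multivariateGaussian 0 (influenceCovariance F₀ I)) t := by
    rw [charFun_gaussianReal,
      charFun_multivariateGaussian (posSemidef_influenceCovariance hc hb),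
      Real.coe_toNNReal _ (variance_nonneg _ _), hvar]
    simp
  have hpre : ∀ n : ℕ, charFun (P.map fun ω => (Real.sqrt n)⁻¹ *
        (∑ k ∈ Finset.range n, g (X k ω) - n * ∫ ω, g (X 0 ω) ∂P)) 1 =
      charFun (P.map fun ω => scaledInfluence I (empirical (fun i => X i ω)) n) t := by
    intro n
    rw [charFun_apply_real, charFun_apply, integral_map (clt.forall_aemeasurable n)
      (by fun_prop), integral_map (hm n).aemeasurable (by fun_prop)]
    refine integral_congr_ae (ae_of_all _ fun ω => ?_)
    simp only
    rw [scaledInfluence_empirical, real_inner_smul_left, sum_inner,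
      (hmap g hgc).trans hg0]
    simp_rw [hinner]
    simp
  have h1 := hchar
  simp only [ProbabilityMeasure.coe_mk, Measure.map_id] at h1 ⊢
  rw [hlim] at h1
  exact h1.congr hpre

end CentralLimit

/-- The influence function of the joint functional is centred. -/
lemma integral_jointInfluence_eq_zero {ρ₀ ρ₁ : ℝ → ℝ} {m₀ m₁ δ : ℝ} (h₀ : IsSmoothRho ρ₀ m₀)
    (h₁ : IsSmoothRho ρ₁ m₁) {F : ProbabilityMeasure ℝ} {α₀ α₁ σ : ℝ} (hσ : 0 < σ)
    (hm₀ : IsMinOn (mLoss ρ₀ σ F) univ α₀) (hm₁ : IsMinOn (mLoss ρ₁ σ F) univ α₁)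
    (hδ : mLoss ρ₀ σ F α₀ = δ) :
    ∫ y, jointInfluence ρ₀ ρ₁ δ F α₀ α₁ σ y ∂(F : Measure ℝ) = 0 := by
  have e₀ := integral_deriv_rho_eq_zero h₀.bounded h₀.logConcave h₀.contDiff hσ hm₀
  have e₁ := integral_deriv_rho_eq_zero h₁.bounded h₁.logConcave h₁.contDiff hσ hm₁
  have e₂ : ∫ y, ρ₀ ((y - α₀) / σ) ∂(F : Measure ℝ) - δ = 0 := sub_eq_zero.2 hδ
  ext i
  rw [eval_integral_piLp (fun i => integrable_jointInfluence_apply h₀ h₁ F F α₀ α₁ σ i)]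
  fin_cases i
  · refine (integral_locationInfluence h₀ h₀ F F α₀ α₀ σ).trans ?_
    rw [e₀, e₂]
    simp
  · refine (integral_locationInfluence h₀ h₁ F F α₀ α₁ σ).trans ?_
    rw [e₁, e₂]
    simp
  · refine (integral_scaleInfluence h₀ F F α₀ σ).trans ?_
    rw [e₂]
    simp

end RobustLocation

/-! ### The main theorem -/

open RobustLocation

theorem theorem8
    (ρ₀ ρ₁ f : ℝ → ℝ) (m₀ m₁ a δ : ℝ) (F₀ : ProbabilityMeasure ℝ)
    (TS TMM : ProbabilityMeasure ℝ → ℝ)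
    (hδ : δ ∈ Ioo (0 : ℝ) 1)
    (hρ₀ : IsBoundedRho ρ₀) (hρ₁ : IsBoundedRho ρ₁)
    (hR1₀ : LogConcaveRho ρ₀ m₀) (hR1₁ : LogConcaveRho ρ₁ m₁)
    (hle : ∀ u, ρ₁ u ≤ ρ₀ u)
    (hf : IsDensity F₀ f) (hfu : StronglyUnimodal f a)
    (hstrict : (StrictLogConcaveRho ρ₀ m₀ ∧ StrictLogConcaveRho ρ₁ m₁) ∨ StrictOnSupport f a)
    (hTS : IsSFunctional ρ₀ δ TS) (hTMM : IsMMFunctional ρ₀ ρ₁ δ TMM) :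
    ∃ α₀₀ α₀₁ σ₀ : ℝ,
      -- the scale at `F₀` is positive and solves its defining equation
      (σ₀ = scaleFunctional ρ₀ δ F₀ ∧ 0 < σ₀ ∧ mLoss ρ₀ σ₀ F₀ α₀₀ = δ) ∧
      -- uniqueness and Fisher consistency of the S functional
      ((∀ t, IsMinOn (mLoss ρ₀ σ₀ F₀) univ t ↔ t = α₀₀) ∧
        (∀ t, IsMinOn (residualScale ρ₀ δ F₀) univ t ↔ t = α₀₀) ∧
        TS F₀ = α₀₀ ∧ ∀ μ₀, IsSymmetricAround F₀ μ₀ → α₀₀ = μ₀) ∧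
      -- uniqueness and Fisher consistency of the MM functional
      ((∀ t, IsMinOn (mLoss ρ₁ σ₀ F₀) univ t ↔ t = α₀₁) ∧
        TMM F₀ = α₀₁ ∧ ∀ μ₀, IsSymmetricAround F₀ μ₀ → α₀₁ = μ₀) ∧
      -- weak continuity
      ContinuousAt (jointFunctional ρ₀ δ TS TMM) F₀ ∧
      (ContDiff ℝ 2 ρ₀ → ContDiff ℝ 2 ρ₁ →
        aConst ρ₀ F₀ α₀₀ σ₀ ≠ 0 → aConst ρ₁ F₀ α₀₁ σ₀ ≠ 0 → dConst ρ₀ F₀ α₀₀ σ₀ ≠ 0 →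
        -- invertible derivative matrix and influence function
        ((∀ y, DifferentiableAt ℝ (score ρ₀ ρ₁ δ y) (jointFunctional ρ₀ δ TS TMM F₀)) ∧
          (∀ j k, Integrable
            (fun y => scoreJacobian ρ₀ ρ₁ δ y (jointFunctional ρ₀ δ TS TMM F₀) j k)
            (F₀ : Measure ℝ)) ∧
          IsUnit (expectedJacobian ρ₀ ρ₁ δ F₀ (jointFunctional ρ₀ δ TS TMM F₀)) ∧
          HasInfluenceFunction (jointFunctional ρ₀ δ TS TMM) F₀
            (jointInfluence ρ₀ ρ₁ δ F₀ α₀₀ α₀₁ σ₀)) ∧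
        -- almost sure weak differentiability
        (∀ {Ω : Type*} [MeasurableSpace Ω] (P : Measure Ω) [IsProbabilityMeasure P]
          (F : ℕ → Ω → ProbabilityMeasure ℝ), (∀ n, Measurable (F n)) →
          (∀ᵐ ω ∂P, Tendsto (fun n => F n ω) atTop (𝓝 F₀)) →
          ∀ᵐ ω ∂P, WeaklyDifferentiableAt (jointFunctional ρ₀ δ TS TMM) F₀
            (jointInfluence ρ₀ ρ₁ δ F₀ α₀₀ α₀₁ σ₀) (fun n => F n ω)) ∧
        -- asymptotic expansion and limit law
        (∀ {Ω : Type*} [MeasurableSpace Ω] (P : Measure Ω) [IsProbabilityMeasure P]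
          (F : ℕ → Ω → ProbabilityMeasure ℝ), (∀ n, Measurable (F n)) →
          (∀ᵐ ω ∂P, Tendsto (fun n => F n ω) atTop (𝓝 F₀)) →
          ∀ (H : Measure E3) [IsProbabilityMeasure H],
          TendstoInDistribution
            (fun n ω => scaledInfluence (jointInfluence ρ₀ ρ₁ δ F₀ α₀₀ α₀₁ σ₀)
              (fun k => F k ω) n) atTop id (fun _ => P) H →
          TendstoInMeasure P
            (fun n ω => scaledError (jointFunctional ρ₀ δ TS TMM) F₀ (fun k => F k ω) n -
              scaledInfluence (jointInfluence ρ₀ ρ₁ δ F₀ α₀₀ α₀₁ σ₀) (fun k => F k ω) n)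
            atTop (fun _ => 0) ∧
          ((∀ n, AEMeasurable (fun ω => jointFunctional ρ₀ δ TS TMM (F n ω)) P) →
            TendstoInDistribution
              (fun n ω => scaledError (jointFunctional ρ₀ δ TS TMM) F₀ (fun k => F k ω) n)
              atTop id (fun _ => P) H)) ∧
        -- asymptotic normality for i.i.d. observations
        (∀ {Ω : Type*} [MeasurableSpace Ω] (P : Measure Ω) [IsProbabilityMeasure P]
          (X : ℕ → Ω → ℝ), (∀ i, Measurable (X i)) → iIndepFun X P →
          (∀ i, P.map (X i) = (F₀ : Measure ℝ)) →
          TendstoInDistribution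
            (fun n ω => scaledInfluence (jointInfluence ρ₀ ρ₁ δ F₀ α₀₀ α₀₁ σ₀)
              (empirical (fun i => X i ω)) n) atTop id (fun _ => P)
            (multivariateGaussian 0
              (influenceCovariance F₀ (jointInfluence ρ₀ ρ₁ δ F₀ α₀₀ α₀₁ σ₀))) ∧
          TendstoInMeasure P
            (fun n ω => scaledError (jointFunctional ρ₀ δ TS TMM) F₀
                (empirical (fun i => X i ω)) n -
              scaledInfluence (jointInfluence ρ₀ ρ₁ δ F₀ α₀₀ α₀₁ σ₀)
                (empirical (fun i => X i ω)) n)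
            atTop (fun _ => 0) ∧
          ((∀ n, AEMeasurable
              (fun ω => jointFunctional ρ₀ δ TS TMM (empirical (fun i => X i ω) n)) P) →
            TendstoInDistribution
              (fun n ω => scaledError (jointFunctional ρ₀ δ TS TMM) F₀
                (empirical (fun i => X i ω)) n) atTop id (fun _ => P)
              (multivariateGaussian 0
                (influenceCovariance F₀
                  (jointInfluence ρ₀ ρ₁ δ F₀ α₀₀ α₀₁ σ₀)))))) := by
  have hF : NullSingletonClass (F₀ : Measure ℝ) := hf.nullSingletonClass
  have hσ : 0 < scaleFunctional ρ₀ δ F₀ := by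
    rw [hTS.scale_eq F₀]
    exact residualScale_pos hρ₀ hR1₀ F₀ _ hF hδ
  have hstrict₀ := hstrict.imp And.left id
  have hstrict₁ := hstrict.imp And.right id
  have hmin₀ := hTS.isMinOn hρ₀ hR1₀ F₀ hδ.1 hσ
  have hmin₁ := hTMM F₀ hσ
  have huniq₀ : ∀ t, IsMinOn (mLoss ρ₀ (scaleFunctional ρ₀ δ F₀) F₀) univ t → t = TS F₀ :=
    fun t ht => eq_of_isMinOn_mLoss hρ₀ hR1₀ hf hfu hstrict₀ hσ ht hmin₀
  have huniq₁ : ∀ t, IsMinOn (mLoss ρ₁ (scaleFunctional ρ₀ δ F₀) F₀) univ t → t = TMM F₀ :=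
    fun t ht => eq_of_isMinOn_mLoss hρ₁ hR1₁ hf hfu hstrict₁ hσ ht hmin₁
  have hiff₀ : ∀ t, IsMinOn (mLoss ρ₀ (scaleFunctional ρ₀ δ F₀) F₀) univ t ↔ t = TS F₀ :=
    fun t => ⟨huniq₀ t, fun h => h ▸ hmin₀⟩
  have hiff₁ : ∀ t, IsMinOn (mLoss ρ₁ (scaleFunctional ρ₀ δ F₀) F₀) univ t ↔ t = TMM F₀ :=
    fun t => ⟨huniq₁ t, fun h => h ▸ hmin₁⟩
  have hval := hTS.mLoss_eq hρ₀ hR1₀ F₀ hδ.1 hσ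
  have cS := hTS.tendsto_scaleFunctional hρ₀ hR1₀ hδ hF
  have cTS := tendsto_S_functional hδ hρ₀ hR1₀ hF hTS huniq₀
  have cTMM := tendsto_MM_functional hδ hρ₀ hρ₁ hR1₀ hR1₁ hle hF hTS hTMM huniq₁
  have hcont := continuousAt_jointFunctional cS cTS cTMM
  refine ⟨TS F₀, TMM F₀, scaleFunctional ρ₀ δ F₀, ⟨rfl, hσ, hval⟩,
    ⟨hiff₀, hTS.isMinOn_residualScale_iff hρ₀ hR1₀ hδ.1 hσ huniq₀, rfl,
      fun μ₀ hμ => eq_center_of_isSymmetricAround hρ₀ hiff₀ hμ⟩,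
    ⟨hiff₁, rfl, fun μ₀ hμ => eq_center_of_isSymmetricAround hρ₁ hiff₁ hμ⟩, hcont, ?_⟩
  intro hc₀ hc₁ ha₀ ha₁ hd
  have h₀ : IsSmoothRho ρ₀ m₀ := ⟨hρ₀, hR1₀, hc₀⟩
  have h₁ : IsSmoothRho ρ₁ m₁ := ⟨hρ₁, hR1₁, hc₁⟩
  have hθ : 0 < jointFunctional ρ₀ δ TS TMM F₀ 2 := hσ
  -- An expansion along the whole weak neighbourhood filter, so it applies to contaminations, sample
  -- paths and random sequences alike.
  have hexp := isLittleO_jointFunctional_sub h₀ h₁ hδ hTS hTMM rfl hσ rfl rfl cS cTS cTMM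
    ha₀ ha₁ hd
  have hIc : Continuous
      (jointInfluence ρ₀ ρ₁ δ F₀ (TS F₀) (TMM F₀) (scaleFunctional ρ₀ δ F₀)) :=
    continuous_jointInfluence hρ₀.continuous h₀.continuous_deriv h₁.continuous_deriv _ _ _ _
  have hI0 := integral_jointInfluence_eq_zero h₀ h₁ hσ hmin₀ hmin₁ hval
  have hinf := hasInfluenceFunction_of_isLittleO hIc
    (integrable_jointInfluence h₀ h₁ F₀ F₀ _ _ _) hI0 hexp
  refine ⟨⟨fun y => differentiableAt_score h₀ h₁ y hθ,
    fun j k => integrable_scoreJacobian h₀ h₁ F₀ hθ j k,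
    isUnit_expectedJacobian h₀ h₁ F₀ hθ
      (integral_deriv_rho_eq_zero hρ₀ hR1₀ hc₀ hσ hmin₀) ha₀ ha₁ hd, hinf⟩, ?_, ?_, ?_⟩
  · intro Ω _ P _ F _ hlim
    filter_upwards [hlim] with ω hω
    exact ⟨hcont, hω, hinf, fun n => integrable_jointInfluence h₀ h₁ F₀ (F n ω) _ _ _,
      hexp.comp_tendsto hω⟩
  · intro Ω _ P _ F hFm hlim H _ hH
    exact ⟨tendstoInMeasure_scaledError_sub hexp hFm hlim hH,
      fun hT => tendstoInDistribution_scaledError hexp hFm hlim hH hT⟩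
  · intro Ω _ P _ X hX hind hlaw
    obtain ⟨C, hC⟩ := exists_bound_jointInfluence (δ := δ) h₀ h₁ F₀ (TS F₀) (TMM F₀)
      (scaleFunctional ρ₀ δ F₀)
    have hH := tendstoInDistribution_scaledInfluence_empirical hIc hC hI0 hX hind hlaw
    have hFm := measurable_empirical hX
    have hlim := tendsto_empirical hX hind hlaw
    exact ⟨hH, tendstoInMeasure_scaledError_sub (F := fun n ω => empirical (fun i => X i ω) n)
        hexp hFm hlim hH,
      fun hT => tendstoInDistribution_scaledError
        (F := fun n ω => empirical (fun i => X i ω) n) hexp hFm hlim hH hT⟩
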